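/- Let $\Sigma$ be a closed connected oriented smooth surface (for instance of genus $g\ge 2$; no restriction on the genus is needed), with a fixed reference complex structure compatible with the orientation, local holomorphic coordinates $z$ and canonical bundle $K$. Let $p=\partial_z$, $\bar p=\partial_{\bar z}$ be the induced linear coordinates on the fibres of $T^{*\mathbb C}\Sigma$, so that the polynomial functions on a fibre form $\mathbb C[p,\bar p]$. Teichmüller space $\mathcal T(\Sigma)$ is the set of compatible complex structures on $\Sigma$, i.e. of smooth sections $\mu_2$ of $K^{-1}\otimes\bar K$ with $|\mu_2|<1$ (the $(0,1)$-direction being spanned by $\bar\partial-\mu_2\partial$), modulo the diffeomorphisms of $\Sigma$ smoothly isotopic to the identity. For $n\ge 2$, an $n$-complex structure is a smooth family of ideals $I(z)\subset\mathbb C[p,\bar p]$ of codimension $n$, supported at the origin, such that $I(z)+\overline{I}(z)=\langle p,\bar p\rangle$ for all $z$. It is compatible if $I(z)=\langle p^n,-\bar p+\mu_2p+\dots+\mu_np^{n-1}\rangle$ with $|\mu_2|<1$ for all $z$; it is then denoted $(\mu_2,\dots,\mu_n)$. A higher diffeomorphism is the time-one map of the flow on $T^*\Sigma$ of a smooth,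 possibly time-dependent Hamiltonian that vanishes on the zero-section. It acts on $n$-complex structures by transporting the complex-valued smooth functions on $T^*\Sigma$ whose fibrewise Taylor expansion along the zero-section lies in $I$. The moduli space $\hat{\mathcal T}^n$ is the set of compatible $n$-complex structures modulo higher diffeomorphisms. **Claim 1.** For every $n\ge2$ the map $\mathcal T(\Sigma)\to\hat{\mathcal T}^n$, $[\mu_2]\mapsto[(\mu_2,0,\dots,0)]$, is well defined and injective. Let $\mathfrak g$ be a classical simple complex Lie algebra of rank $r$: $\mathfrak{sl}_{r+1}$ ($r\ge1$), $\mathfrak{so}_{2r+1}$ ($r\ge1$), $\mathfrak{sp}_{2r}$ ($r\ge1$) or $\mathfrak{so}_{2r}$ ($r\ge3$), with its standard representation on $\mathbb C^m$. A $\mathfrak g$-complex structure is a smooth family of ideals $I(z)\subset\mathbb C[p,\bar p]$ of codimension $m$, supported at the origin, invariant under $(p,\bar p)\mapsto(-p,-\bar p)$ if $\mathfrak g$ is not of type $A$, such that $I(z)+\overline I(z)$ equals $\langle p,\bar p\rangle$ in types $A,B,C$ and $\langle p,\bar p\rangle^2$ in type $D$. It is compatible if, with some $|\mu_2|<1$,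 $I(z)=\langle p^m,-\bar p+\mu_2p+\dots+\mu_mp^{m-1}\rangle$ in types $A,B,C$, and $I(z)=\langle p^{2r-1},\,p\bar p-\sum_{i=1}^{r-1}\mu_{2i}p^{2i},\,\bar p^2-\sum_{i=1}^{r-1}\nu_{2i}p^{2i}\rangle$ in type $D$. Higher diffeomorphisms of type $\mathfrak g$ are those defined above in type $A$; in the other types they are the time-one maps of the flows of Hamiltonians that are odd in the fibres of $T^*\Sigma$ at all times. The moduli space $\hat{\mathcal T}_{\mathfrak g}$ is the set of compatible $\mathfrak g$-complex structures modulo higher diffeomorphisms of type $\mathfrak g$. For a commuting pair $(A,B)$ of nilpotent elements of $\mathfrak g$ with $A$ regular, the idealic map gives the ideal $I(A,B)=\{P\in\mathbb C[x,y] : P(A,B)=0\}$ if $(A,B)$ has a cyclic vector in $\mathbb C^m$; otherwise (which happens in type $D$ only) it gives the limit for $t\to0$ of the ideals $I(A,B+tS)$, where $S\in\mathfrak g$ commutes with $A$ and $(A,B+tS)$ is cyclic for all $t\ne0$. Let $\rho:\mathfrak{sl}_2\to\mathfrak g$ be the principal map and $f\in\mathfrak{sl}_2$ the standard lower triangular nilpotent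 element. **Claim 2.** For every such $\mathfrak g$ and all $z$ and $\mu_2$, the pair $(\rho(f),\rho(\mu_2(z)f))$ consists of commuting nilpotent elements whose common centralizer has dimension $r$, at least one of them being regular; its images under the idealic map form a compatible $\mathfrak g$-complex structure $I_{\mu_2}$ (with $x=p$, $y=\bar p$); and the map $\mathcal T(\Sigma)\to\hat{\mathcal T}_{\mathfrak g}$, $[\mu_2]\mapsto[I_{\mu_2}]$, is well defined and injective. -/

import Mathlib

open scoped Manifold ContDiff Topology
open Bundle

namespace HigherTeich

attribute [local instance] LieRing.ofAssociativeRing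

noncomputable section

/-! ## The surface and its cotangent bundle

A surface is a space `S` with an atlas of holomorphic charts (the reference complex structure). At a
point `z` the tangent space is `ℂ`, through the preferred chart at `z`. -/

theorem contDiffGroupoid_restrict : contDiffGroupoid ω 𝓘(ℂ, ℂ) ≤ contDiffGroupoid ω 𝓘(ℝ, ℂ) := by
  intro e he
  have he' := (mem_groupoid_of_pregroupoid (PG := contDiffPregroupoid ω 𝓘(ℂ, ℂ))).1 he
  refine (mem_groupoid_of_pregroupoid (PG := contDiffPregroupoid ω 𝓘(ℝ, ℂ))).2 ?_
  simp [contDiffPregroupoid] at he' ⊢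
  exact ⟨he'.1.restrict_scalars ℝ, he'.2.restrict_scalars ℝ⟩

/-- The real-analytic (hence smooth) structure underlying a complex structure. -/
instance realManifold (S : Type*) [TopologicalSpace S] [ChartedSpace ℂ S]
    [h : IsManifold 𝓘(ℂ) ω S] : IsManifold 𝓘(ℝ, ℂ) ω S where
  compatible he he' := contDiffGroupoid_restrict (h.compatible he he')

/-- The real cotangent bundle of `S`. -/
abbrev Cotangent (S : Type*) [TopologicalSpace S] [ChartedSpace ℂ S] [IsManifold 𝓘(ℂ) ω S] : Type _ :=
  TotalSpace (ℂ →L[ℝ] ℝ) (fun z : S => TangentSpace 𝓘(ℝ, ℂ) z →L[ℝ] Trivial S ℝ z)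

/-- The model of the cotangent bundle as a real manifold. -/
abbrev IT := 𝓘(ℝ, ℂ).prod 𝓘(ℝ, ℂ →L[ℝ] ℝ)

/-- The diffeomorphisms of `S`. -/
abbrev Diffeo (S : Type*) [TopologicalSpace S] [ChartedSpace ℂ S] : Type _ :=
  Diffeomorph 𝓘(ℝ, ℂ) 𝓘(ℝ, ℂ) S S ∞

section Surface

variable {S : Type*} [TopologicalSpace S] [ChartedSpace ℂ S] [IsManifold 𝓘(ℂ) ω S]

/-- The covector `ξ` at the point `z`. -/
def covector (z : S) (ξ : ℂ →L[ℝ] ℝ) : Cotangent S := ⟨z, ξ⟩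

/-- The coordinate `p` on the cotangent fibre, `p = ∂ = (∂_x - i ∂_y) / 2`. -/
def pCoord (ξ : ℂ →L[ℝ] ℝ) : ℂ := ((ξ 1 : ℂ) - Complex.I * (ξ Complex.I : ℂ)) / 2

/-- The coordinate `p̄` on the cotangent fibre, `p̄ = ∂̄ = (∂_x + i ∂_y) / 2`. -/
def pbarCoord (ξ : ℂ →L[ℝ] ℝ) : ℂ := ((ξ 1 : ℂ) + Complex.I * (ξ Complex.I : ℂ)) / 2

/-! ## Teichmüller space -/

/-- A Beltrami differential `μ` with `|μ| < 1`, that is, a complex structure compatible with the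
orientation: a smooth section of `K⁻¹ ⊗ K̄`, written at `z` in the preferred chart at `z`. Sections
of `K⁻¹ ⊗ K̄` are the conjugate-linear bundle endomorphisms `v ↦ μ v̄` of the tangent bundle. -/
structure Beltrami (S : Type*) [TopologicalSpace S] [ChartedSpace ℂ S] [IsManifold 𝓘(ℂ) ω S] where
  toFun : S → ℂ
  norm_lt_one : ∀ z, ‖toFun z‖ < 1
  smooth : ContMDiff 𝓘(ℝ, ℂ).tangent 𝓘(ℝ, ℂ).tangent ∞
    (fun v : TangentBundle 𝓘(ℝ, ℂ) S =>
      (⟨v.proj, (toFun v.proj * (starRingEnd ℂ) (show ℂ from v.snd) : ℂ)⟩ :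
        TangentBundle 𝓘(ℝ, ℂ) S))

/-- `f` is smoothly isotopic to the identity, through diffeomorphisms. -/
def IsotopicToId (f : Diffeo S) : Prop :=
  ∃ G : ℝ → Diffeo S,
    ContMDiff (𝓘(ℝ, ℝ).prod 𝓘(ℝ, ℂ)) 𝓘(ℝ, ℂ) ∞ (fun q : ℝ × S => G q.1 q.2) ∧
    (∀ z, G 0 z = z) ∧ G 1 = f

/-- The `(0,1)`-vector `∂̄ - m ∂` in the complexified tangent space, as a complex-valued linear
function on covectors. -/
def vector01 (m : ℂ) (ξ : ℂ →L[ℝ] ℝ) : ℂ := pbarCoord ξ - m * pCoord ξ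

/-- The differential of `f` at `z`, in the preferred charts at `z` and `f z`. -/
def differential (f : Diffeo S) (z : S) : ℂ →L[ℝ] ℂ := mfderiv 𝓘(ℝ, ℂ) 𝓘(ℝ, ℂ) f z

/-- `f` identifies the complex structure `μ` with `μ'`: its complexified differential maps the
`(0,1)`-direction of `μ` at each `z` to the `(0,1)`-direction of `μ'` at `f z`. -/
def Identifies (f : Diffeo S) (μ μ' : Beltrami S) : Prop :=
  ∀ z, ∃ c : ℂ, ∀ ξ : ℂ →L[ℝ] ℝ,
    vector01 (μ.toFun z) (ξ.comp (differential f z)) = c * vector01 (μ'.toFun (f z)) ξ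

/-- Teichmüller space: compatible complex structures modulo the diffeomorphisms isotopic to the
identity. -/
def Teichmuller (S : Type*) [TopologicalSpace S] [ChartedSpace ℂ S] [IsManifold 𝓘(ℂ) ω S] : Type _ :=
  Quot (fun μ μ' : Beltrami S => ∃ f : Diffeo S, IsotopicToId f ∧ Identifies f μ μ')

/-- The class of a complex structure in Teichmüller space. -/
def Teichmuller.mk (μ : Beltrami S) : Teichmuller S := Quot.mk _ μ

/-! ## Higher diffeomorphisms -/

/-- The canonical symplectic form `dq ∧ dp` of the cotangent bundle. The preferred chart of the
cotangent bundle at `x` is the canonical (Darboux) chart induced by the preferred chart of `S`, and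
tangent vectors at `x` are pairs (component along `S`, component along the fibre) in this chart. -/
def symplecticForm (x : Cotangent S) (w w' : TangentSpace IT x) : ℝ :=
  (show ℂ × (ℂ →L[ℝ] ℝ) from w').2 (show ℂ × (ℂ →L[ℝ] ℝ) from w).1 -
    (show ℂ × (ℂ →L[ℝ] ℝ) from w).2 (show ℂ × (ℂ →L[ℝ] ℝ) from w').1

/-- `φ` is the flow, starting at the identity, of the time-dependent Hamiltonian `H` on the cotangent
bundle: `dH_t = ω(∂φ_t/∂t, ·)` at `φ_t(x)`. -/
structure IsHamiltonianFlow (H : ℝ → Cotangent S → ℝ)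
    (φ : ℝ → Diffeomorph IT IT (Cotangent S) (Cotangent S) ∞) : Prop where
  smooth_hamiltonian :
    ContMDiff (𝓘(ℝ, ℝ).prod IT) 𝓘(ℝ, ℝ) ∞ (fun q : ℝ × Cotangent S => H q.1 q.2)
  smooth_flow : ContMDiff (𝓘(ℝ, ℝ).prod IT) IT ∞ (fun q : ℝ × Cotangent S => φ q.1 q.2)
  start : ∀ x, φ 0 x = x
  hamilton : ∀ (t : ℝ) (x : Cotangent S) (w : TangentSpace IT (φ t x)),
    mfderiv IT 𝓘(ℝ, ℝ) (H t) (φ t x) w =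
      symplecticForm (φ t x) (mfderiv 𝓘(ℝ, ℝ) IT (fun s : ℝ => φ s x) t (1 : ℝ)) w

/-- The function `h` vanishes on the zero-section. -/
def VanishesOnZeroSection (h : Cotangent S → ℝ) : Prop := ∀ z : S, h (covector z 0) = 0

/-- The function `h` is odd in the fibres, i.e. its Hamiltonian flow commutes with
`(z, ξ) ↦ (z, -ξ)`. -/
def IsFibrewiseOdd (h : Cotangent S → ℝ) : Prop :=
  ∀ (z : S) (ξ : ℂ →L[ℝ] ℝ), h (covector z (-ξ)) = -h (covector z ξ)

/-- The time-one maps of Hamiltonian flows whose Hamiltonians satisfy `c` at all times. -/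
def IsHamiltonianDiffeo (c : (Cotangent S → ℝ) → Prop)
    (φ : Diffeomorph IT IT (Cotangent S) (Cotangent S) ∞) : Prop :=
  ∃ (H : ℝ → Cotangent S → ℝ) (Φ : ℝ → Diffeomorph IT IT (Cotangent S) (Cotangent S) ∞),
    (∀ t, c (H t)) ∧ IsHamiltonianFlow H Φ ∧ Φ 1 = φ

end Surface

/-! ## The Hilbert scheme bundle -/

/-- `ℂ[p, p̄]`, with `p = X 0` and `p̄ = X 1`: the polynomial functions on a fibre of the complexified
cotangent bundle. -/
abbrev Poly : Type := MvPolynomial (Fin 2) ℂ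

/-- The variable `p`. -/
abbrev p : Poly := MvPolynomial.X 0

/-- The variable `p̄`. -/
abbrev pbar : Poly := MvPolynomial.X 1

/-- The value of a polynomial in `p, p̄` at a real covector. -/
def evalAt (ξ : ℂ →L[ℝ] ℝ) (P : Poly) : ℂ := MvPolynomial.eval ![pCoord ξ, pbarCoord ξ] P

/-- Complex conjugation of `ℂ[p, p̄]`: conjugate the coefficients and exchange `p` and `p̄`. -/
def conjPoly : Poly →+* Poly :=
  (MvPolynomial.rename (R := ℂ) (Equiv.swap (0 : Fin 2) 1)).toRingHom.comp
    (MvPolynomial.map (starRingEnd ℂ))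

/-- The substitution `(p, p̄) ↦ (-p, -p̄)`. -/
def negPoly : Poly →+* Poly := (MvPolynomial.aeval (R := ℂ) ![-p, -pbar]).toRingHom

/-- The maximal ideal supported at zero. -/
def maxIdeal : Ideal Poly := Ideal.span {p, pbar}

section Ideals

variable {S : Type*} [TopologicalSpace S] [ChartedSpace ℂ S] [IsManifold 𝓘(ℂ) ω S]

/-- The polynomial `P` is, modulo terms of order at least `m`, the Taylor polynomial at the origin of
the function `F` in the cotangent fibre at `z`. -/
def AgreesAt (m : ℕ) (F : Cotangent S → ℂ) (z : S) (P : Poly) : Prop :=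
  (fun ξ : ℂ →L[ℝ] ℝ => F (covector z ξ) - evalAt ξ P) =O[𝓝 0] (fun ξ : ℂ →L[ℝ] ℝ => ‖ξ‖ ^ m)

/-- The function `F` on the cotangent bundle belongs to the family of ideals `I` (whose members
contain all polynomials of order at least `m`): in every fibre its jet lies in the ideal. -/
def BelongsTo (m : ℕ) (I : S → Ideal Poly) (F : Cotangent S → ℂ) : Prop :=
  ∀ z, ∃ P ∈ I z, AgreesAt m F z P

/-- A smooth section of the bundle of the zero-fibres of the punctual Hilbert schemes of length `m`
of the complexified cotangent spaces. An ideal of codimension `m` supported at the origin contains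
all monomials of degree at least `m`. Such ideals are subspaces of constant codimension, and a family
of them is smooth if each element of one of them extends to a smooth section. -/
structure HilbSection (m : ℕ) (S : Type*) [TopologicalSpace S] [ChartedSpace ℂ S]
    [IsManifold 𝓘(ℂ) ω S] where
  ideal : S → Ideal Poly
  codim : ∀ z, Module.finrank ℂ (Poly ⧸ ideal z) = m
  support : ∀ z (a b : ℂ), (∀ P ∈ ideal z, MvPolynomial.eval ![a, b] P = 0) ↔ a = 0 ∧ b = 0
  smooth : ∀ z, ∀ P ∈ ideal z, ∃ F : Cotangent S → ℂ,
    ContMDiff IT 𝓘(ℝ, ℂ) ∞ F ∧ BelongsTo m ideal F ∧ AgreesAt m F z P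

/-- The diffeomorphism `φ` of the cotangent bundle carries `I` to `J`: pulling back by `φ` carries
the functions belonging to `J` to those belonging to `I`. -/
def Carries {m : ℕ} (φ : Diffeomorph IT IT (Cotangent S) (Cotangent S) ∞)
    (I J : HilbSection m S) : Prop :=
  ∀ F : Cotangent S → ℂ, ContMDiff IT 𝓘(ℝ, ℂ) ∞ F →
    (BelongsTo m J.ideal F ↔ BelongsTo m I.ideal (fun x => F (φ x)))

end Ideals

/-! ## `n`-complex structures -/

/-- The ideal `⟨p^n, -p̄ + μ_2 p + … + μ_n p^(n-1)⟩`. -/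
def genericIdeal (n : ℕ) (μ : ℕ → ℂ) : Ideal Poly :=
  Ideal.span {p ^ n, -pbar + ∑ k ∈ Finset.Icc 2 n, MvPolynomial.C (μ k) * p ^ (k - 1)}

/-- Compatible `n`-complex structures: at every point `I + Ī` is the maximal ideal, and `I` has the
form `⟨p^n, -p̄ + μ_2 p + … + μ_n p^(n-1)⟩` with `|μ_2| < 1`. -/
structure NComplexStructure (n : ℕ) (S : Type*) [TopologicalSpace S] [ChartedSpace ℂ S]
    [IsManifold 𝓘(ℂ) ω S] extends HilbSection n S where
  reality : ∀ z, ideal z ⊔ (ideal z).map conjPoly = maxIdeal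
  compatible : ∀ z, ∃ μ : ℕ → ℂ, ‖μ 2‖ < 1 ∧ ideal z = genericIdeal n μ

/-- The moduli space of `n`-complex structures: compatible structures modulo higher
diffeomorphisms. -/
def NModuli (n : ℕ) (S : Type*) [TopologicalSpace S] [ChartedSpace ℂ S] [IsManifold 𝓘(ℂ) ω S] :
    Type _ :=
  Quot (fun I J : NComplexStructure n S =>
    ∃ φ, IsHamiltonianDiffeo VanishesOnZeroSection φ ∧ Carries φ I.toHilbSection J.toHilbSection)

/-- The class of an `n`-complex structure. -/
def NModuli.mk {n : ℕ} {S : Type*} [TopologicalSpace S] [ChartedSpace ℂ S] [IsManifold 𝓘(ℂ) ω S]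
    (I : NComplexStructure n S) : NModuli n S := Quot.mk _ I

/-! ## The principal map of a classical Lie algebra -/

theorem sum_aux {m : ℕ} (f : Fin m → ℂ) (a : ℕ) :
    ∑ k : Fin m, (if (k : ℕ) = a then f k else 0) = if h : a < m then f ⟨a, h⟩ else 0 := by
  split_ifs with h
  · rw [Finset.sum_eq_single ⟨a, h⟩]
    · simp
    · intro b _ hb
      rw [if_neg]
      intro hba; exact hb (Fin.ext hba)
    · simp
  · apply Finset.sum_eq_zero
    intro k _
    rw [if_neg]; have := k.2; omega

/-- The lowering operator `e_j ↦ e_{j+1}` (`j + 1 < L`) on the span of `e_0, …, e_{L-1}`, zero on the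
remaining basis vectors of `ℂ^m`. -/
def chainF (m L : ℕ) : Matrix (Fin m) (Fin m) ℂ :=
  Matrix.of fun i j => if (i : ℕ) = j + 1 ∧ (i : ℕ) < L then 1 else 0
/-- The raising operator `e_j ↦ j (L - j) e_{j-1}` (`j < L`). -/
def chainE (m L : ℕ) : Matrix (Fin m) (Fin m) ℂ :=
  Matrix.of fun i j => if (j : ℕ) = i + 1 ∧ (j : ℕ) < L then (j : ℂ) * ((L : ℂ) - j) else 0
/-- The weight operator `e_j ↦ (L - 1 - 2 j) e_j` (`j < L`). -/
def chainH (m L : ℕ) : Matrix (Fin m) (Fin m) ℂ :=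
  Matrix.diagonal fun i => if (i : ℕ) < L then (L : ℂ) - 1 - 2 * i else 0

theorem lie_EF (m L : ℕ) (h : L ≤ m) : ⁅chainE m L, chainF m L⁆ = chainH m L := by
  ext i j
  have h1 : (chainE m L * chainF m L) i j =
      if i = j ∧ (i : ℕ) + 1 < L then ((i : ℂ) + 1) * ((L : ℂ) - (i + 1)) else 0 := by
    have : (chainE m L * chainF m L) i j = ∑ k : Fin m, (if (k : ℕ) = i + 1 then
        (if i = j ∧ (i : ℕ) + 1 < L then ((i : ℂ) + 1) * ((L : ℂ) - (i + 1)) else 0) else 0) := by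
      rw [Matrix.mul_apply]
      refine Finset.sum_congr rfl fun k _ => ?_
      simp only [chainE, chainF, Matrix.of_apply, Fin.ext_iff]
      by_cases hk : (k : ℕ) = i + 1
      · have : (k : ℂ) = (i : ℂ) + 1 := by rw [hk]; push_cast; ring
        simp only [hk, true_and]
        split_ifs <;> first | omega | simp_all
      · simp [hk]
    rw [this, sum_aux]
    split_ifs <;> first | rfl | omega
  have h2 : (chainF m L * chainE m L) i j =
      if i = j ∧ (i : ℕ) < L then (i : ℂ) * ((L : ℂ) - i) else 0 := by
    have : (chainF m L * chainE m L) i j = ∑ k : Fin m, (if (k : ℕ) = (i : ℕ) - 1 then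
        (if i = j ∧ (i : ℕ) < L then (i : ℂ) * ((L : ℂ) - i) else 0) else 0) := by
      rw [Matrix.mul_apply]
      refine Finset.sum_congr rfl fun k _ => ?_
      simp only [chainE, chainF, Matrix.of_apply, Fin.ext_iff]
      by_cases hij : (i : ℕ) = j
      · by_cases hi : (i : ℕ) = 0
        · have : (i : ℂ) = 0 := by exact_mod_cast hi
          simp [hi]
        · have hji : (j : ℂ) = i := by rw [hij]
          by_cases hk : (k : ℕ) = (i : ℕ) - 1
          · by_cases hL : (i : ℕ) < L
            · rw [if_pos (by omega), if_pos (by omega), if_pos hk, if_pos ⟨hij, hL⟩, hji, one_mul]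
            · rw [if_neg (by omega), zero_mul, if_pos hk, if_neg (fun hh => hL hh.2)]
          · rw [if_neg (by omega), if_neg hk, zero_mul]
      · have hij2 : ¬ ((i : ℕ) = j ∧ (i : ℕ) < L) := fun hh => hij hh.1
        rw [if_neg hij2, ite_self]
        by_cases hk : (i : ℕ) = k + 1 ∧ (i : ℕ) < L
        · rw [if_neg (by omega : ¬ ((j : ℕ) = k + 1 ∧ (j : ℕ) < L)), mul_zero]
        · rw [if_neg hk, zero_mul]
    rw [this, sum_aux]
    split_ifs <;> first | rfl | omega
  rw [Ring.lie_def, Matrix.sub_apply, h1, h2]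
  by_cases hij : i = j
  · subst hij
    simp only [chainH, Matrix.diagonal_apply_eq, true_and]
    by_cases a : (i : ℕ) + 1 < L
    · have : (i : ℕ) < L := by omega
      simp only [a, this, if_true]; ring
    · by_cases b : (i : ℕ) < L
      · have : (L : ℂ) = i + 1 := by
          have : L = i + 1 := by omega
          rw [this]; push_cast; ring
        simp only [a, b, if_true, if_false, this]; ring
      · simp [a, b]
  · simp [chainH, hij]

theorem lie_HE (m L : ℕ) : ⁅chainH m L, chainE m L⁆ = (2 : ℂ) • chainE m L := by
  ext i j
  rw [Ring.lie_def, Matrix.sub_apply, chainH, Matrix.diagonal_mul, Matrix.mul_diagonal]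
  simp only [chainE, Matrix.of_apply, Matrix.smul_apply, smul_eq_mul]
  by_cases h : (j : ℕ) = i + 1 ∧ (j : ℕ) < L
  · have : (j : ℂ) = (i : ℂ) + 1 := by rw [h.1]; push_cast; ring
    have hi : (i : ℕ) < L := by omega
    rw [if_pos h, if_pos hi, if_pos h.2, this]
    ring
  · simp [h]

theorem lie_HF (m L : ℕ) : ⁅chainH m L, chainF m L⁆ = -((2 : ℂ) • chainF m L) := by
  ext i j
  rw [Ring.lie_def, Matrix.sub_apply, chainH, Matrix.diagonal_mul, Matrix.mul_diagonal]
  simp only [chainF, Matrix.of_apply, Matrix.smul_apply, Matrix.neg_apply, smul_eq_mul]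
  by_cases h : (i : ℕ) = j + 1 ∧ (i : ℕ) < L
  · have : (i : ℂ) = (j : ℂ) + 1 := by rw [h.1]; push_cast; ring
    rw [if_pos h, if_pos h.2, if_pos (by omega), this]
    ring
  · simp [h]

/-- The nondegenerate bilinear form on `ℂ^m` with `⟨e_i, e_j⟩ = (-1)^i` for `i + j = L - 1`, with
`⟨e_i, e_i⟩ = 1` for `i ≥ L`, and all other products zero. It is symmetric for `L` odd, and
alternating for `L = m` even. -/
def chainForm (m L : ℕ) : Matrix (Fin m) (Fin m) ℂ :=
  Matrix.of fun i j => if (i : ℕ) + j + 1 = L then (-1) ^ (i : ℕ)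
    else if i = j ∧ L ≤ (i : ℕ) then 1 else 0

theorem skew_F (m L : ℕ) (_h : L ≤ m) :
    chainF m L ∈ skewAdjointMatricesLieSubalgebra (chainForm m L) := by
  rw [mem_skewAdjointMatricesLieSubalgebra, mem_skewAdjointMatricesSubmodule]
  rw [Matrix.IsSkewAdjoint, Matrix.IsAdjointPair]
  ext i j
  have h1 : ((chainF m L).transpose * chainForm m L) i j =
      if (i : ℕ) + j + 2 = L then (-1) ^ ((i : ℕ) + 1) else 0 := by
    have : ((chainF m L).transpose * chainForm m L) i j = ∑ k : Fin m, (if (k : ℕ) = (i : ℕ) + 1 then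
        (if (i : ℕ) + j + 2 = L then (-1) ^ ((i : ℕ) + 1) else 0) else 0) := by
      rw [Matrix.mul_apply]
      refine Finset.sum_congr rfl fun k _ => ?_
      simp only [chainForm, chainF, Matrix.of_apply, Matrix.transpose_apply, Fin.ext_iff]
      split_ifs <;> first | omega | simp_all
    rw [this, sum_aux]
    split_ifs <;> first | rfl | omega
  have h2 : (chainForm m L * -chainF m L) i j =
      if (i : ℕ) + j + 2 = L then (-1) ^ ((i : ℕ) + 1) else 0 := by
    have : (chainForm m L * -chainF m L) i j = ∑ k : Fin m, (if (k : ℕ) = (j : ℕ) + 1 then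
        (if (i : ℕ) + j + 2 = L then (-1) ^ ((i : ℕ) + 1) else 0) else 0) := by
      rw [Matrix.mul_apply]
      refine Finset.sum_congr rfl fun k _ => ?_
      simp only [chainForm, chainF, Matrix.of_apply, Matrix.neg_apply, Fin.ext_iff]
      split_ifs <;> first | omega | simp_all [pow_succ]
    rw [this, sum_aux]
    split_ifs <;> first | rfl | omega
  rw [h1, h2]

theorem skew_E (m L : ℕ) (_h : L ≤ m) :
    chainE m L ∈ skewAdjointMatricesLieSubalgebra (chainForm m L) := by
  rw [mem_skewAdjointMatricesLieSubalgebra, mem_skewAdjointMatricesSubmodule]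
  rw [Matrix.IsSkewAdjoint, Matrix.IsAdjointPair]
  ext i j
  have h1 : ((chainE m L).transpose * chainForm m L) i j =
      if (i : ℕ) + j = L then -((-1) ^ (i : ℕ) * ((i : ℂ) * j)) else 0 := by
    have : ((chainE m L).transpose * chainForm m L) i j = ∑ k : Fin m, (if (k : ℕ) = (i : ℕ) - 1 then
        (if (i : ℕ) + j = L then -((-1) ^ (i : ℕ) * ((i : ℂ) * j)) else 0) else 0) := by
      rw [Matrix.mul_apply]
      refine Finset.sum_congr rfl fun k _ => ?_
      simp only [chainForm, chainE, Matrix.of_apply, Matrix.transpose_apply, Fin.ext_iff]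
      by_cases hi : (i : ℕ) = k + 1
      · by_cases hL : (i : ℕ) + j = L
        · have e1 : (L : ℂ) - i = j := by rw [← hL]; push_cast; ring
          rw [if_pos hL, if_pos (by omega : (k : ℕ) = i - 1), if_pos (by omega : (k : ℕ) + j + 1 = L), e1]
          by_cases hj : (j : ℕ) = 0
          · have : (j : ℂ) = 0 := by exact_mod_cast hj
            simp [this]
          · rw [if_pos ⟨hi, by omega⟩]
            have : (-1 : ℂ) ^ (i : ℕ) = -(-1) ^ (k : ℕ) := by rw [hi, pow_succ]; ring
            rw [this]; ring
        · rw [if_neg hL]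
          split_ifs <;> first | omega | simp
      · rw [if_neg (by omega), zero_mul]
        by_cases hi0 : (i : ℕ) = 0
        · have : (i : ℂ) = 0 := by exact_mod_cast hi0
          simp [this]
        · rw [if_neg (by omega)]
    rw [this, sum_aux]
    split_ifs <;> first | rfl | omega
  have h2 : (chainForm m L * -chainE m L) i j =
      if (i : ℕ) + j = L then -((-1) ^ (i : ℕ) * ((i : ℂ) * j)) else 0 := by
    have : (chainForm m L * -chainE m L) i j = ∑ k : Fin m, (if (k : ℕ) = (j : ℕ) - 1 then
        (if (i : ℕ) + j = L then -((-1) ^ (i : ℕ) * ((i : ℂ) * j)) else 0) else 0) := by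
      rw [Matrix.mul_apply]
      refine Finset.sum_congr rfl fun k _ => ?_
      simp only [chainForm, chainE, Matrix.of_apply, Matrix.neg_apply, Fin.ext_iff]
      by_cases hi : (j : ℕ) = k + 1
      · by_cases hL : (i : ℕ) + j = L
        · have e1 : (L : ℂ) - j = i := by rw [← hL]; push_cast; ring
          rw [if_pos hL, if_pos (by omega : (k : ℕ) = j - 1), if_pos (by omega : (i : ℕ) + k + 1 = L), e1]
          by_cases hj : (i : ℕ) = 0
          · have : (i : ℂ) = 0 := by exact_mod_cast hj
            simp [this]
          · rw [if_pos ⟨hi, by omega⟩]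
            ring
        · rw [if_neg hL]
          split_ifs <;> first | omega | simp
      · rw [if_neg (by omega : ¬ ((j : ℕ) = k + 1 ∧ (j : ℕ) < L)), neg_zero, mul_zero]
        by_cases hi0 : (j : ℕ) = 0
        · have : (j : ℂ) = 0 := by exact_mod_cast hi0
          simp [this]
        · rw [if_neg (by omega)]
    rw [this, sum_aux]
    split_ifs <;> first | rfl | omega
  rw [h1, h2]

theorem trace_eq_zero_of_mem_sl {n : ℕ} {A : Matrix (Fin n) (Fin n) ℂ}
    (h : A ∈ LieAlgebra.SpecialLinear.sl (Fin n) ℂ) : Matrix.trace A = 0 := h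

/-- The representation of `sl₂` on `ℂ^m` that is the sum of the irreducible representation on the
span of `e_0, …, e_{L-1}` and a trivial one. -/
def principalRep (m L : ℕ) (h : L ≤ m) :
    LieAlgebra.SpecialLinear.sl (Fin 2) ℂ →ₗ⁅ℂ⁆ Matrix (Fin m) (Fin m) ℂ where
  toFun x := x.val 0 0 • chainH m L + x.val 0 1 • chainE m L + x.val 1 0 • chainF m L
  map_add' x y := by
    have hv : (x + y).val = x.val + y.val := rfl
    rw [hv]; simp only [Matrix.add_apply, add_smul]; abel
  map_smul' c x := by
    have hv : (c • x).val = c • x.val := rfl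
    rw [hv]
    simp only [Matrix.smul_apply, smul_eq_mul, mul_smul, smul_add, RingHom.id_apply]
  map_lie' := by
    intro x y
    have tr : ∀ z : LieAlgebra.SpecialLinear.sl (Fin 2) ℂ, z.val 1 1 = -z.val 0 0 := by
      intro z
      have h2 := trace_eq_zero_of_mem_sl z.2
      rw [Matrix.trace_fin_two] at h2
      linear_combination h2
    have hEF := lie_EF m L h
    have hHE := lie_HE m L
    have hHF := lie_HF m L
    have hFE : ⁅chainF m L, chainE m L⁆ = -chainH m L := by rw [← lie_skew, hEF]
    have hEH : ⁅chainE m L, chainH m L⁆ = -((2 : ℂ) • chainE m L) := by rw [← lie_skew, hHE]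
    have hFH : ⁅chainF m L, chainH m L⁆ = (2 : ℂ) • chainF m L := by
      rw [← lie_skew, hHF, neg_neg]
    simp only [add_lie, lie_add, smul_lie, lie_smul, lie_self, hEF, hHE, hHF, hFE, hEH, hFH,
      LieAlgebra.SpecialLinear.sl_bracket, Matrix.sub_apply, Matrix.mul_apply, Fin.sum_univ_two,
      tr x, tr y]
    module

/-- The types of classical Lie algebras, with the rank `r`. -/
inductive ClassicalType where
  | A (r : ℕ)
  | B (r : ℕ)
  | C (r : ℕ)
  | D (r : ℕ)

namespace ClassicalType

/-- The ranks for which the Lie algebra is simple. -/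
def Admissible : ClassicalType → Prop
  | A r => 1 ≤ r
  | B r => 1 ≤ r
  | C r => 1 ≤ r
  | D r => 3 ≤ r

/-- The rank. -/
def rank : ClassicalType → ℕ
  | A r => r
  | B r => r
  | C r => r
  | D r => r

/-- The dimension of the standard representation. -/
def dim : ClassicalType → ℕ
  | A r => r + 1
  | B r => 2 * r + 1
  | C r => 2 * r
  | D r => 2 * r

/-- The size of the largest Jordan block of a principal nilpotent element in the standard
representation. -/
def block : ClassicalType → ℕ
  | A r => r + 1
  | B r => 2 * r + 1
  | C r => 2 * r
  | D r => 2 * r - 1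

theorem block_le_dim (T : ClassicalType) : T.block ≤ T.dim := by
  cases T <;> simp [block, dim]

/-- The classical Lie algebras in their standard representations: `sl_{r+1}`, and the Lie algebras
`so_{2r+1}`, `sp_{2r}`, `so_{2r}` of the nondegenerate (symmetric, alternating, symmetric) forms
`chainForm (2r+1) (2r+1)`, `chainForm (2r) (2r)`, `chainForm (2r) (2r-1)`. -/
def lieAlg : (T : ClassicalType) → LieSubalgebra ℂ (Matrix (Fin T.dim) (Fin T.dim) ℂ)
  | A r => LieAlgebra.SpecialLinear.sl (Fin (r + 1)) ℂ
  | B r => skewAdjointMatricesLieSubalgebra (chainForm (B r).dim (B r).block)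
  | C r => skewAdjointMatricesLieSubalgebra (chainForm (C r).dim (C r).block)
  | D r => skewAdjointMatricesLieSubalgebra (chainForm (D r).dim (D r).block)

theorem sl_of_lie {m L : ℕ} (h : L ≤ m) :
    chainH m L ∈ LieAlgebra.SpecialLinear.sl (Fin m) ℂ ∧
    chainE m L ∈ LieAlgebra.SpecialLinear.sl (Fin m) ℂ ∧
    chainF m L ∈ LieAlgebra.SpecialLinear.sl (Fin m) ℂ := by
  have key : ∀ X Y : Matrix (Fin m) (Fin m) ℂ, ⁅X, Y⁆ ∈ LieAlgebra.SpecialLinear.sl (Fin m) ℂ :=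
    fun X Y => LieAlgebra.matrix_trace_commutator_zero _ _ X Y
  refine ⟨?_, ?_, ?_⟩
  · rw [← lie_EF m L h]; exact key _ _
  · have h2 : chainE m L = (2 : ℂ)⁻¹ • ⁅chainH m L, chainE m L⁆ := by
      rw [lie_HE, smul_smul]; norm_num
    rw [h2]; exact LieSubalgebra.smul_mem _ _ (key _ _)
  · have h2 : chainF m L = (-(2 : ℂ)⁻¹) • ⁅chainH m L, chainF m L⁆ := by
      rw [lie_HF, smul_neg, smul_smul]; norm_num
    rw [h2]; exact LieSubalgebra.smul_mem _ _ (key _ _)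

theorem skew_H (m L : ℕ) (h : L ≤ m) :
    chainH m L ∈ skewAdjointMatricesLieSubalgebra (chainForm m L) := by
  rw [← lie_EF m L h]
  exact LieSubalgebra.lie_mem _ (skew_E m L h) (skew_F m L h)

theorem chain_mem (T : ClassicalType) :
    chainH T.dim T.block ∈ T.lieAlg ∧ chainE T.dim T.block ∈ T.lieAlg ∧
      chainF T.dim T.block ∈ T.lieAlg := by
  cases T with
  | A r => exact sl_of_lie le_rfl
  | B r => exact ⟨skew_H _ _ (block_le_dim _), skew_E _ _ (block_le_dim _), skew_F _ _ (block_le_dim _)⟩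
  | C r => exact ⟨skew_H _ _ (block_le_dim _), skew_E _ _ (block_le_dim _), skew_F _ _ (block_le_dim _)⟩
  | D r => exact ⟨skew_H _ _ (block_le_dim _), skew_E _ _ (block_le_dim _), skew_F _ _ (block_le_dim _)⟩

/-- The principal map `sl₂ → 𝔤`. -/
def principalMap (T : ClassicalType) : LieAlgebra.SpecialLinear.sl (Fin 2) ℂ →ₗ⁅ℂ⁆ T.lieAlg where
  toFun x := ⟨principalRep T.dim T.block T.block_le_dim x, by
    have h := chain_mem T
    exact add_mem (add_mem (LieSubalgebra.smul_mem _ _ h.1) (LieSubalgebra.smul_mem _ _ h.2.1))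
      (LieSubalgebra.smul_mem _ _ h.2.2)⟩
  map_add' x y := Subtype.ext (map_add _ x y)
  map_smul' c x := Subtype.ext (map_smul (principalRep T.dim T.block T.block_le_dim) c x)
  map_lie' {x y} := Subtype.ext (LieHom.map_lie (principalRep T.dim T.block T.block_le_dim) x y)

end ClassicalType

/-- The standard nilpotent element `f` of `sl₂`. -/
def sl2f : LieAlgebra.SpecialLinear.sl (Fin 2) ℂ :=
  LieAlgebra.SpecialLinear.single (1 : Fin 2) 0 (by decide) (1 : ℂ)

/-! ## The `𝔤`-Hilbert scheme and the idealic map -/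

/-- The centralizer of `A` in `𝔤`. -/
def centralizer (T : ClassicalType) (A : T.lieAlg) : Submodule ℂ T.lieAlg :=
  LinearMap.ker (LieAlgebra.ad ℂ T.lieAlg A : T.lieAlg →ₗ[ℂ] T.lieAlg)

/-- The pair `(A, B)` represents a point of the regular part of the zero-fibre of the `𝔤`-Hilbert
scheme. -/
structure InRegularZeroFibre (T : ClassicalType) (A B : T.lieAlg) : Prop where
  comm : ⁅A, B⁆ = 0
  nilpotent_left : IsNilpotent (A : Matrix (Fin T.dim) (Fin T.dim) ℂ)
  nilpotent_right : IsNilpotent (B : Matrix (Fin T.dim) (Fin T.dim) ℂ)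
  common : Module.finrank ℂ (centralizer T A ⊓ centralizer T B : Submodule ℂ T.lieAlg) = T.rank
  regular : Module.finrank ℂ (centralizer T A) = T.rank ∨
    Module.finrank ℂ (centralizer T B) = T.rank

/-- The matrix `P(A, B)`, for commuting `A` and `B`. -/
def evalPair {m : ℕ} (A B : Matrix (Fin m) (Fin m) ℂ) (P : Poly) : Matrix (Fin m) (Fin m) ℂ :=
  ∑ s ∈ P.support, P.coeff s • (A ^ s 0 * B ^ s 1)

/-- The pair `(A, B)` admits a cyclic vector. -/
def IsCyclicPair {m : ℕ} (A B : Matrix (Fin m) (Fin m) ℂ) : Prop :=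
  ∃ v : Fin m → ℂ,
    Submodule.span ℂ (Set.range fun k : ℕ × ℕ => (A ^ k.1 * B ^ k.2).mulVec v) = ⊤

/-- `I` is the image under the idealic map of the pair `(A, B)`, where `A` is regular. For a cyclic
pair this is the ideal `I(A, B)` of all `P` with `P(A, B) = 0`. A pair that is not cyclic (which
happens in type `D` only) is deformed inside the centralizer of `A` to cyclic pairs `(A, B + t S)`,
`t ≠ 0`, and the image is the limit of the ideals `I(A, B + t S)` for `t → 0`. -/
def IsIdealicImage (T : ClassicalType) (A B : T.lieAlg) (I : Ideal Poly) : Prop :=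
  (IsCyclicPair A.val B.val ∧ ∀ P, P ∈ I ↔ evalPair A.val B.val P = 0) ∨
  (¬ IsCyclicPair A.val B.val ∧ ∃ S : T.lieAlg, ⁅A, S⁆ = 0 ∧
    (∀ t : ℂ, t ≠ 0 → IsCyclicPair A.val (B + t • S).val) ∧
    ∀ P, P ∈ I ↔ ∃ Q : ℂ → Poly, (∀ t, t ≠ 0 → evalPair A.val (B + t • S).val (Q t) = 0) ∧
      (∃ d, ∀ t, (Q t).totalDegree ≤ d) ∧
      ∀ s, Filter.Tendsto (fun t => (Q t).coeff s) (𝓝[≠] 0) (𝓝 (P.coeff s)))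

/-! ## `𝔤`-complex structures -/

/-- The ideal `⟨p^(2r-1), p p̄ - (μ_2 p² + … + μ_{2r-2} p^(2r-2)), p̄² - (ν_2 p² + … + ν_{2r-2} p^(2r-2))⟩`. -/
def genericIdealD (r : ℕ) (μ ν : ℕ → ℂ) : Ideal Poly :=
  Ideal.span {p ^ (2 * r - 1),
    p * pbar - ∑ i ∈ Finset.Icc 1 (r - 1), MvPolynomial.C (μ (2 * i)) * p ^ (2 * i),
    pbar ^ 2 - ∑ i ∈ Finset.Icc 1 (r - 1), MvPolynomial.C (ν (2 * i)) * p ^ (2 * i)}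

namespace ClassicalType

/-- The Weyl invariance of an ideal of codimension `T.dim` supported at the origin: invariance under
`(p, p̄) ↦ (-p, -p̄)` in types `B`, `C`, `D`, and no condition in type `A`. -/
def WeylInvariant : ClassicalType → Ideal Poly → Prop
  | A _, _ => True
  | _, I => ∀ P ∈ I, negPoly P ∈ I

/-- The value of `I + Ī`. -/
def realIdeal : ClassicalType → Ideal Poly
  | D _ => maxIdeal ^ 2
  | _ => maxIdeal

/-- The induced Beltrami coefficient `μ_2` has modulus less than one. -/
def CompatibleIdeal : ClassicalType → Ideal Poly → Prop
  | D r, I => ∃ μ ν : ℕ → ℂ, ‖μ 2‖ < 1 ∧ I = genericIdealD r μ ν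
  | T, I => ∃ μ : ℕ → ℂ, ‖μ 2‖ < 1 ∧ I = genericIdeal T.dim μ

/-- The condition on the Hamiltonians of higher diffeomorphisms of type `𝔤`: vanishing on the
zero-section for type `A`, and oddness in the fibres for the other types. -/
def AdmissibleHamiltonian {S : Type*} [TopologicalSpace S] [ChartedSpace ℂ S]
    [IsManifold 𝓘(ℂ) ω S] : ClassicalType → (Cotangent S → ℝ) → Prop
  | A _, h => VanishesOnZeroSection h
  | _, h => IsFibrewiseOdd h

end ClassicalType

/-- Compatible `𝔤`-complex structures, for `𝔤` of classical type `T`. -/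
structure GComplexStructure (T : ClassicalType) (S : Type*) [TopologicalSpace S] [ChartedSpace ℂ S]
    [IsManifold 𝓘(ℂ) ω S] extends HilbSection T.dim S where
  weyl : ∀ z, T.WeylInvariant (ideal z)
  reality : ∀ z, ideal z ⊔ (ideal z).map conjPoly = T.realIdeal
  compatible : ∀ z, T.CompatibleIdeal (ideal z)

/-- The moduli space of `𝔤`-complex structures: compatible structures modulo higher diffeomorphisms
of type `𝔤`. -/
def GModuli (T : ClassicalType) (S : Type*) [TopologicalSpace S] [ChartedSpace ℂ S]
    [IsManifold 𝓘(ℂ) ω S] : Type _ :=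
  Quot (fun I J : GComplexStructure T S =>
    ∃ φ, IsHamiltonianDiffeo T.AdmissibleHamiltonian φ ∧ Carries φ I.toHilbSection J.toHilbSection)

/-- The class of a `𝔤`-complex structure. -/
def GModuli.mk {T : ClassicalType} {S : Type*} [TopologicalSpace S] [ChartedSpace ℂ S]
    [IsManifold 𝓘(ℂ) ω S] (I : GComplexStructure T S) : GModuli T S := Quot.mk _ I

end

end HigherTeich

open scoped Manifold ContDiff Topology
open Bundle

namespace HigherTeich

attribute [local instance] LieRing.ofAssociativeRing

noncomputable section

/-! Every compatible ideal has a slope: its elements have order at least `k`, and their degree-`k`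
parts are exactly the degree-`k` multiples of the linear form `p̄ - μ p` with `μ = μ₂`. Here `k = 1`
for `n`-complex structures and in types `A`, `B`, `C`, and `k = 2` in type `D`, where codimension
`2r` forces `ν₂ = μ₂²` (`nu_eq_of_finrank`). The map from moduli to Teichmüller space that takes the
slope is a left inverse of the map in question, which gives injectivity. Both maps have to be shown
to descend to the quotients; `exists_injective_moduli` assembles this once for all types.

Taking the slope is well defined (`exists_identifies_of_carries`). A Hamiltonian flow whose
Hamiltonian vanishes on the zero-section preserves the zero-section, by uniqueness for an ordinary
differential equation in the fibre variable, and so induces an isotopy of the surface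
(`IsHamiltonianFlow.isotopicToId`). It also preserves the symplectic form, and this ties the normal
derivative along the zero-section to the derivative of the base map `f`: to first order the inverse
flow acts on covectors by `ξ ↦ ξ ∘ df` (`IsSymplectic.fibre_deriv`). A function of order `k` along
the zero-section has a degree-`k` part that sees only this normal derivative, so the slopes of two
ideals related by the flow are related by `df`, and this is the condition that `f` identifies the
two complex structures. The slope must moreover be a smooth section; it is recovered by linear
algebra from smooth functions that belong to the family (`contDiffAt_slope`).

The map out of Teichmüller space is well defined because an isotopy of the surface lifts to the
cotangent bundle. The lift is the flow of the fibrewise linear Hamiltonian that pairs a covector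
with the velocity of the isotopy (`isHamiltonianFlow_cotangentDiffeo`); this is odd and vanishes on
the zero-section, hence is allowed in every type. The ideals with all higher coefficients zero are
the slope ideals: polynomials of order at least `k` whose restriction to the line `p̄ = μ p`
vanishes to order `M`. This description is visibly compatible with linear substitutions, so the
lifts carry slope ideals to slope ideals (`carries_cotangentDiffeo`).

For the principal pair, `P(F, μ F)` is the restriction of `P` to the line of slope `μ`, evaluated at
the nilpotent `F = ρ(f)`. It vanishes when `X ^ L` divides that restriction, where `L` is the size
of the large Jordan block. In type `D` the pair is not cyclic; a deformation by an element `S` with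
`F S = S F = 0` and `S² = -F ^ (L - 1)` adds, in the limit, the single condition that `p̄` has
coefficient zero, and the result is again a slope ideal (`isIdealicImage_principal`). The
centralizer of `F` has as coordinates certain entries of the first column, one for each unit of rank
(`inRegularZeroFibre_principal`). -/

section

/-! ## Ideals with a slope -/

/-- Restriction of a polynomial to the parametrized line through the origin and `(a, b)`. -/
def lineRes (a b : ℂ) : Poly →ₐ[ℂ] Polynomial ℂ :=
  MvPolynomial.aeval ![Polynomial.C a * Polynomial.X, Polynomial.C b * Polynomial.X]

/-- The value at `(a, b)` of the homogeneous part of degree `k` of a polynomial. -/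
def homPart (k : ℕ) (P : Poly) (a b : ℂ) : ℂ :=
  MvPolynomial.eval ![a, b] (MvPolynomial.homogeneousComponent k P)

@[simp] theorem lineRes_p (a b : ℂ) : lineRes a b p = Polynomial.C a * Polynomial.X := by
  simp [lineRes]

@[simp] theorem lineRes_pbar (a b : ℂ) : lineRes a b pbar = Polynomial.C b * Polynomial.X := by
  simp [lineRes]

theorem eval_lineRes (a b t : ℂ) (P : Poly) :
    (lineRes a b P).eval t = MvPolynomial.eval ![a * t, b * t] P := by
  induction P using MvPolynomial.induction_on with
  | C c => simp
  | add P Q hP hQ => simp [hP, hQ]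
  | mul_X P i hP => fin_cases i <;> simp [hP]

theorem lineRes_monomial (a b c : ℂ) (d : Fin 2 →₀ ℕ) :
    lineRes a b (MvPolynomial.monomial d c) =
      Polynomial.C (c * (a ^ d 0 * b ^ d 1)) * Polynomial.X ^ (d 0 + d 1) := by
  rw [lineRes, MvPolynomial.aeval_monomial, Finsupp.prod_fintype _ _ (by simp)]
  simp [mul_pow, pow_add]
  ring

theorem coeff_lineRes_monomial (k : ℕ) (a b c : ℂ) (d : Fin 2 →₀ ℕ) :
    (lineRes a b (MvPolynomial.monomial d c)).coeff k = homPart k (MvPolynomial.monomial d c) a b := by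
  rw [lineRes_monomial, homPart, Polynomial.coeff_C_mul_X_pow]
  have hd : d.degree = d 0 + d 1 := by simp [Finsupp.degree_eq_sum]
  by_cases h : k = d 0 + d 1
  · rw [if_pos h, MvPolynomial.homogeneousComponent_of_mem
      (MvPolynomial.isHomogeneous_monomial c (hd.trans h.symm)), if_pos rfl,
      MvPolynomial.eval_monomial, Finsupp.prod_fintype _ _ (by simp)]
    simp
  · rw [if_neg h, MvPolynomial.homogeneousComponent_of_mem
      (MvPolynomial.isHomogeneous_monomial c hd), if_neg h]
    simp

/-- Along `t ↦ (a t, b t)` a form of degree `k` scales by `t ^ k`. Leading parts can therefore be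
computed as coefficients of a polynomial in one variable. -/
theorem coeff_lineRes (k : ℕ) (a b : ℂ) (P : Poly) : (lineRes a b P).coeff k = homPart k P a b := by
  induction P using MvPolynomial.monomial_add_induction_on with
  | C c => exact coeff_lineRes_monomial k a b c 0
  | monomial_add d c P _ _ hP =>
    rw [map_add, Polynomial.coeff_add, hP, coeff_lineRes_monomial]
    simp only [homPart, map_add]

theorem maxIdeal_eq : maxIdeal = MvPolynomial.idealOfVars (Fin 2) ℂ := by
  rw [maxIdeal, MvPolynomial.idealOfVars]
  congr 1
  ext x
  simp [Fin.exists_fin_two, eq_comm]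

theorem mem_maxIdeal_pow {k : ℕ} {P : Poly} :
    P ∈ maxIdeal ^ k ↔ ∀ d : Fin 2 →₀ ℕ, d 0 + d 1 < k → P.coeff d = 0 := by
  rw [maxIdeal_eq, MvPolynomial.mem_pow_idealOfVars_iff']
  simp [Finsupp.degree_eq_sum]

theorem p_mem : p ∈ maxIdeal := Ideal.subset_span (by simp)

theorem pbar_mem : pbar ∈ maxIdeal := Ideal.subset_span (by simp)

theorem X_pow_dvd_lineRes {k : ℕ} {P : Poly} (hP : P ∈ maxIdeal ^ k) (a b : ℂ) :
    Polynomial.X ^ k ∣ lineRes a b P := by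
  have h : maxIdeal.map (lineRes a b) ≤ Ideal.span {Polynomial.X} := by
    rw [maxIdeal, Ideal.map_span, Ideal.span_le]
    rintro _ ⟨x, hx | hx, rfl⟩
    · rw [hx, lineRes_p]; exact Ideal.mul_mem_left _ _ (Ideal.subset_span rfl)
    · rw [hx, lineRes_pbar]; exact Ideal.mul_mem_left _ _ (Ideal.subset_span rfl)
  have h2 : lineRes a b P ∈ (Ideal.span {Polynomial.X}) ^ k := by
    refine Ideal.pow_right_mono h k ?_
    rw [← Ideal.map_pow]
    exact Ideal.mem_map_of_mem _ hP
  rwa [Ideal.span_singleton_pow, Ideal.mem_span_singleton] at h2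

/-- The ideal of the polynomials of order at least `k` whose restriction to the line of slope `μ`
vanishes to order at least `M`. -/
def slopeIdeal (k M : ℕ) (μ : ℂ) : Ideal Poly :=
  (Ideal.span {Polynomial.X ^ M}).comap (lineRes 1 μ) ⊓ maxIdeal ^ k

theorem mem_slopeIdeal {k M : ℕ} {μ : ℂ} {P : Poly} :
    P ∈ slopeIdeal k M μ ↔ Polynomial.X ^ M ∣ lineRes 1 μ P ∧ P ∈ maxIdeal ^ k := by
  rw [slopeIdeal, Ideal.mem_inf, Ideal.mem_comap, Ideal.mem_span_singleton]

/-- The linear substitution `(p, p̄) ↦ (α p + β p̄, γ p + δ p̄)`. -/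
def linSubst (α β γ δ : ℂ) : Poly →ₐ[ℂ] Poly :=
  MvPolynomial.aeval ![MvPolynomial.C α * p + MvPolynomial.C β * pbar,
    MvPolynomial.C γ * p + MvPolynomial.C δ * pbar]

theorem eval_linSubst (α β γ δ a b : ℂ) (P : Poly) :
    MvPolynomial.eval ![a, b] (linSubst α β γ δ P) =
      MvPolynomial.eval ![α * a + β * b, γ * a + δ * b] P := by
  induction P using MvPolynomial.induction_on with
  | C c => simp [linSubst]
  | add P Q hP hQ => simp [hP, hQ]
  | mul_X P i hP =>
    rw [map_mul, map_mul, map_mul, hP]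
    fin_cases i <;> simp [linSubst]

theorem lineRes_linSubst (α β γ δ a b : ℂ) (P : Poly) :
    lineRes a b (linSubst α β γ δ P) = lineRes (α * a + β * b) (γ * a + δ * b) P := by
  refine Polynomial.funext fun t => ?_
  rw [eval_lineRes, eval_lineRes, eval_linSubst]
  congr 2
  ext i
  fin_cases i <;> simp <;> ring

theorem lineRes_smul (c a b : ℂ) (P : Poly) :
    lineRes (c * a) (c * b) P = (lineRes a b P).comp (Polynomial.C c * Polynomial.X) := by
  refine Polynomial.funext fun t => ?_
  rw [eval_lineRes, Polynomial.eval_comp, eval_lineRes]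
  congr 2
  ext i
  fin_cases i <;> simp <;> ring

theorem linSubst_mem_maxIdeal_pow {k : ℕ} {P : Poly} (hP : P ∈ maxIdeal ^ k) (α β γ δ : ℂ) :
    linSubst α β γ δ P ∈ maxIdeal ^ k := by
  have h : maxIdeal.map (linSubst α β γ δ) ≤ maxIdeal := by
    conv_lhs => rw [maxIdeal]
    rw [Ideal.map_span, Ideal.span_le]
    rintro _ ⟨x, hx | hx, rfl⟩ <;> rw [hx] <;> simp only [linSubst, p, pbar, MvPolynomial.aeval_X]
    · exact add_mem (Ideal.mul_mem_left _ _ p_mem) (Ideal.mul_mem_left _ _ pbar_mem)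
    · exact add_mem (Ideal.mul_mem_left _ _ p_mem) (Ideal.mul_mem_left _ _ pbar_mem)
  refine Ideal.pow_right_mono h k ?_
  rw [← Ideal.map_pow]
  exact Ideal.mem_map_of_mem _ hP

/-- The hypotheses say that the substitution sends `(1, μ)` to `c (1, μ')`. Restricting to the line
of slope `μ` after the substitution is thus restricting to the line of slope `μ'` and rescaling the
parameter by `c`, which preserves divisibility by `X ^ M` even for `c = 0`. -/
theorem linSubst_mem_slopeIdeal {k M : ℕ} {μ μ' α β γ δ c : ℂ} (h1 : α + β * μ = c)
    (h2 : γ + δ * μ = c * μ') {P : Poly} (hP : P ∈ slopeIdeal k M μ') :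
    linSubst α β γ δ P ∈ slopeIdeal k M μ := by
  rw [mem_slopeIdeal] at hP ⊢
  refine ⟨?_, linSubst_mem_maxIdeal_pow hP.2 _ _ _ _⟩
  have e : lineRes 1 μ (linSubst α β γ δ P) =
      (lineRes 1 μ' P).comp (Polynomial.C c * Polynomial.X) := by
    rw [lineRes_linSubst, ← lineRes_smul]
    congr 2 <;> simp [h1, h2]
  rw [e]
  obtain ⟨Q, hQ⟩ := hP.1
  rw [hQ, Polynomial.mul_comp, Polynomial.pow_comp, Polynomial.X_comp, mul_pow, mul_assoc]
  exact Dvd.dvd.mul_left (Dvd.intro _ rfl) _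

/-- Real covectors correspond to the points with `p̄` conjugate to `p`, and these are Zariski dense
in `ℂ²`. This allows identities known on real covectors to be evaluated at the complex point `(1,
μ)`. -/
theorem eq_zero_of_evalAt {P : Poly} (h : ∀ ξ, evalAt ξ P = 0) : P = 0 := by
  have hQ : linSubst (1 / 2) (-Complex.I / 2) (1 / 2) (Complex.I / 2) P = 0 := by
    refine MvPolynomial.funext_set (fun _ : Fin 2 => Set.range ((↑) : ℝ → ℂ))
      (fun _ => Set.infinite_range_of_injective Complex.ofReal_injective) fun x hx => ?_
    obtain ⟨a, ha⟩ := hx 0 trivial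
    obtain ⟨b, hb⟩ := hx 1 trivial
    have hxx : x = ![(a : ℂ), (b : ℂ)] := by
      ext i; fin_cases i <;> simp [ha, hb]
    rw [hxx, eval_linSubst, map_zero]
    have := h (a • Complex.reCLM + b • Complex.imCLM)
    rw [← this, evalAt]
    congr 2
    simp [pCoord, pbarCoord]
    constructor <;> ring
  refine MvPolynomial.funext fun x => ?_
  -- The evaluation point inverts the substitution: `p + p̄` and `i (p - p̄)` are the two real
  -- coordinates of the covector.
  have := congrArg (MvPolynomial.eval ![x 0 + x 1, Complex.I * (x 0 - x 1)]) hQ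
  rw [eval_linSubst, map_zero] at this
  rw [map_zero, ← this]
  congr 2
  ext i
  fin_cases i
  · simp
    linear_combination ((x 0 - x 1) / 2) * Complex.I_sq
  · simp
    linear_combination (-(x 0 - x 1) / 2) * Complex.I_sq

/-- `I` consists of polynomials of order at least `k`, and its homogeneous parts of degree `k` are
those of the multiples of `p̄ - μ p`. -/
structure HasSlope (k : ℕ) (I : Ideal Poly) (μ : ℂ) : Prop where
  le : I ≤ slopeIdeal k (k + 1) μ
  gen : ∀ a b : ℕ, a + b + 1 = k → ∃ P ∈ I, ∀ x y, homPart k P x y = x ^ a * y ^ b * (y - μ * x)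

theorem homPart_eq_zero_of_mem {k : ℕ} {μ : ℂ} {P : Poly} (h : P ∈ slopeIdeal k (k + 1) μ) :
    homPart k P 1 μ = 0 := by
  rw [← coeff_lineRes]
  exact Polynomial.X_pow_dvd_iff.1 (mem_slopeIdeal.1 h).1 k (Nat.lt_succ_self k)

/-- The form `x ^ (k - 1) (y - μ' x)` is the leading part of an element of `I`, so it must vanish at
`(1, μ)`. -/
theorem HasSlope.unique {k : ℕ} (hk : 1 ≤ k) {I : Ideal Poly} {μ μ' : ℂ} (h : HasSlope k I μ)
    (h' : HasSlope k I μ') : μ = μ' := by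
  obtain ⟨P, hP, e⟩ := h'.gen (k - 1) 0 (by omega)
  have := homPart_eq_zero_of_mem (h.le hP)
  rw [e] at this
  simp at this
  linear_combination this

end

/-! ### Slope ideals: generators, codimension, support, reality condition. -/

section

/-- Modulo `J` every monomial of degree at least `k` equals its restriction to the line of slope
`μ`, rewritten as a multiple of a power of `p`. Hence `P` is congruent to its whole restriction with
`p` put for the parameter, and that is a multiple of `p ^ M`. -/
theorem slopeIdeal_le {k M : ℕ} {μ : ℂ} {J : Ideal Poly} (hM : p ^ M ∈ J)
    (h : ∀ i j : ℕ, k ≤ i + j → p ^ i * pbar ^ j - MvPolynomial.C (μ ^ j) * p ^ (i + j) ∈ J) :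
    slopeIdeal k M μ ≤ J := by
  intro P hP
  rw [mem_slopeIdeal] at hP
  let τ : Polynomial ℂ →ₐ[ℂ] Poly := Polynomial.aeval p
  have h1 : P - τ (lineRes 1 μ P) ∈ J := by
    have e : P - τ (lineRes 1 μ P) = ∑ d ∈ P.support, (MvPolynomial.monomial d (P.coeff d) -
        τ (lineRes 1 μ (MvPolynomial.monomial d (P.coeff d)))) := by
      rw [Finset.sum_sub_distrib, ← map_sum, ← map_sum, MvPolynomial.support_sum_monomial_coeff]
    rw [e]
    refine sum_mem fun d hd => ?_
    have hk : k ≤ d 0 + d 1 := by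
      by_contra hlt
      exact MvPolynomial.mem_support_iff.1 hd (mem_maxIdeal_pow.1 hP.2 d (not_le.1 hlt))
    have e2 : MvPolynomial.monomial d (P.coeff d) -
        τ (lineRes 1 μ (MvPolynomial.monomial d (P.coeff d))) = MvPolynomial.C (P.coeff d) *
        (p ^ d 0 * pbar ^ d 1 - MvPolynomial.C (μ ^ d 1) * p ^ (d 0 + d 1)) := by
      rw [lineRes_monomial, MvPolynomial.monomial_eq, Finsupp.prod_fintype _ _ (by simp)]
      simp [τ, MvPolynomial.algebraMap_eq]
      ring
    rw [e2]
    exact Ideal.mul_mem_left _ _ (h _ _ hk)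
  obtain ⟨Q, hQ⟩ := hP.1
  have h2 : τ (lineRes 1 μ P) ∈ J := by
    rw [hQ, map_mul, map_pow]
    simp only [τ, Polynomial.aeval_X]
    exact Ideal.mul_mem_right _ _ hM
  simpa using add_mem h1 h2

theorem p_pow_mem_slopeIdeal_of_le {k M N : ℕ} (hk : k ≤ N) (hM : M ≤ N) (μ : ℂ) :
    p ^ N ∈ slopeIdeal k M μ := by
  rw [mem_slopeIdeal]
  exact ⟨by simpa using pow_dvd_pow _ hM, Ideal.pow_le_pow_right hk (Ideal.pow_mem_pow p_mem N)⟩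

theorem mul_mem_slopeIdeal {k M : ℕ} {N : Poly} (hN : N * (pbar - MvPolynomial.C μ * p) ∈ maxIdeal ^ k) :
    N * (pbar - MvPolynomial.C μ * p) ∈ slopeIdeal k M μ := by
  rw [mem_slopeIdeal]
  refine ⟨by simp, hN⟩

/-- Both generators satisfy the two slope conditions. Conversely `p̄ ^ j - (μ p) ^ j` is divisible
by `p̄ - μ p`, which supplies the congruences required by `slopeIdeal_le`. -/
theorem genericIdeal_single {n : ℕ} (hn : 2 ≤ n) (μ : ℂ) :
    genericIdeal n (Pi.single 2 μ) = slopeIdeal 1 n μ := by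
  have hs : ∑ k ∈ Finset.Icc 2 n, MvPolynomial.C ((Pi.single 2 μ : ℕ → ℂ) k) * p ^ (k - 1) =
      MvPolynomial.C μ * p := by
    rw [Finset.sum_eq_single_of_mem 2 (Finset.mem_Icc.2 ⟨le_rfl, hn⟩)]
    · simp
    · intro b _ hb
      simp [hb]
  rw [genericIdeal, hs]
  apply le_antisymm
  · rw [Ideal.span_le]
    rintro _ (rfl | rfl)
    · exact p_pow_mem_slopeIdeal_of_le (by omega) le_rfl μ
    · have := mul_mem_slopeIdeal (μ := μ) (k := 1) (M := n) (N := -1) (by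
        rw [pow_one]
        exact Ideal.mul_mem_left _ _ (sub_mem pbar_mem (Ideal.mul_mem_left _ _ p_mem)))
      rwa [show (-1 : Poly) * (pbar - MvPolynomial.C μ * p) = -pbar + MvPolynomial.C μ * p by ring] at this
  · refine slopeIdeal_le (Ideal.subset_span (by simp)) fun i j _ => ?_
    have h : -pbar + MvPolynomial.C μ * p ∈ Ideal.span {p ^ n, -pbar + MvPolynomial.C μ * p} :=
      Ideal.subset_span (by simp)
    obtain ⟨Q, hQ⟩ := sub_dvd_pow_sub_pow pbar (MvPolynomial.C μ * p) j
    have e : p ^ i * pbar ^ j - MvPolynomial.C (μ ^ j) * p ^ (i + j) =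
        (-(p ^ i * Q)) * (-pbar + MvPolynomial.C μ * p) := by
      rw [map_pow, pow_add]
      linear_combination p ^ i * hQ
    rw [e]
    exact Ideal.mul_mem_left _ _ h

theorem mem_maxIdeal_sq (i j : ℕ) (h : 2 ≤ i + j) : p ^ i * pbar ^ j ∈ maxIdeal ^ 2 := by
  refine Ideal.pow_le_pow_right h ?_
  rw [pow_add]
  exact Ideal.mul_mem_mul (Ideal.pow_mem_pow p_mem i) (Ideal.pow_mem_pow pbar_mem j)

/-- Monomials containing `p` are reduced with the generator `p (p̄ - μ p)`. A pure power of `p̄` has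
no such factor: two of its factors are first traded by `p̄² - μ² p²`, and the remainder contains
`p`. -/
theorem genericIdealD_single {r : ℕ} (hr : 2 ≤ r) (μ : ℂ) :
    genericIdealD r (Pi.single 2 μ) (Pi.single 2 (μ ^ 2)) = slopeIdeal 2 (2 * r - 1) μ := by
  have hs : ∀ c : ℂ, ∑ i ∈ Finset.Icc 1 (r - 1),
      MvPolynomial.C ((Pi.single 2 c : ℕ → ℂ) (2 * i)) * p ^ (2 * i) = MvPolynomial.C c * p ^ 2 := by
    intro c
    rw [Finset.sum_eq_single_of_mem 1 (Finset.mem_Icc.2 ⟨le_rfl, by omega⟩)]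
    · simp
    · intro b _ hb
      have : 2 * b ≠ 2 := by omega
      simp [this]
  rw [genericIdealD, hs, hs]
  have hpp : p ^ 2 ∈ maxIdeal ^ 2 := by simpa using mem_maxIdeal_sq 2 0 le_rfl
  have hpq : p * pbar ∈ maxIdeal ^ 2 := by simpa using mem_maxIdeal_sq 1 1 le_rfl
  have hqq : pbar ^ 2 ∈ maxIdeal ^ 2 := by simpa using mem_maxIdeal_sq 0 2 le_rfl
  apply le_antisymm
  · rw [Ideal.span_le]
    rintro _ (rfl | rfl | rfl)
    · exact p_pow_mem_slopeIdeal_of_le (by omega) le_rfl μ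
    · rw [SetLike.mem_coe, mem_slopeIdeal]
      refine ⟨?_, sub_mem hpq (Ideal.mul_mem_left _ _ hpp)⟩
      have : lineRes 1 μ (p * pbar - MvPolynomial.C μ * p ^ 2) = 0 := by simp; ring
      rw [this]; exact dvd_zero _
    · rw [SetLike.mem_coe, mem_slopeIdeal]
      refine ⟨?_, sub_mem hqq (Ideal.mul_mem_left _ _ hpp)⟩
      have : lineRes 1 μ (pbar ^ 2 - MvPolynomial.C (μ ^ 2) * p ^ 2) = 0 := by
        simp [mul_pow]
      rw [this]; exact dvd_zero _
  · set J := Ideal.span {p ^ (2 * r - 1), p * pbar - MvPolynomial.C μ * p ^ 2,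
      pbar ^ 2 - MvPolynomial.C (μ ^ 2) * p ^ 2} with hJ
    have g2 : p * pbar - MvPolynomial.C μ * p ^ 2 ∈ J := Ideal.subset_span (by simp)
    have g3 : pbar ^ 2 - MvPolynomial.C (μ ^ 2) * p ^ 2 ∈ J := Ideal.subset_span (by simp)
    have key : ∀ j, p * (pbar ^ j - (MvPolynomial.C μ * p) ^ j) ∈ J := by
      intro j
      obtain ⟨Q, hQ⟩ := sub_dvd_pow_sub_pow pbar (MvPolynomial.C μ * p) j
      have : p * (pbar ^ j - (MvPolynomial.C μ * p) ^ j) = Q * (p * pbar - MvPolynomial.C μ * p ^ 2) := by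
        rw [hQ]; ring
      rw [this]; exact Ideal.mul_mem_left _ _ g2
    refine slopeIdeal_le (Ideal.subset_span (by simp)) fun i j hij => ?_
    rcases i with _ | i
    · obtain ⟨l, rfl⟩ : ∃ l, j = l + 2 := ⟨j - 2, by omega⟩
      have : p ^ 0 * pbar ^ (l + 2) - MvPolynomial.C (μ ^ (l + 2)) * p ^ (0 + (l + 2)) =
          pbar ^ l * (pbar ^ 2 - MvPolynomial.C (μ ^ 2) * p ^ 2) +
          (MvPolynomial.C μ ^ 2 * p) * (p * (pbar ^ l - (MvPolynomial.C μ * p) ^ l)) := by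
        simp only [map_pow]; ring
      rw [this]
      exact add_mem (Ideal.mul_mem_left _ _ g3) (Ideal.mul_mem_left _ _ (key l))
    · have : p ^ (i + 1) * pbar ^ j - MvPolynomial.C (μ ^ j) * p ^ (i + 1 + j) =
          p ^ i * (p * (pbar ^ j - (MvPolynomial.C μ * p) ^ j)) := by
        simp only [map_pow]; ring
      rw [this]
      exact Ideal.mul_mem_left _ _ (key j)

theorem finrank_quotient_of_ker {W : Type*} [AddCommGroup W] [Module ℂ W] (I : Ideal Poly)
    (f : Poly →ₗ[ℂ] W) (hf : Function.Surjective f) (h : ∀ P, P ∈ I ↔ f P = 0) :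
    Module.finrank ℂ (Poly ⧸ I) = Module.finrank ℂ W := by
  have hker : LinearMap.ker (Ideal.Quotient.mkₐ ℂ I).toLinearMap = LinearMap.ker f := by
    ext P
    rw [LinearMap.mem_ker, LinearMap.mem_ker, ← h]
    exact Ideal.Quotient.eq_zero_iff_mem
  have e1 := LinearMap.quotKerEquivOfSurjective (Ideal.Quotient.mkₐ ℂ I).toLinearMap
    (Ideal.Quotient.mkₐ_surjective ℂ I)
  have e2 := LinearMap.quotKerEquivOfSurjective f hf
  exact (e1.symm.trans ((Submodule.quotEquivOfEq _ _ hker).trans e2)).finrank_eq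

/-- The first `M` coefficients of the restriction to the line of slope `μ`. -/
def lineCoeffs (M : ℕ) (μ : ℂ) : Poly →ₗ[ℂ] (Fin M → ℂ) :=
  LinearMap.pi fun i => (Polynomial.lcoeff ℂ (i : ℕ)).comp (lineRes 1 μ).toLinearMap

theorem lineCoeffs_eq_zero {M : ℕ} {μ : ℂ} {P : Poly} :
    lineCoeffs M μ P = 0 ↔ Polynomial.X ^ M ∣ lineRes 1 μ P := by
  rw [Polynomial.X_pow_dvd_iff]
  constructor
  · intro h d hd
    exact congrFun h ⟨d, hd⟩
  · intro h
    ext i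
    exact h i i.2

theorem lineCoeffs_sum (M : ℕ) (μ : ℂ) (c : Fin M → ℂ) :
    lineCoeffs M μ (∑ i : Fin M, MvPolynomial.C (c i) * p ^ (i : ℕ)) = c := by
  ext i
  simp [lineCoeffs, Polynomial.coeff_X_pow, Fin.val_inj]

theorem coeff_zero_lineRes (μ : ℂ) (P : Poly) : (lineRes 1 μ P).coeff 0 = P.coeff 0 := by
  rw [coeff_lineRes, homPart]
  simp

/-- Divisibility of the restriction by `X ^ n` already kills the constant term, so the order
condition is automatic and the quotient is `ℂ[X] / X ^ n`. -/
theorem finrank_slopeIdeal_one {n : ℕ} (hn : 1 ≤ n) (μ : ℂ) :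
    Module.finrank ℂ (Poly ⧸ slopeIdeal 1 n μ) = n := by
  rw [finrank_quotient_of_ker _ (lineCoeffs n μ) fun c => ⟨_, lineCoeffs_sum n μ c⟩, Module.finrank_fin_fun]
  intro P
  rw [lineCoeffs_eq_zero, mem_slopeIdeal, and_iff_left_iff_imp]
  intro h
  rw [mem_maxIdeal_pow]
  intro d hd
  have : d = 0 := by
    ext i; fin_cases i <;> simp <;> omega
  rw [this, ← coeff_zero_lineRes μ]
  exact Polynomial.X_pow_dvd_iff.1 h 0 hn

theorem homPart_one (P : Poly) (a b : ℂ) : homPart 1 P a b =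
    P.coeff (Finsupp.single 0 1) * a + P.coeff (Finsupp.single 1 1) * b := by
  induction P using MvPolynomial.induction_on' with
  | monomial d c =>
    rw [← coeff_lineRes, lineRes_monomial, Polynomial.coeff_C_mul_X_pow]
    simp only [MvPolynomial.coeff_monomial]
    by_cases h0 : d = Finsupp.single 0 1
    · subst h0; simp [Finsupp.single_left_inj]
    · by_cases h1 : d = Finsupp.single 1 1
      · subst h1; simp [Finsupp.single_left_inj]
      · rw [if_neg h0, if_neg h1, if_neg]
        · simp
        · intro h
          have : d 0 = 1 ∧ d 1 = 0 ∨ d 0 = 0 ∧ d 1 = 1 := by omega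
          rcases this with h | h
          · exact h0 (by ext i; fin_cases i <;> simp [h])
          · exact h1 (by ext i; fin_cases i <;> simp [h])
  | add P Q hP hQ =>
    simp only [homPart, map_add, MvPolynomial.coeff_add] at *
    rw [hP, hQ]; ring

/-- For `M ≥ 2` the restriction controls the constant term and the combination of the linear
coefficients of `p` and `μ p̄`. Order two then costs one more linear condition, which accounts for
the extra dimension in `finrank_slopeIdeal_two`. -/
theorem mem_slopeIdeal_two {M : ℕ} (hM : 2 ≤ M) {μ : ℂ} {P : Poly} : P ∈ slopeIdeal 2 M μ ↔
    Polynomial.X ^ M ∣ lineRes 1 μ P ∧ P.coeff (Finsupp.single 1 1) = 0 := by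
  rw [mem_slopeIdeal]
  refine and_congr_right fun h => ?_
  rw [mem_maxIdeal_pow]
  constructor
  · intro h2
    exact h2 _ (by simp)
  · intro h1 d hd
    have c0 := Polynomial.X_pow_dvd_iff.1 h 0 (by omega)
    have c1 := Polynomial.X_pow_dvd_iff.1 h 1 (by omega)
    rw [coeff_zero_lineRes] at c0
    rw [coeff_lineRes, homPart_one, h1] at c1
    have : d 0 = 0 ∧ d 1 = 0 ∨ d 0 = 1 ∧ d 1 = 0 ∨ d 0 = 0 ∧ d 1 = 1 := by omega
    rcases this with h | h | h
    · have : d = 0 := by ext i; fin_cases i <;> simp [h]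
      rw [this, c0]
    · have : d = Finsupp.single 0 1 := by ext i; fin_cases i <;> simp [h]
      rw [this]; simpa using c1
    · have : d = Finsupp.single 1 1 := by ext i; fin_cases i <;> simp [h]
      rw [this, h1]

theorem finrank_slopeIdeal_two {M : ℕ} (hM : 2 ≤ M) (μ : ℂ) :
    Module.finrank ℂ (Poly ⧸ slopeIdeal 2 M μ) = M + 1 := by
  rw [finrank_quotient_of_ker _ ((lineCoeffs M μ).prod (MvPolynomial.lcoeff ℂ (Finsupp.single 1 1)))]
  · simp
  · rintro ⟨c, e⟩
    have h1 : (lineCoeffs M μ) (pbar - MvPolynomial.C μ * p) = 0 := by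
      rw [lineCoeffs_eq_zero]; simp
    have h2 : ∀ i : ℕ, MvPolynomial.coeff (Finsupp.single 1 1) (p ^ i) = 0 := by
      intro i
      rw [p, MvPolynomial.X_pow_eq_monomial, MvPolynomial.coeff_monomial, if_neg]
      intro h
      have := DFunLike.congr_fun h 1
      simp at this
    have h3 := h2 1
    rw [pow_one] at h3
    refine ⟨∑ i : Fin M, MvPolynomial.C (c i) * p ^ (i : ℕ) +
      MvPolynomial.C e * (pbar - MvPolynomial.C μ * p), Prod.ext ?_ ?_⟩
    · change lineCoeffs M μ _ = c
      rw [map_add, lineCoeffs_sum, ← MvPolynomial.smul_eq_C_mul (pbar - _), map_smul, h1, smul_zero,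
        add_zero]
    · simp [MvPolynomial.coeff_sum, MvPolynomial.coeff_C_mul, h2, h3]
  · intro P
    rw [mem_slopeIdeal_two hM, ← lineCoeffs_eq_zero]
    simp [Prod.ext_iff]

/-- A power of `p` in the ideal forces `a = 0`, and then `(p̄ - μ p) ^ k` forces `b = 0`. -/
theorem slopeIdeal_support {k M : ℕ} (hk : 1 ≤ k) (μ a b : ℂ) :
    (∀ P ∈ slopeIdeal k M μ, MvPolynomial.eval ![a, b] P = 0) ↔ a = 0 ∧ b = 0 := by
  constructor
  · intro h
    have h1 := h (p ^ (k + M)) (by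
      rw [mem_slopeIdeal]
      exact ⟨by simp [pow_add], Ideal.pow_le_pow_right (by omega) (Ideal.pow_mem_pow p_mem _)⟩)
    have ha : a = 0 := by
      simp at h1
      exact h1.1
    have h2 := h ((pbar - MvPolynomial.C μ * p) ^ k) (by
      rw [mem_slopeIdeal]
      refine ⟨?_, Ideal.pow_mem_pow (sub_mem pbar_mem (Ideal.mul_mem_left _ _ p_mem)) _⟩
      have : lineRes 1 μ ((pbar - MvPolynomial.C μ * p) ^ k) = 0 := by
        simp; omega
      rw [this]; exact dvd_zero _)
    simp [ha] at h2
    exact ⟨ha, h2.1⟩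
  · rintro ⟨rfl, rfl⟩ P hP
    have h0 := mem_maxIdeal_pow.1 (mem_slopeIdeal.1 hP).2 0 (by simp; omega)
    have h2 : MvPolynomial.eval (0 : Fin 2 → ℂ) P = P.coeff 0 := by
      rw [← MvPolynomial.constantCoeff_eq, MvPolynomial.eval_zero]
    rw [show ![(0 : ℂ), 0] = 0 by ext i; fin_cases i <;> rfl, h2, h0]

theorem slopeIdeal_neg {k M : ℕ} {μ : ℂ} {P : Poly} (hP : P ∈ slopeIdeal k M μ) :
    negPoly P ∈ slopeIdeal k M μ := by
  have : negPoly P = linSubst (-1) 0 0 (-1) P := by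
    simp [negPoly, linSubst]
  rw [this]
  exact linSubst_mem_slopeIdeal (c := -1) (by simp) (by simp) hP

theorem conjPoly_p : conjPoly p = pbar := by
  simp [conjPoly]

theorem conjPoly_pbar : conjPoly pbar = p := by
  simp [conjPoly]

theorem conjPoly_C (c : ℂ) : conjPoly (MvPolynomial.C c) = MvPolynomial.C ((starRingEnd ℂ) c) := by
  simp [conjPoly]

theorem map_conjPoly_maxIdeal_le : maxIdeal.map conjPoly ≤ maxIdeal := by
  conv_lhs => rw [maxIdeal]
  rw [Ideal.map_span, Ideal.span_le]
  rintro _ ⟨x, hx | hx, rfl⟩ <;> rw [hx]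
  · rw [conjPoly_p]; exact pbar_mem
  · rw [conjPoly_pbar]; exact p_mem

theorem sup_conj_le {I : Ideal Poly} {k : ℕ} (h : I ≤ maxIdeal ^ k) :
    I ⊔ I.map conjPoly ≤ maxIdeal ^ k := by
  refine sup_le h ((Ideal.map_mono h).trans ?_)
  rw [Ideal.map_pow]
  exact Ideal.pow_right_mono map_conjPoly_maxIdeal_le k

theorem one_sub_normSq_ne_zero {μ : ℂ} (hμ : ‖μ‖ < 1) : 1 - μ * (starRingEnd ℂ) μ ≠ 0 := by
  rw [Complex.mul_conj, Complex.normSq_eq_norm_sq]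
  have : ‖μ‖ ^ 2 < 1 := by nlinarith [norm_nonneg μ]
  intro h
  have h2 : (1 - ‖μ‖ ^ 2 : ℝ) = 0 := by exact_mod_cast h
  linarith

/-- The linear forms `p̄ - μ p` and its conjugate `p - μ̄ p̄` have determinant `1 - |μ|²` up to
sign. This is nonzero for `|μ| < 1`, so together they generate `p` and `p̄`. -/
theorem slopeIdeal_reality_one {n : ℕ} {μ : ℂ} (hμ : ‖μ‖ < 1) :
    slopeIdeal 1 n μ ⊔ (slopeIdeal 1 n μ).map conjPoly = maxIdeal := by
  apply le_antisymm
  · conv_rhs => rw [← pow_one maxIdeal]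
    exact sup_conj_le inf_le_right
  · set J := slopeIdeal 1 n μ ⊔ (slopeIdeal 1 n μ).map conjPoly
    have g : pbar - MvPolynomial.C μ * p ∈ slopeIdeal 1 n μ := by
      have := mul_mem_slopeIdeal (μ := μ) (k := 1) (M := n) (N := 1) (by
        rw [pow_one]
        exact Ideal.mul_mem_left _ _ (sub_mem pbar_mem (Ideal.mul_mem_left _ _ p_mem)))
      rwa [one_mul] at this
    have h1 : pbar - MvPolynomial.C μ * p ∈ J := Ideal.mem_sup_left g
    have h2 : p - MvPolynomial.C ((starRingEnd ℂ) μ) * pbar ∈ J := by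
      have := Ideal.mem_sup_right (S := slopeIdeal 1 n μ) (Ideal.mem_map_of_mem conjPoly g)
      rwa [map_sub, map_mul, conjPoly_p, conjPoly_pbar, conjPoly_C] at this
    set c := 1 - μ * (starRingEnd ℂ) μ with hc
    have hcc : (MvPolynomial.C c⁻¹ : Poly) * MvPolynomial.C c = 1 := by
      rw [← map_mul, inv_mul_cancel₀ (one_sub_normSq_ne_zero hμ), map_one]
    have hp : p ∈ J := by
      have e : p = MvPolynomial.C c⁻¹ * ((p - MvPolynomial.C ((starRingEnd ℂ) μ) * pbar) +
          MvPolynomial.C ((starRingEnd ℂ) μ) * (pbar - MvPolynomial.C μ * p)) := by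
        have : (MvPolynomial.C c : Poly) = 1 - MvPolynomial.C μ * MvPolynomial.C ((starRingEnd ℂ) μ) := by
          rw [hc]; simp only [map_sub, map_mul, map_one]
        rw [this] at hcc
        linear_combination (-p) * hcc
      rw [e]
      exact Ideal.mul_mem_left _ _ (add_mem h2 (Ideal.mul_mem_left _ _ h1))
    have hq : pbar ∈ J := by
      have e : pbar = (pbar - MvPolynomial.C μ * p) + MvPolynomial.C μ * p := by ring
      rw [e]; exact add_mem h1 (Ideal.mul_mem_left _ _ hp)
    rw [maxIdeal, Ideal.span_le]
    rintro _ (rfl | rfl)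
    · exact hp
    · exact hq

/-- The same elimination as in order one, applied to the products of the two linear forms with `p`
and `p̄`; it yields all quadratic monomials. -/
theorem slopeIdeal_reality_two {n : ℕ} {μ : ℂ} (hμ : ‖μ‖ < 1) :
    slopeIdeal 2 n μ ⊔ (slopeIdeal 2 n μ).map conjPoly = maxIdeal ^ 2 := by
  apply le_antisymm
  · exact sup_conj_le inf_le_right
  · set J := slopeIdeal 2 n μ ⊔ (slopeIdeal 2 n μ).map conjPoly
    have gm : pbar - MvPolynomial.C μ * p ∈ maxIdeal :=
      sub_mem pbar_mem (Ideal.mul_mem_left _ _ p_mem)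
    have g : ∀ N ∈ maxIdeal, N * (pbar - MvPolynomial.C μ * p) ∈ slopeIdeal 2 n μ := fun N hN =>
      mul_mem_slopeIdeal (by rw [sq]; exact Ideal.mul_mem_mul hN gm)
    have h1 := Ideal.mem_sup_left (T := (slopeIdeal 2 n μ).map conjPoly) (g p p_mem)
    have h2 := Ideal.mem_sup_left (T := (slopeIdeal 2 n μ).map conjPoly) (g pbar pbar_mem)
    have h3 := Ideal.mem_sup_right (S := slopeIdeal 2 n μ) (Ideal.mem_map_of_mem conjPoly (g p p_mem))
    have h4 := Ideal.mem_sup_right (S := slopeIdeal 2 n μ)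
      (Ideal.mem_map_of_mem conjPoly (g pbar pbar_mem))
    rw [map_mul, map_sub, map_mul, conjPoly_p, conjPoly_pbar, conjPoly_C] at h3 h4
    change _ ∈ J at h1 h2 h3 h4
    set ν := (starRingEnd ℂ) μ with hν
    set c := 1 - μ * ν with hc
    have hcc : (MvPolynomial.C c⁻¹ : Poly) * (1 - MvPolynomial.C μ * MvPolynomial.C ν) = 1 := by
      have : (MvPolynomial.C c : Poly) = 1 - MvPolynomial.C μ * MvPolynomial.C ν := by
        rw [hc]; simp only [map_sub, map_mul, map_one]
      rw [← this, ← map_mul, inv_mul_cancel₀ (one_sub_normSq_ne_zero hμ), map_one]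
    have m1 : p * p ∈ J := by
      have e : p * p = MvPolynomial.C c⁻¹ * (p * (p - MvPolynomial.C ν * pbar) +
          MvPolynomial.C ν * (p * (pbar - MvPolynomial.C μ * p))) := by
        linear_combination (-(p * p)) * hcc
      rw [e]
      exact Ideal.mul_mem_left _ _ (add_mem h4 (Ideal.mul_mem_left _ _ h1))
    have m2 : p * pbar ∈ J := by
      have e : p * pbar = p * (pbar - MvPolynomial.C μ * p) + MvPolynomial.C μ * (p * p) := by ring
      rw [e]; exact add_mem h1 (Ideal.mul_mem_left _ _ m1)
    have m3 : pbar * pbar ∈ J := by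
      have e : pbar * pbar = pbar * (pbar - MvPolynomial.C μ * p) + MvPolynomial.C μ * (p * pbar) := by
        ring
      rw [e]; exact add_mem h2 (Ideal.mul_mem_left _ _ m2)
    rw [sq, maxIdeal, Ideal.span_pair_mul_span_pair, Ideal.span_le]
    rintro _ (rfl | rfl | rfl | rfl)
    · exact m1
    · exact m2
    · rw [mul_comm]; exact m2
    · exact m3

end

/-! ### The slope of a compatible ideal. -/

section

theorem coeff_lineRes_p_pow (m : ℕ) (c a b : ℂ) (k : ℕ) :
    (lineRes a b (MvPolynomial.C c * p ^ m)).coeff k = if k = m then c * a ^ m else 0 := by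
  have : lineRes a b (MvPolynomial.C c * p ^ m) = Polynomial.C (c * a ^ m) * Polynomial.X ^ m := by
    simp [mul_pow, mul_assoc]
  rw [this, Polynomial.coeff_C_mul_X_pow]

theorem mem_slopeIdeal_succ {k : ℕ} {μ : ℂ} {P : Poly} (h : P ∈ maxIdeal ^ k)
    (h2 : homPart k P 1 μ = 0) : P ∈ slopeIdeal k (k + 1) μ := by
  rw [mem_slopeIdeal]
  refine ⟨Polynomial.X_pow_dvd_iff.2 fun d hd => ?_, h⟩
  rcases Nat.lt_succ_iff_lt_or_eq.1 hd with hd | rfl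
  · exact Polynomial.X_pow_dvd_iff.1 (X_pow_dvd_lineRes h 1 μ) d hd
  · rw [coeff_lineRes, h2]

/-- Only the terms `-p̄ + μ₂ p` of the generators are linear; everything else, including `p ^ n`,
has degree at least two. -/
theorem hasSlope_genericIdeal {n : ℕ} (hn : 2 ≤ n) (μ : ℕ → ℂ) : HasSlope 1 (genericIdeal n μ) (μ 2) := by
  have hsum : ∀ x y k, (lineRes x y (∑ k ∈ Finset.Icc 2 n, MvPolynomial.C (μ k) * p ^ (k - 1))).coeff k =
      if k + 1 ∈ Finset.Icc 2 n then μ (k + 1) * x ^ k else 0 := by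
    intro x y k
    have := Finset.sum_ite_eq' (Finset.Icc 2 n) (k + 1) (fun j => μ j * x ^ (j - 1))
    rw [Nat.add_sub_cancel] at this
    rw [map_sum, Polynomial.finsetSum_coeff, ← this]
    refine Finset.sum_congr rfl fun j hj => ?_
    rw [Finset.mem_Icc] at hj
    rw [coeff_lineRes_p_pow]
    exact if_congr (by omega) rfl rfl
  have hg : ∀ x y, homPart 1 (-pbar + ∑ k ∈ Finset.Icc 2 n, MvPolynomial.C (μ k) * p ^ (k - 1)) x y =
      -y + μ 2 * x := by
    intro x y
    rw [← coeff_lineRes, map_add, Polynomial.coeff_add, hsum, if_pos (by simpa using hn)]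
    simp
  refine ⟨?_, ?_⟩
  · rw [genericIdeal, Ideal.span_le]
    rintro _ (rfl | rfl)
    · exact p_pow_mem_slopeIdeal_of_le (by omega) hn _
    · refine mem_slopeIdeal_succ ?_ (by rw [hg]; ring)
      rw [pow_one]
      refine add_mem (neg_mem pbar_mem) (sum_mem fun k hk => ?_)
      exact Ideal.mul_mem_left _ _ (Ideal.pow_mem_of_mem _ p_mem _ (by simp at hk; omega))
  · intro a b hab
    obtain ⟨rfl, rfl⟩ : a = 0 ∧ b = 0 := by omega
    refine ⟨-(-pbar + ∑ k ∈ Finset.Icc 2 n, MvPolynomial.C (μ k) * p ^ (k - 1)),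
      neg_mem (Ideal.subset_span (by simp)), fun x y => ?_⟩
    have := hg x y
    simp only [homPart, map_neg] at this ⊢
    rw [this]; ring

theorem even_sum_eq {R : Type*} [CommRing R] {r : ℕ} (hr : 2 ≤ r) (c : ℕ → R) (x : R) :
    ∃ s, ∑ i ∈ Finset.Icc 1 (r - 1), c (2 * i) * x ^ (2 * i) = c 2 * x ^ 2 + x ^ 4 * s := by
  have h1 : 1 ∈ Finset.Icc 1 (r - 1) := Finset.mem_Icc.2 ⟨le_rfl, by omega⟩
  have : x ^ 4 ∣ ∑ i ∈ (Finset.Icc 1 (r - 1)).erase 1, c (2 * i) * x ^ (2 * i) := by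
    refine Finset.dvd_sum fun i hi => ?_
    simp at hi
    exact Dvd.dvd.mul_left (pow_dvd_pow x (by omega)) _
  obtain ⟨s, hs⟩ := this
  exact ⟨s, by rw [← Finset.add_sum_erase _ _ h1, hs]⟩

/-- In an ideal of type `D` of the right codimension, `ν₂ = μ₂²`. -/
theorem nu_eq_of_finrank {r : ℕ} (hr : 3 ≤ r) {μ ν : ℕ → ℂ}
    (h : Module.finrank ℂ (Poly ⧸ genericIdealD r μ ν) = 2 * r) : ν 2 = μ 2 ^ 2 := by
  by_contra hne
  set I := genericIdealD r μ ν with hI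
  let mkI : Poly →ₐ[ℂ] (Poly ⧸ I) := Ideal.Quotient.mkₐ ℂ I
  set x := mkI p with hx
  set y := mkI pbar with hy
  have hz : ∀ P ∈ I, mkI P = 0 := fun P hP => Ideal.Quotient.eq_zero_iff_mem.2 hP
  have hC : ∀ c : ℂ, mkI (MvPolynomial.C c) = algebraMap ℂ _ c := fun c => mkI.commutes c
  have e1 : x ^ (2 * r - 1) = 0 := by
    rw [hx, ← map_pow]; exact hz _ (Ideal.subset_span (by simp))
  obtain ⟨s, hs⟩ := even_sum_eq (by omega : 2 ≤ r) (fun i => algebraMap ℂ (Poly ⧸ I) (μ i)) x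
  obtain ⟨s', hs'⟩ := even_sum_eq (by omega : 2 ≤ r) (fun i => algebraMap ℂ (Poly ⧸ I) (ν i)) x
  have e2 : x * y = algebraMap ℂ _ (μ 2) * x ^ 2 + x ^ 4 * s := by
    rw [← hs, ← sub_eq_zero]
    have := hz _ (Ideal.subset_span (by simp) : p * pbar - ∑ i ∈ Finset.Icc 1 (r - 1),
      MvPolynomial.C (μ (2 * i)) * p ^ (2 * i) ∈ I)
    rw [← this]
    simp [hC, hx, hy]
  have e3 : y ^ 2 = algebraMap ℂ _ (ν 2) * x ^ 2 + x ^ 4 * s' := by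
    rw [← hs', ← sub_eq_zero]
    have := hz _ (Ideal.subset_span (by simp) : pbar ^ 2 - ∑ i ∈ Finset.Icc 1 (r - 1),
      MvPolynomial.C (ν (2 * i)) * p ^ (2 * i) ∈ I)
    rw [← this]
    simp [hC, hx, hy]
  set m := algebraMap ℂ (Poly ⧸ I) (μ 2) with hm
  set n := algebraMap ℂ (Poly ⧸ I) (ν 2) with hn
  -- Computing `x y²` from `y²` and from `(x y) y` gives two expressions, whose difference is `x³`
  -- times the constant `ν₂ - μ₂²` plus a nilpotent.
  have e4 : x ^ 3 * ((n - m ^ 2) + x ^ 2 * (s' - 2 * m * s - x ^ 2 * s ^ 2)) = 0 := by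
    linear_combination (-x) * e3 + (y + m * x + x ^ 3 * s) * e2
  have hunit : IsUnit ((n - m ^ 2) + x ^ 2 * (s' - 2 * m * s - x ^ 2 * s ^ 2)) := by
    have h1 : IsUnit (n - m ^ 2) := by
      rw [hn, hm, ← map_pow, ← map_sub]
      exact (IsUnit.mk0 _ (sub_ne_zero.2 hne)).map _
    have h2 : IsNilpotent (x ^ 2 * (s' - 2 * m * s - x ^ 2 * s ^ 2)) := by
      have : IsNilpotent x := ⟨_, e1⟩
      exact (Commute.all _ _).isNilpotent_mul_right (this.pow_of_pos (by norm_num))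
    exact h2.isUnit_add_left_of_commute h1 (Commute.all _ _)
  have hx3 : x ^ 3 = 0 := by
    rwa [hunit.mul_left_eq_zero] at e4
  have hx4 : x ^ 4 = 0 := by rw [pow_succ, hx3, zero_mul]
  rw [hx4, zero_mul, add_zero] at e2 e3
  -- With `x³ = 0` the quotient is spanned by `1, x, x², y`, so its dimension is at most four,
  -- against `2r ≥ 6`.
  set W := Submodule.span ℂ (Set.range ![1, x, x ^ 2, y]) with hW
  have w0 : (1 : Poly ⧸ I) ∈ W := Submodule.subset_span ⟨0, rfl⟩
  have w1 : x ∈ W := Submodule.subset_span ⟨1, rfl⟩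
  have w2 : x ^ 2 ∈ W := Submodule.subset_span ⟨2, rfl⟩
  have w3 : y ∈ W := Submodule.subset_span ⟨3, rfl⟩
  have alg : ∀ (c : ℂ) (w : Poly ⧸ I), w ∈ W → algebraMap ℂ _ c * w ∈ W := by
    intro c w hw
    rw [← Algebra.smul_def]; exact W.smul_mem c hw
  have mulx : ∀ w ∈ W, w * x ∈ W := by
    intro w hw
    refine Submodule.span_induction ?_ (by simp) (fun a b _ _ ha hb => by rw [add_mul]; exact add_mem ha hb)
      (fun c a _ ha => by rw [smul_mul_assoc]; exact W.smul_mem c ha) hw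
    rintro _ ⟨i, rfl⟩
    fin_cases i
    · simpa using w1
    · simpa [← sq] using w2
    · have : x ^ 2 * x = 0 := by rw [← pow_succ, hx3]
      simp [this]
    · have : y * x = m * x ^ 2 := by rw [mul_comm, e2]
      change y * x ∈ W
      rw [this]; exact alg _ _ w2
  have muly : ∀ w ∈ W, w * y ∈ W := by
    intro w hw
    refine Submodule.span_induction ?_ (by simp) (fun a b _ _ ha hb => by rw [add_mul]; exact add_mem ha hb)
      (fun c a _ ha => by rw [smul_mul_assoc]; exact W.smul_mem c ha) hw
    rintro _ ⟨i, rfl⟩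
    fin_cases i
    · simpa using w3
    · change x * y ∈ W
      rw [e2]; exact alg _ _ w2
    · have : x ^ 2 * y = 0 := by linear_combination x * e2 + m * hx3
      change x ^ 2 * y ∈ W
      rw [this]; exact zero_mem _
    · change y * y ∈ W
      rw [← sq, e3]; exact alg _ _ w2
  have top : W = ⊤ := by
    rw [eq_top_iff]
    rintro q -
    obtain ⟨P, rfl⟩ := Ideal.Quotient.mkₐ_surjective ℂ I q
    change mkI P ∈ W
    induction P using MvPolynomial.induction_on with
    | C c => rw [hC, ← mul_one (algebraMap ℂ _ c)]; exact alg _ _ w0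
    | add P Q hP hQ => rw [map_add]; exact add_mem hP hQ
    | mul_X P i hP =>
      rw [map_mul]
      fin_cases i
      · exact mulx _ hP
      · exact muly _ hP
  have h4 : Module.finrank ℂ W ≤ 4 := by
    have := finrank_range_le_card (R := ℂ) (![1, x, x ^ 2, y] : Fin 4 → Poly ⧸ I)
    simpa [Set.finrank] using this
  rw [top, finrank_top, h] at h4
  omega

/-- For `ν₂ = μ₂²` the quadratic parts of the generators are `x (y - μ₂ x)` and `(y + μ₂ x)(y - μ₂
x)`, which share the factor required by the slope. -/
theorem hasSlope_genericIdealD {r : ℕ} (hr : 2 ≤ r) {μ ν : ℕ → ℂ} (h : ν 2 = μ 2 ^ 2) :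
    HasSlope 2 (genericIdealD r μ ν) (μ 2) := by
  have hs : ∀ c : ℕ → ℂ, ∀ x y, homPart 2 (∑ i ∈ Finset.Icc 1 (r - 1),
      MvPolynomial.C (c (2 * i)) * p ^ (2 * i)) x y = c 2 * x ^ 2 := by
    intro c x y
    rw [← coeff_lineRes, map_sum, Polynomial.finsetSum_coeff,
      Finset.sum_eq_single_of_mem 1 (Finset.mem_Icc.2 ⟨le_rfl, by omega⟩)]
    · rw [coeff_lineRes_p_pow]; simp
    · intro b _ hb
      rw [coeff_lineRes_p_pow, if_neg (by omega)]
  have hsm : ∀ c : ℕ → ℂ, ∑ i ∈ Finset.Icc 1 (r - 1),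
      MvPolynomial.C (c (2 * i)) * p ^ (2 * i) ∈ maxIdeal ^ 2 := by
    intro c
    refine sum_mem fun i hi => Ideal.mul_mem_left _ _ ?_
    simpa using mem_maxIdeal_sq (2 * i) 0 (by simp at hi; omega)
  have h2 : ∀ x y, homPart 2 (p * pbar - ∑ i ∈ Finset.Icc 1 (r - 1),
      MvPolynomial.C (μ (2 * i)) * p ^ (2 * i)) x y = x * y - μ 2 * x ^ 2 := by
    intro x y
    have := hs μ x y
    simp only [homPart, map_sub] at this ⊢
    rw [this]
    congr 1
    have : homPart 2 (p * pbar) x y = x * y := by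
      rw [← coeff_lineRes, map_mul, lineRes_p, lineRes_pbar]
      rw [show Polynomial.C x * Polynomial.X * (Polynomial.C y * Polynomial.X) =
        Polynomial.C (x * y) * Polynomial.X ^ 2 by simp only [map_mul]; ring]
      rw [Polynomial.coeff_C_mul_X_pow]
      simp
    exact this
  have h3 : ∀ x y, homPart 2 (pbar ^ 2 - ∑ i ∈ Finset.Icc 1 (r - 1),
      MvPolynomial.C (ν (2 * i)) * p ^ (2 * i)) x y = y ^ 2 - μ 2 ^ 2 * x ^ 2 := by
    intro x y
    have := hs ν x y
    simp only [homPart, map_sub] at this ⊢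
    rw [this, h]
    congr 1
    have : homPart 2 (pbar ^ 2) x y = y ^ 2 := by
      rw [← coeff_lineRes, map_pow, lineRes_pbar, mul_pow, ← map_pow, Polynomial.coeff_C_mul_X_pow]
      simp
    exact this
  refine ⟨?_, ?_⟩
  · rw [genericIdealD, Ideal.span_le]
    rintro _ (rfl | rfl | rfl)
    · rw [SetLike.mem_coe]
      exact p_pow_mem_slopeIdeal_of_le (by omega) (by omega) _
    · refine mem_slopeIdeal_succ (sub_mem ?_ (hsm _)) (by rw [h2]; ring)
      simpa using mem_maxIdeal_sq 1 1 le_rfl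
    · refine mem_slopeIdeal_succ (sub_mem ?_ (hsm _)) (by rw [h3]; ring)
      simpa using mem_maxIdeal_sq 0 2 le_rfl
  · intro a b hab
    obtain ⟨rfl, rfl⟩ | ⟨rfl, rfl⟩ : a = 1 ∧ b = 0 ∨ a = 0 ∧ b = 1 := by omega
    · exact ⟨p * pbar - ∑ i ∈ Finset.Icc 1 (r - 1), MvPolynomial.C (μ (2 * i)) * p ^ (2 * i),
        Ideal.subset_span (by simp), fun x y => by rw [h2]; ring⟩
    -- This combination is chosen for `y (y - μ x) = (y² - μ² x²) - μ (x y - μ x²)`.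
    · refine ⟨(pbar ^ 2 - ∑ i ∈ Finset.Icc 1 (r - 1), MvPolynomial.C (ν (2 * i)) * p ^ (2 * i)) -
        MvPolynomial.C (μ 2) * (p * pbar - ∑ i ∈ Finset.Icc 1 (r - 1),
          MvPolynomial.C (μ (2 * i)) * p ^ (2 * i)),
        sub_mem (Ideal.subset_span (by simp)) (Ideal.mul_mem_left _ _ (Ideal.subset_span (by simp))),
        fun x y => ?_⟩
      have a2 := h2 x y
      have a3 := h3 x y
      rw [← MvPolynomial.smul_eq_C_mul (p * pbar - _)]
      simp only [homPart, map_sub, map_smul, MvPolynomial.smul_eval] at a2 a3 ⊢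
      rw [a2, a3]
      ring

end

/-! ### Canonical charts of the cotangent bundle. -/

section

variable {S : Type*} [TopologicalSpace S] [ChartedSpace ℂ S] [IsManifold 𝓘(ℂ) ω S]

/-- The real cotangent space of `ℂ`. -/
abbrev Covec : Type := ℂ →L[ℝ] ℝ

/-- The transition map from the preferred chart at `a` to the one at `b`. -/
def transition (a b : S) : ℂ → ℂ := fun q => chartAt ℂ b ((chartAt ℂ a).symm q)

theorem contDiffAt_transition_complex (a b : S) {q : ℂ} (hq : q ∈ (chartAt ℂ a).target)
    (hb : (chartAt ℂ a).symm q ∈ (chartAt ℂ b).source) : ContDiffAt ℂ ω (transition a b) q := by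
  have h := contDiffOn_ext_coord_change (I := 𝓘(ℂ)) (n := ω) b a
  refine (h.contDiffAt (x := q) ?_)
  have ho : IsOpen ((extChartAt 𝓘(ℂ) a).symm ≫ extChartAt 𝓘(ℂ) b).source := by
    simpa using ((chartAt ℂ a).symm.trans (chartAt ℂ b)).open_source
  exact ho.mem_nhds (by simp [hq, hb])

/-- The canonical chart of the cotangent bundle induced by the preferred chart at `a`. -/
def cotChart (a : S) : PartialEquiv (Cotangent S) (ℂ × Covec) := extChartAt IT (covector a 0)

theorem extChartAt_eq_cotChart (x : Cotangent S) : extChartAt IT x = cotChart x.proj := by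
  rfl

theorem cotChart_source (a : S) : (cotChart a).source = {x | x.proj ∈ (chartAt ℂ a).source} := by
  ext x
  rw [cotChart, FiberBundle.extChartAt]
  simp only [covector, PartialEquiv.trans_source, hom_trivializationAt_source, PartialEquiv.prod_source,
    Set.mem_inter_iff, Set.mem_preimage, TangentBundle.trivializationAt_baseSet, Set.mem_ofPred_eq]
  simp
  intro h
  exact h

theorem cotChart_target (a : S) : (cotChart a).target = (chartAt ℂ a).target ×ˢ Set.univ := by
  rw [cotChart, FiberBundle.extChartAt_target]
  ext x
  simp only [covector, hom_trivializationAt_baseSet, TangentBundle.trivializationAt_baseSet]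
  simp
  intro h
  exact (chartAt ℂ a).map_target h

/-- The covector part of a point of the cotangent bundle, in the preferred chart at its base point. -/
def cov (x : Cotangent S) : Covec := x.2

theorem cov_covector (z : S) (ξ : Covec) : cov (covector z ξ) = ξ := rfl

theorem covector_proj_cov (x : Cotangent S) : covector x.proj (cov x) = x := rfl

/-- A point of the bundle stores its covector in the preferred chart at its own base point. Reading
it in the chart at `a` means pulling it back by the transition from `a` to that chart. -/
theorem cotChart_apply {a : S} {x : Cotangent S} (hx : x.proj ∈ (chartAt ℂ a).source) :
    cotChart a x = (chartAt ℂ a x.proj,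
      (cov x).comp (fderiv ℝ (transition a x.proj) (chartAt ℂ a x.proj))) := by
  rw [cotChart, FiberBundle.extChartAt]
  ext1
  · simp [covector]
    rfl
  · simp [covector, hom_trivializationAt_apply]
    rw [ContinuousLinearMap.inCoordinates]
    rw [TangentBundle.symmL_trivializationAt hx]
    have hd : MDifferentiableWithinAt 𝓘(ℝ, ℂ) 𝓘(ℝ, ℂ) (extChartAt 𝓘(ℝ, ℂ) a).symm (Set.range 𝓘(ℝ, ℂ))
        (extChartAt 𝓘(ℝ, ℂ) a x.proj) :=
      mdifferentiableWithinAt_extChartAt_symm (by simp [hx])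
    rw [hd.mfderivWithin]
    simp [writtenInExtChartAt, hx]
    rfl

theorem cotChart_symm_proj {a : S} {y : ℂ × Covec} (hy : y.1 ∈ (chartAt ℂ a).target) :
    ((cotChart a).symm y).proj = (chartAt ℂ a).symm y.1 := by
  have h1 : y ∈ (cotChart a).target := by rw [cotChart_target]; exact ⟨hy, trivial⟩
  have h2 := (cotChart a).map_target h1
  rw [cotChart_source] at h2
  have h3 := congrArg Prod.fst ((cotChart a).right_inv h1)
  rw [cotChart_apply h2] at h3
  rw [← h3]
  exact ((chartAt ℂ a).left_inv h2).symm

theorem contDiffAt_transition (a b : S) {q : ℂ} (hq : q ∈ (chartAt ℂ a).target)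
    (hb : (chartAt ℂ a).symm q ∈ (chartAt ℂ b).source) : ContDiffAt ℝ ω (transition a b) q :=
  (contDiffAt_transition_complex a b hq hb).restrict_scalars ℝ

omit [IsManifold 𝓘(ℂ) ω S] in
theorem transition_comp_eventuallyEq (a b c : S) {q : ℂ} (hq : q ∈ (chartAt ℂ a).target)
    (hb : (chartAt ℂ a).symm q ∈ (chartAt ℂ b).source) :
    transition b c ∘ transition a b =ᶠ[𝓝 q] transition a c := by
  have h : ∀ᶠ q' in 𝓝 q, q' ∈ (chartAt ℂ a).target ∧ (chartAt ℂ a).symm q' ∈ (chartAt ℂ b).source :=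
    Filter.Eventually.and ((chartAt ℂ a).open_target.mem_nhds hq)
      (((chartAt ℂ a).continuousAt_symm hq).eventually_mem ((chartAt ℂ b).open_source.mem_nhds hb))
  filter_upwards [h] with q' h'
  simp [transition, (chartAt ℂ b).left_inv h'.2]

theorem fderiv_transition_comp (a b c : S) {q : ℂ} (hq : q ∈ (chartAt ℂ a).target)
    (hb : (chartAt ℂ a).symm q ∈ (chartAt ℂ b).source)
    (hc : (chartAt ℂ a).symm q ∈ (chartAt ℂ c).source) :
    (fderiv ℝ (transition b c) (transition a b q)).comp (fderiv ℝ (transition a b) q) =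
      fderiv ℝ (transition a c) q := by
  rw [← (transition_comp_eventuallyEq a b c hq hb).fderiv_eq, fderiv_comp]
  · refine (contDiffAt_transition b c ((chartAt ℂ b).map_source hb) ?_).differentiableAt (by simp)
    rwa [(chartAt ℂ b).left_inv hb]
  · exact (contDiffAt_transition a b hq hb).differentiableAt (by simp)

omit [IsManifold 𝓘(ℂ) ω S] in
theorem fderiv_transition_self (a : S) {q : ℂ} (hq : q ∈ (chartAt ℂ a).target) :
    fderiv ℝ (transition a a) q = ContinuousLinearMap.id ℝ ℂ := by
  have h : transition a a =ᶠ[𝓝 q] id := by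
    filter_upwards [(chartAt ℂ a).open_target.mem_nhds hq] with q' h'
    exact (chartAt ℂ a).right_inv h'
  rw [h.fderiv_eq, fderiv_id]

/-- The transition is holomorphic, so its real derivative is multiplication by a complex number. The
reference complex structure enters the later computations in this way. -/
theorem fderiv_transition_apply (a b : S) {q : ℂ} (hq : q ∈ (chartAt ℂ a).target)
    (hb : (chartAt ℂ a).symm q ∈ (chartAt ℂ b).source) (v : ℂ) :
    fderiv ℝ (transition a b) q v = deriv (transition a b) q * v := by
  have h := ((contDiffAt_transition_complex a b hq hb).differentiableAt (by simp)).hasDerivAt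
  have h2 := h.hasFDerivAt.restrictScalars ℝ
  rw [h2.fderiv]
  simp [mul_comm]

/-- The canonical symplectic form on `ℂ × Covec`. -/
def stdForm (w w' : ℂ × Covec) : ℝ := w'.2 w.1 - w.2 w'.1

theorem cotChart_zero {a z : S} (hz : z ∈ (chartAt ℂ a).source) :
    cotChart a (covector z 0) = (chartAt ℂ a z, 0) := by
  rw [cotChart_apply hz, cov_covector, ContinuousLinearMap.zero_comp]
  rfl


theorem mem_cotChart_source {a : S} {x : Cotangent S} :
    x ∈ (cotChart a).source ↔ x.proj ∈ (chartAt ℂ a).source := by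
  rw [cotChart_source]; rfl

theorem mem_cotChart_target {a : S} {y : ℂ × Covec} :
    y ∈ (cotChart a).target ↔ y.1 ∈ (chartAt ℂ a).target := by
  rw [cotChart_target]; simp

theorem isOpen_cotChart_target (a : S) : IsOpen (cotChart a).target := by
  rw [cotChart_target]; exact (chartAt ℂ a).open_target.prod isOpen_univ

theorem isOpen_cotChart_source (a : S) : IsOpen (cotChart a).source := isOpen_extChartAt_source _

theorem contMDiffAt_cotChart {a : S} {x : Cotangent S} (hx : x.proj ∈ (chartAt ℂ a).source) :
    ContMDiffAt IT 𝓘(ℝ, ℂ × Covec) ∞ (cotChart a) x := by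
  have := mem_cotChart_source.2 hx
  rw [cotChart, extChartAt_source] at this
  exact contMDiffAt_extChartAt' this

theorem contMDiffAt_cotChart_symm {a : S} {y : ℂ × Covec} (hy : y.1 ∈ (chartAt ℂ a).target) :
    ContMDiffAt 𝓘(ℝ, ℂ × Covec) IT ∞ (cotChart a).symm y :=
  (contMDiffOn_extChartAt_symm (I := IT) (covector a 0)).contMDiffAt
    ((isOpen_cotChart_target a).mem_nhds (mem_cotChart_target.2 hy))

/-- The transition map of the canonical charts of the cotangent bundle. -/
def cotTransition (a b : S) : ℂ × Covec → ℂ × Covec := fun y => cotChart b ((cotChart a).symm y)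

theorem contDiffAt_cotTransition {a b : S} {y : ℂ × Covec} (hy : y.1 ∈ (chartAt ℂ a).target)
    (hb : (chartAt ℂ a).symm y.1 ∈ (chartAt ℂ b).source) :
    ContDiffAt ℝ ∞ (cotTransition a b) y := by
  rw [← contMDiffAt_iff_contDiffAt]
  refine ContMDiffAt.comp y (contMDiffAt_cotChart ?_) (contMDiffAt_cotChart_symm hy)
  rwa [cotChart_symm_proj hy]

theorem cotChart_symm_snd {a : S} {y : ℂ × Covec} (hy : y.1 ∈ (chartAt ℂ a).target) :
    (cov ((cotChart a).symm y)).comp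
      (fderiv ℝ (transition a ((chartAt ℂ a).symm y.1)) y.1) = y.2 := by
  have h := (cotChart a).right_inv (mem_cotChart_target.2 hy)
  have hp := cotChart_symm_proj hy
  rw [cotChart_apply (by rw [hp]; exact (chartAt ℂ a).map_target hy)] at h
  rw [hp, (chartAt ℂ a).right_inv hy] at h
  exact congrArg Prod.snd h

theorem cotTransition_fst {a b : S} {y : ℂ × Covec} (hy : y.1 ∈ (chartAt ℂ a).target)
    (hb : (chartAt ℂ a).symm y.1 ∈ (chartAt ℂ b).source) :
    (cotTransition a b y).1 = transition a b y.1 := by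
  have hp := cotChart_symm_proj hy
  rw [cotTransition, cotChart_apply (by rwa [hp]), hp]
  rfl

theorem cotTransition_snd {a b : S} {y : ℂ × Covec} (hy : y.1 ∈ (chartAt ℂ a).target)
    (hb : (chartAt ℂ a).symm y.1 ∈ (chartAt ℂ b).source) :
    (cotTransition a b y).2.comp (fderiv ℝ (transition a b) y.1) = y.2 := by
  have hp := cotChart_symm_proj hy
  rw [← cotChart_symm_snd hy, cotTransition, cotChart_apply (by rwa [hp]), hp]
  dsimp only
  rw [ContinuousLinearMap.comp_assoc]
  congr 1
  exact fderiv_transition_comp a b _ hy hb (mem_chart_source ℂ _)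

theorem mfderiv_cotChart {a : S} {x : Cotangent S} (hx : x.proj ∈ (chartAt ℂ a).source) :
    (mfderiv IT 𝓘(ℝ, ℂ × Covec) (cotChart a) x : ℂ × Covec →L[ℝ] ℂ × Covec) =
      fderiv ℝ (cotTransition x.proj a) (cotChart x.proj x) := by
  rw [((contMDiffAt_cotChart hx).mdifferentiableAt (by simp)).mfderiv]
  simp [writtenInExtChartAt]
  rfl

/-- The hypotheses say that `κ` is the cotangent lift of `τ`. Differentiating `(κ y).2 ∘ Dτ = y.2`
produces a term with the second derivative of `τ`; being symmetric, it drops out of the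
antisymmetric form. -/
theorem stdForm_fderiv {κ : ℂ × Covec → ℂ × Covec} {τ : ℂ → ℂ} {y : ℂ × Covec}
    (hκ : DifferentiableAt ℝ κ y) (hτ : ContDiffAt ℝ 2 τ y.1)
    (h1 : ∀ᶠ y' in 𝓝 y, (κ y').1 = τ y'.1)
    (h2 : ∀ᶠ y' in 𝓝 y, (κ y').2.comp (fderiv ℝ τ y'.1) = y'.2) (w w' : ℂ × Covec) :
    stdForm (fderiv ℝ κ y w) (fderiv ℝ κ y w') = stdForm w w' := by
  have hτ1 : DifferentiableAt ℝ τ y.1 := hτ.differentiableAt (by simp)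
  have hτ2 : DifferentiableAt ℝ (fderiv ℝ τ) y.1 :=
    (hτ.fderiv_right (m := 1) (by norm_num)).differentiableAt (by simp)
  have hsymm : IsSymmSndFDerivAt ℝ τ y.1 := hτ.isSymmSndFDerivAt (by simp)
  have e1 : ∀ w : ℂ × Covec, (fderiv ℝ κ y w).1 = fderiv ℝ τ y.1 w.1 := by
    intro w
    have l := hκ.hasFDerivAt.fst
    have r := hτ1.hasFDerivAt.comp y hasFDerivAt_fst
    have := l.unique (r.congr_of_eventuallyEq h1)
    exact congrArg (fun L => L w) this
  have e2 : ∀ w : ℂ × Covec, (fderiv ℝ κ y w).2.comp (fderiv ℝ τ y.1) +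
      (κ y).2.comp (fderiv ℝ (fderiv ℝ τ) y.1 w.1) = w.2 := by
    intro w
    have l := hκ.hasFDerivAt.snd.clm_comp (hτ2.hasFDerivAt.comp y hasFDerivAt_fst)
    have := l.unique ((hasFDerivAt_snd (𝕜 := ℝ) (p := y)).congr_of_eventuallyEq h2)
    have := congrArg (fun L => L w) this
    simp at this
    rw [← this, add_comm]
  have f1 := congrArg (fun L => L w'.1) (e2 w)
  have f2 := congrArg (fun L => L w.1) (e2 w')
  simp at f1 f2
  rw [hsymm w.1 w'.1] at f1
  simp only [stdForm]
  rw [e1, e1]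
  linarith

/-- The form is defined pointwise in the preferred chart at each point. Since chart changes are
cotangent lifts, any canonical chart computes it, and so one chart can be kept while the point
moves. -/
theorem symplecticForm_eq {a : S} {x : Cotangent S} (hx : x.proj ∈ (chartAt ℂ a).source)
    (w w' : TangentSpace IT x) :
    symplecticForm x w w' =
      stdForm (mfderiv IT 𝓘(ℝ, ℂ × Covec) (cotChart a) x w)
        (mfderiv IT 𝓘(ℝ, ℂ × Covec) (cotChart a) x w') := by
  have hz : (cotChart x.proj x).1 = chartAt ℂ x.proj x.proj := by
    rw [cotChart_apply (mem_chart_source ℂ _)]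
  have hz1 : (cotChart x.proj x).1 ∈ (chartAt ℂ x.proj).target := by rw [hz]; exact mem_chart_target ℂ _
  have hz2 : (chartAt ℂ x.proj).symm (cotChart x.proj x).1 ∈ (chartAt ℂ a).source := by
    rwa [hz, (chartAt ℂ x.proj).left_inv (mem_chart_source ℂ _)]
  have ev : ∀ᶠ y in 𝓝 (cotChart x.proj x), y.1 ∈ (chartAt ℂ x.proj).target ∧
      (chartAt ℂ x.proj).symm y.1 ∈ (chartAt ℂ a).source := by
    have hc := continuous_fst.continuousAt (x := cotChart x.proj x)
    have h1 : ∀ᶠ q in 𝓝 (cotChart x.proj x).1, q ∈ (chartAt ℂ x.proj).target :=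
      (chartAt ℂ x.proj).open_target.mem_nhds hz1
    exact hc.eventually (h1.and (((chartAt ℂ x.proj).continuousAt_symm hz1).eventually_mem
      ((chartAt ℂ a).open_source.mem_nhds hz2)))
  have key := stdForm_fderiv ((contDiffAt_cotTransition hz1 hz2).differentiableAt (by simp))
    ((contDiffAt_transition x.proj a hz1 hz2).of_le (by simp)) (ev.mono fun y h => cotTransition_fst h.1 h.2)
    (ev.mono fun y h => cotTransition_snd h.1 h.2) w w'
  have e := mfderiv_cotChart hx
  rw [← e] at key
  exact key.symm

end

/-! ### Hamilton's equations in charts and invariance of the symplectic form. -/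

section

variable {S : Type*} [TopologicalSpace S] [ChartedSpace ℂ S] [IsManifold 𝓘(ℂ) ω S]

theorem contMDiffAt_prod_self_iff {E E' : Type*} [NormedAddCommGroup E] [NormedSpace ℝ E]
    [NormedAddCommGroup E'] [NormedSpace ℝ E'] {f : ℝ × E → E'} {p : ℝ × E} :
    ContMDiffAt (𝓘(ℝ, ℝ).prod 𝓘(ℝ, E)) 𝓘(ℝ, E') ∞ f p ↔ ContDiffAt ℝ ∞ f p := by
  rw [← contMDiffAt_iff_contDiffAt, modelWithCornersSelf_prod, ← chartedSpaceSelf_prod]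

theorem contDiffAt_in_cotChart {Φ : ℝ × Cotangent S → Cotangent S}
    (hΦ : ContMDiff (𝓘(ℝ, ℝ).prod IT) IT ∞ Φ) {a b : S} {t : ℝ} {y : ℂ × Covec}
    (hy : y.1 ∈ (chartAt ℂ b).target)
    (ha : (Φ (t, (cotChart b).symm y)).proj ∈ (chartAt ℂ a).source) :
    ContDiffAt ℝ ∞ (fun p : ℝ × (ℂ × Covec) => cotChart a (Φ (p.1, (cotChart b).symm p.2))) (t, y) := by
  rw [← contMDiffAt_prod_self_iff]
  refine (contMDiffAt_cotChart ha).comp (t, y) (hΦ.contMDiffAt.comp (t, y) ?_)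
  exact contMDiffAt_fst.prodMk ((contMDiffAt_cotChart_symm hy).comp (t, y) contMDiffAt_snd)

theorem contDiffAt_function_in_cotChart {H : ℝ × Cotangent S → ℝ}
    (hH : ContMDiff (𝓘(ℝ, ℝ).prod IT) 𝓘(ℝ, ℝ) ∞ H) {b : S} {t : ℝ} {y : ℂ × Covec}
    (hy : y.1 ∈ (chartAt ℂ b).target) :
    ContDiffAt ℝ ∞ (fun p : ℝ × (ℂ × Covec) => H (p.1, (cotChart b).symm p.2)) (t, y) := by
  rw [← contMDiffAt_prod_self_iff]
  refine hH.contMDiffAt.comp (t, y) ?_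
  exact contMDiffAt_fst.prodMk ((contMDiffAt_cotChart_symm hy).comp (t, y) contMDiffAt_snd)

theorem exists_mfderiv_cotChart_eq {a : S} {x : Cotangent S} (hx : x.proj ∈ (chartAt ℂ a).source)
    (w : ℂ × Covec) : ∃ W : TangentSpace IT x, mfderiv IT 𝓘(ℝ, ℂ × Covec) (cotChart a) x W = w := by
  have h := isInvertible_mfderiv_extChartAt (I := IT) (x := covector a 0) (y := x)
    (mem_cotChart_source.2 hx)
  obtain ⟨e, he⟩ := h
  exact ⟨e.symm w, by
    change mfderiv IT 𝓘(ℝ, ℂ × Covec) (extChartAt IT (covector a 0)) x (e.symm w) = w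
    rw [← he]; exact e.apply_symm_apply w⟩

theorem mfderiv_eq_fderiv_cotChart {E : Type*} [NormedAddCommGroup E] [NormedSpace ℝ E]
    {f : Cotangent S → E} {a : S} {x : Cotangent S} (hx : x.proj ∈ (chartAt ℂ a).source)
    (hf : MDifferentiableAt IT 𝓘(ℝ, E) f x) (W : TangentSpace IT x) :
    mfderiv IT 𝓘(ℝ, E) f x W = fderiv ℝ (fun y => f ((cotChart a).symm y)) (cotChart a x)
      (mfderiv IT 𝓘(ℝ, ℂ × Covec) (cotChart a) x W) := by
  have hs := mem_cotChart_source.2 hx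
  have hli := (cotChart a).left_inv hs
  have hy : (cotChart a x).1 ∈ (chartAt ℂ a).target :=
    mem_cotChart_target.1 ((cotChart a).map_source hs)
  have ev : (fun x' => f ((cotChart a).symm (cotChart a x'))) =ᶠ[𝓝 x] f := by
    filter_upwards [(isOpen_cotChart_source a).mem_nhds hs] with x' hx'
    rw [(cotChart a).left_inv hx']
  have hd : MDifferentiableAt 𝓘(ℝ, ℂ × Covec) 𝓘(ℝ, E) (fun y => f ((cotChart a).symm y))
      (cotChart a x) := by
    refine MDifferentiableAt.comp _ ?_ ((contMDiffAt_cotChart_symm hy).mdifferentiableAt (by simp))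
    rwa [hli]
  have hc := (hd.hasMFDerivAt.comp x
    ((contMDiffAt_cotChart hx).mdifferentiableAt (by simp)).hasMFDerivAt).congr_of_eventuallyEq ev.symm
  refine (congrArg (fun L => L W) hc.mfderiv).trans ?_
  rw [mfderiv_eq_fderiv]
  rfl

namespace IsHamiltonianFlow

variable {H : ℝ → Cotangent S → ℝ} {φ : ℝ → Diffeomorph IT IT (Cotangent S) (Cotangent S) ∞}

theorem contMDiff_curve (h : IsHamiltonianFlow H φ) (x : Cotangent S) :
    ContMDiff 𝓘(ℝ, ℝ) IT ∞ (fun s => φ s x) :=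
  h.smooth_flow.comp (contMDiff_id.prodMk contMDiff_const)

theorem contMDiff_hamiltonian (h : IsHamiltonianFlow H φ) (t : ℝ) :
    ContMDiff IT 𝓘(ℝ, ℝ) ∞ (H t) :=
  h.smooth_hamiltonian.comp (contMDiff_const.prodMk contMDiff_id)

theorem differentiableAt_chart_curve (h : IsHamiltonianFlow H φ) {a : S} {x : Cotangent S} {t : ℝ}
    (ha : (φ t x).proj ∈ (chartAt ℂ a).source) :
    DifferentiableAt ℝ (fun s => cotChart a (φ s x)) t := by
  rw [← mdifferentiableAt_iff_differentiableAt]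
  exact ((contMDiffAt_cotChart ha).comp t (h.contMDiff_curve x t)).mdifferentiableAt (by simp)

/-- Hamilton's equation in a canonical chart. -/
theorem hamilton_chart (h : IsHamiltonianFlow H φ) {a : S} {x : Cotangent S} {t : ℝ}
    (ha : (φ t x).proj ∈ (chartAt ℂ a).source) (w : ℂ × Covec) :
    fderiv ℝ (fun y => H t ((cotChart a).symm y)) (cotChart a (φ t x)) w =
      stdForm (deriv (fun s => cotChart a (φ s x)) t) w := by
  obtain ⟨W, rfl⟩ := exists_mfderiv_cotChart_eq ha w
  have h1 := h.hamilton t x W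
  rw [symplecticForm_eq ha, mfderiv_eq_fderiv_cotChart ha
    ((h.contMDiff_hamiltonian t _).mdifferentiableAt (by simp))] at h1
  refine h1.trans ?_
  congr 1
  have := mfderiv_comp_apply (I := 𝓘(ℝ, ℝ)) (I' := IT) (I'' := 𝓘(ℝ, ℂ × Covec)) t
    (g := cotChart a) (f := fun s => φ s x)
    ((contMDiffAt_cotChart ha).mdifferentiableAt (by simp))
    ((h.contMDiff_curve x t).mdifferentiableAt (by simp)) (1 : ℝ)
  refine this.symm.trans ?_
  rw [mfderiv_eq_fderiv]
  rfl

end IsHamiltonianFlow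

theorem two_le_infty : (2 : ℕ∞ω) ≤ ∞ := by
  exact WithTop.coe_le_coe.2 le_top

/-- The flow of a Hamiltonian vector field on a normed space preserves the symplectic form. -/
theorem hasDerivAt_form_zero {E : Type*} [NormedAddCommGroup E] [NormedSpace ℝ E]
    (B : E →L[ℝ] E →L[ℝ] ℝ) (hB : ∀ v w, B v w = -B w v) {Φ : ℝ × E → E} {H : ℝ × E → ℝ} {t : ℝ} {y : E}
    (hΦ : ContDiffAt ℝ 2 Φ (t, y)) (hH : ContDiffAt ℝ 2 H (t, Φ (t, y)))
    (heq : ∀ᶠ p in 𝓝 (t, y), ∀ w, B (fderiv ℝ Φ p (1, 0)) w = fderiv ℝ H (p.1, Φ p) (0, w)) (v v' : E) :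
    HasDerivAt (fun s => B (fderiv ℝ Φ (s, y) (0, v)) (fderiv ℝ Φ (s, y) (0, v'))) 0 t := by
  have hΦ1 : DifferentiableAt ℝ Φ (t, y) := hΦ.differentiableAt (by simp)
  have hΦ2 : DifferentiableAt ℝ (fderiv ℝ Φ) (t, y) :=
    (hΦ.fderiv_right (m := 1) (by norm_num)).differentiableAt (by simp)
  have hH2 : DifferentiableAt ℝ (fderiv ℝ H) (t, Φ (t, y)) :=
    (hH.fderiv_right (m := 1) (by norm_num)).differentiableAt (by simp)
  have sΦ : IsSymmSndFDerivAt ℝ Φ (t, y) := hΦ.isSymmSndFDerivAt (by simp)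
  have sH : IsSymmSndFDerivAt ℝ H (t, Φ (t, y)) := hH.isSymmSndFDerivAt (by simp)
  -- The spatial derivative of Hamilton's equation: the mixed derivative of the flow, inserted in
  -- `B`, is the Hessian of `H` at the transported vector.
  have key : ∀ v w : E, B (fderiv ℝ (fderiv ℝ Φ) (t, y) (0, v) (1, 0)) w =
      fderiv ℝ (fderiv ℝ H) (t, Φ (t, y)) (0, fderiv ℝ Φ (t, y) (0, v)) (0, w) := by
    intro v w
    have l : HasFDerivAt (fun p : ℝ × E => B (fderiv ℝ Φ p (1, 0)) w) _ (t, y) :=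
      (B.hasFDerivAt.comp (t, y) (hΦ2.hasFDerivAt.clm_apply (hasFDerivAt_const ((1 : ℝ), (0 : E)) _))).clm_apply
        (hasFDerivAt_const w _)
    have r : HasFDerivAt (fun p : ℝ × E => fderiv ℝ H (p.1, Φ p) (0, w)) _ (t, y) :=
      (HasFDerivAt.comp (t, y) (f := fun p : ℝ × E => (p.1, Φ p)) hH2.hasFDerivAt
        (hasFDerivAt_fst.prodMk hΦ1.hasFDerivAt)).clm_apply
        (hasFDerivAt_const ((0 : ℝ), w) _)
    have e := l.unique (r.congr_of_eventuallyEq (heq.mono fun p hp => hp w))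
    have := congrArg (fun L => L ((0 : ℝ), v)) e
    simpa using this
  have d : ∀ v : E, HasDerivAt (fun s : ℝ => fderiv ℝ Φ (s, y) (0, v))
      (fderiv ℝ (fderiv ℝ Φ) (t, y) (1, 0) (0, v)) t := by
    intro v
    have c : HasDerivAt (fun s : ℝ => (s, y)) ((1 : ℝ), (0 : E)) t :=
      (hasDerivAt_id t).prodMk (hasDerivAt_const t y)
    have := (hΦ2.hasFDerivAt.comp_hasDerivAt t c)
    simpa using this.clm_apply (hasDerivAt_const t ((0 : ℝ), v))
  have D := ((B.hasFDerivAt.comp_hasDerivAt t (d v))).clm_apply (d v')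
  refine D.congr_deriv ?_
  simp only [Function.comp]
  -- By the product rule the derivative is a difference of two Hessian values with exchanged
  -- arguments, and the Hessian is symmetric.
  rw [sΦ (1, 0) (0, v), sΦ (1, 0) (0, v'), key, hB, key, sH]
  ring

/-- `stdForm` as a continuous bilinear map. -/
def stdFormL : (ℂ × Covec) →L[ℝ] (ℂ × Covec) →L[ℝ] ℝ :=
  LinearMap.mkContinuous₂ (LinearMap.mk₂ ℝ stdForm
    (fun _ _ _ => by simp [stdForm]; ring)
    (fun _ _ _ => by simp only [stdForm, Prod.smul_fst, Prod.smul_snd, map_smul]; simp; ring)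
    (fun _ _ _ => by simp [stdForm]; ring)
    (fun _ _ _ => by simp only [stdForm, Prod.smul_fst, Prod.smul_snd, map_smul]; simp; ring)) 2 (by
      intro w w'
      have h1 : ‖w'.2 w.1‖ ≤ ‖w‖ * ‖w'‖ := (w'.2.le_opNorm w.1).trans (by
        rw [mul_comm]; gcongr <;> simp [Prod.norm_def])
      have h2 : ‖w.2 w'.1‖ ≤ ‖w‖ * ‖w'‖ := (w.2.le_opNorm w'.1).trans (by
        gcongr <;> simp [Prod.norm_def])
      calc ‖w'.2 w.1 - w.2 w'.1‖ ≤ ‖w'.2 w.1‖ + ‖w.2 w'.1‖ := norm_sub_le _ _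
        _ ≤ 2 * ‖w‖ * ‖w'‖ := by linarith)

theorem stdFormL_apply (w w' : ℂ × Covec) : stdFormL w w' = stdForm w w' := rfl

/-- The tangent spaces involved depend on `f x`, so the equality with the identity is kept as a
hypothesis on `f` and substituted as a whole. It serves the flow at time zero. -/
theorem symplecticForm_mfderiv_of_eq_id {f : Cotangent S → Cotangent S} (hf : f = id)
    (x : Cotangent S) (w w' : TangentSpace IT x) :
    symplecticForm (f x) (mfderiv IT IT f x w) (mfderiv IT IT f x w') = symplecticForm x w w' := by
  subst hf
  rw [mfderiv_id]
  rfl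

/-- The pulled-back form has zero time derivative at every time, by the computation in a vector
space `hasDerivAt_form_zero`, and it starts as the form itself. -/
theorem IsHamiltonianFlow.symplecticForm_mfderiv {H : ℝ → Cotangent S → ℝ}
    {φ : ℝ → Diffeomorph IT IT (Cotangent S) (Cotangent S) ∞} (h : IsHamiltonianFlow H φ) (t : ℝ)
    (x : Cotangent S) (w w' : TangentSpace IT x) :
    symplecticForm (φ t x) (mfderiv IT IT (φ t) x w) (mfderiv IT IT (φ t) x w') =
      symplecticForm x w w' := by
  have key : ∀ t, HasDerivAt (fun t => symplecticForm (φ t x) (mfderiv IT IT (φ t) x w)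
      (mfderiv IT IT (φ t) x w')) 0 t := by
    intro t
    set b := x.proj
    set a := (φ t x).proj with ha
    set y := cotChart b x with hy
    have hb : x.proj ∈ (chartAt ℂ b).source := mem_chart_source ℂ _
    have hx : (cotChart b).symm y = x := (cotChart b).left_inv (mem_cotChart_source.2 hb)
    have hyt : y.1 ∈ (chartAt ℂ b).target :=
      mem_cotChart_target.1 ((cotChart b).map_source (mem_cotChart_source.2 hb))
    set Φ : ℝ × (ℂ × Covec) → ℂ × Covec :=
      fun p => cotChart a (φ p.1 ((cotChart b).symm p.2)) with hΦ
    set K : ℝ × (ℂ × Covec) → ℝ := fun p => H p.1 ((cotChart a).symm p.2) with hK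
    have hsrc : (φ t ((cotChart b).symm y)).proj ∈ (chartAt ℂ a).source := by
      rw [hx]; exact mem_chart_source ℂ _
    have ev : ∀ᶠ p in 𝓝 (t, y), (φ p.1 ((cotChart b).symm p.2)).proj ∈ (chartAt ℂ a).source ∧
        p.2.1 ∈ (chartAt ℂ b).target := by
      have c1 : ContinuousAt (fun p : ℝ × (ℂ × Covec) => (φ p.1 ((cotChart b).symm p.2)).proj) (t, y) := by
        have c0 : ContinuousAt (fun p : ℝ × (ℂ × Covec) => (p.1, (cotChart b).symm p.2)) (t, y) :=
          continuousAt_fst.prodMk ((ContinuousAt.comp (f := fun p : ℝ × (ℂ × Covec) => p.2) (g := (cotChart b).symm)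
            (contMDiffAt_cotChart_symm hyt).continuousAt continuousAt_snd))
        have c2 := (FiberBundle.continuous_proj Covec
          (fun z : S => TangentSpace 𝓘(ℝ, ℂ) z →L[ℝ] Trivial S ℝ z)).comp h.smooth_flow.continuous
        exact ContinuousAt.comp (f := fun p : ℝ × (ℂ × Covec) => (p.1, (cotChart b).symm p.2))
          c2.continuousAt c0
      have c3 : ContinuousAt (fun p : ℝ × (ℂ × Covec) => p.2.1) (t, y) := by fun_prop
      exact (c1.eventually_mem ((chartAt ℂ a).open_source.mem_nhds hsrc)).and
        (c3.eventually_mem ((chartAt ℂ b).open_target.mem_nhds hyt))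
    have sΦ : ∀ p : ℝ × (ℂ × Covec), (φ p.1 ((cotChart b).symm p.2)).proj ∈ (chartAt ℂ a).source →
        p.2.1 ∈ (chartAt ℂ b).target → ContDiffAt ℝ ∞ Φ p :=
      fun p h1 h2 => contDiffAt_in_cotChart h.smooth_flow h2 h1
    have tK : ∀ p : ℝ × (ℂ × Covec), (φ p.1 ((cotChart b).symm p.2)).proj ∈ (chartAt ℂ a).source →
        (Φ p).1 ∈ (chartAt ℂ a).target := fun p h1 =>
      mem_cotChart_target.1 ((cotChart a).map_source (mem_cotChart_source.2 h1))
    have sK : ∀ p : ℝ × (ℂ × Covec), (φ p.1 ((cotChart b).symm p.2)).proj ∈ (chartAt ℂ a).source →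
        ContDiffAt ℝ ∞ K (p.1, Φ p) := fun p h1 =>
      contDiffAt_function_in_cotChart h.smooth_hamiltonian (tK p h1)
    have main := hasDerivAt_form_zero stdFormL
      (fun v w => by simp only [stdFormL_apply, stdForm]; ring)
      (Φ := Φ) (H := K) (t := t) (y := y) ((sΦ _ hsrc hyt).of_le two_le_infty)
      ((sK (t, y) hsrc).of_le two_le_infty) (ev.mono fun p hp w => by
        have e := h.hamilton_chart hp.1 w
        have d1 := ((sΦ p hp.1 hp.2).differentiableAt (by simp))
        have d2 := ((sK p hp.1).differentiableAt (by simp))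
        rw [stdFormL_apply]
        have c1 : HasDerivAt (fun s => Φ (s, p.2)) (fderiv ℝ Φ p (1, 0)) p.1 :=
          HasFDerivAt.comp_hasDerivAt (f := fun s : ℝ => (s, p.2)) p.1 d1.hasFDerivAt
            ((hasDerivAt_id p.1).prodMk (hasDerivAt_const p.1 p.2))
        have c2 : HasFDerivAt (fun y => K (p.1, y)) ((fderiv ℝ K (p.1, Φ p)).comp
            ((0 : (ℂ × Covec) →L[ℝ] ℝ).prod (ContinuousLinearMap.id ℝ _))) (Φ p) :=
          HasFDerivAt.comp (f := fun y => (p.1, y)) (Φ p) d2.hasFDerivAt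
            ((hasFDerivAt_const p.1 (Φ p)).prodMk (hasFDerivAt_id (Φ p)))
        rw [← c1.deriv]
        refine e.symm.trans ?_
        have := congrArg (fun L => L w) c2.fderiv
        exact this)
      (show ℂ × Covec from w) (show ℂ × Covec from w')
    -- The chart at `a` was fixed at time `t`, while the form at time `s` uses the chart at the
    -- moving point. For `s` near `t` the two agree by `symplecticForm_eq`.
    refine main.congr_of_eventuallyEq ?_
    have ev2 : ∀ᶠ s in 𝓝 t, (φ s x).proj ∈ (chartAt ℂ a).source := by
      have := (show ContinuousAt (fun s : ℝ => (s, y)) t by fun_prop).eventually ev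
      filter_upwards [this] with s hs
      have := hs.1
      rwa [hx] at this
    filter_upwards [ev2] with s hs
    have e1 : ∀ w : TangentSpace IT x, (mfderiv IT 𝓘(ℝ, ℂ × Covec) (cotChart a) (φ s x)
        (mfderiv IT IT (φ s) x w) : ℂ × Covec) = fderiv ℝ Φ (s, y) (0, w) := by
      intro w
      have d1 := (contMDiffAt_cotChart hs).mdifferentiableAt (by simp)
      have d2 := ((φ s).contMDiff x).mdifferentiableAt (by simp)
      have c := mfderiv_comp_apply (I' := IT) x d1 d2 w
      refine c.symm.trans ?_
      have c' : MDifferentiableAt IT 𝓘(ℝ, ℂ × Covec) (cotChart a ∘ φ s) x := d1.comp x d2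
      rw [c'.mfderiv]
      have d3 := (sΦ (s, y) (by simpa only [hx] using hs) hyt).differentiableAt (by simp)
      have c2 : HasFDerivAt (fun y => Φ (s, y)) ((fderiv ℝ Φ (s, y)).comp
            ((0 : (ℂ × Covec) →L[ℝ] ℝ).prod (ContinuousLinearMap.id ℝ _))) y :=
          HasFDerivAt.comp (f := fun y => (s, y)) y d3.hasFDerivAt
            ((hasFDerivAt_const s y).prodMk (hasFDerivAt_id y))
      simp only [writtenInExtChartAt, extChartAt_eq_cotChart, ModelWithCorners.range_eq_univ, fderivWithin_univ, extChartAt_model_space_eq_id]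
      exact congrArg (fun L => L (show ℂ × Covec from w)) c2.fderiv
    refine (symplecticForm_eq hs _ _).trans ?_
    exact congrArg₂ (fun u v => stdFormL u v) (e1 w) (e1 w')
  have hd : Differentiable ℝ (fun t => symplecticForm (φ t x) (mfderiv IT IT (φ t) x w)
      (mfderiv IT IT (φ t) x w')) := fun t => (key t).differentiableAt
  have hc := is_const_of_deriv_eq_zero hd (fun t => (key t).deriv) t 0
  refine hc.trans ?_
  exact symplecticForm_mfderiv_of_eq_id (funext h.start) x w w'

end

/-! ### Invariance of the zero-section and the induced isotopy of the surface. -/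

section

variable {S : Type*} [TopologicalSpace S] [ChartedSpace ℂ S] [IsManifold 𝓘(ℂ) ω S]

theorem cov_eq_zero_iff {x : Cotangent S} : cov x = 0 ↔ x = covector x.proj 0 := by
  constructor
  · intro h
    rw [← h]; rfl
  · intro h
    rw [h]; rfl

theorem cotChart_snd_eq_zero_iff {a : S} {x : Cotangent S} (hx : x.proj ∈ (chartAt ℂ a).source) :
    (cotChart a x).2 = 0 ↔ cov x = 0 := by
  constructor
  · intro h
    rw [cov_eq_zero_iff]
    refine (cotChart a).injOn (mem_cotChart_source.2 hx)
      (mem_cotChart_source.2 (show (covector x.proj 0 : Cotangent S).proj ∈ _ from hx)) ?_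
    rw [cotChart_zero hx]
    refine Prod.ext ?_ h
    rw [cotChart_apply hx]
  · intro h
    rw [cotChart_apply hx, h, ContinuousLinearMap.zero_comp]

theorem contMDiff_proj' : ContMDiff IT 𝓘(ℝ, ℂ) ∞ (fun x : Cotangent S => x.proj) :=
  contMDiff_proj (F := Covec) (fun z : S => TangentSpace 𝓘(ℝ, ℂ) z →L[ℝ] Trivial S ℝ z)

theorem continuous_proj' : Continuous (fun x : Cotangent S => x.proj) := contMDiff_proj'.continuous

theorem contMDiff_zero_covector : ContMDiff 𝓘(ℝ, ℂ) IT ∞ (fun z : S => (covector z 0 : Cotangent S)) :=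
  contMDiff_zeroSection ℝ (F := Covec) (fun z : S => TangentSpace 𝓘(ℝ, ℂ) z →L[ℝ] Trivial S ℝ z)

/-- With the base component of the trajectory regarded as known, the fibre component solves the
equation `η' = -∂_q H(t, q(t), η)`. Since `H` vanishes on the zero-section, so do its base
derivatives there, and `η = 0` is a solution; uniqueness shows that it is the only one with this
value at `t₀`. -/
theorem IsHamiltonianFlow.eventually_cov_eq_zero {H : ℝ → Cotangent S → ℝ}
    {φ : ℝ → Diffeomorph IT IT (Cotangent S) (Cotangent S) ∞} (h : IsHamiltonianFlow H φ)
    (hH : ∀ t, VanishesOnZeroSection (H t)) {x : Cotangent S} {t₀ : ℝ} (h0 : cov (φ t₀ x) = 0) :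
    ∀ᶠ t in 𝓝 t₀, cov (φ t x) = 0 := by
  set a := (φ t₀ x).proj
  have ha : (φ t₀ x).proj ∈ (chartAt ℂ a).source := mem_chart_source ℂ _
  set γ : ℝ → ℂ × Covec := fun t => cotChart a (φ t x) with hγ
  set K : ℝ × (ℂ × Covec) → ℝ := fun p => H p.1 ((cotChart a).symm p.2) with hK
  have hcφ : Continuous fun t => (φ t x).proj := continuous_proj'.comp (h.contMDiff_curve x).continuous
  have ev1 : ∀ᶠ t in 𝓝 t₀, (φ t x).proj ∈ (chartAt ℂ a).source :=
    hcφ.continuousAt.eventually_mem ((chartAt ℂ a).open_source.mem_nhds ha)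
  have tgt : ∀ t, (φ t x).proj ∈ (chartAt ℂ a).source → (γ t).1 ∈ (chartAt ℂ a).target := fun t ht =>
    mem_cotChart_target.1 ((cotChart a).map_source (mem_cotChart_source.2 ht))
  have sK : ∀ p : ℝ × (ℂ × Covec), p.2.1 ∈ (chartAt ℂ a).target → ContDiffAt ℝ ∞ K p :=
    fun p hp => contDiffAt_function_in_cotChart h.smooth_hamiltonian hp
  have hγ0 : (γ t₀).2 = 0 := (cotChart_snd_eq_zero_iff ha).2 h0
  have cγ : ContinuousAt γ t₀ := (h.differentiableAt_chart_curve ha).continuousAt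
  -- The gradient of the Hamiltonian is continuously differentiable, hence Lipschitz near the point
  -- considered, as uniqueness requires.
  obtain ⟨C, U, hU, hL⟩ := ((sK (t₀, γ t₀) (tgt t₀ ha)).of_le two_le_infty |>.fderiv_right (m := 1)
    (by norm_num)).exists_lipschitzOnWith
  let V : ℝ → Covec → Covec := fun t η =>
    -(fderiv ℝ K (t, ((γ t).1, η))).comp ((0 : ℂ →L[ℝ] ℝ).prod (ContinuousLinearMap.inl ℝ ℂ Covec))
  have ev2 : ∀ᶠ t in 𝓝 t₀, (t, ((γ t).1, (γ t).2)) ∈ U := by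
    have : ContinuousAt (fun t => (t, ((γ t).1, (γ t).2))) t₀ :=
      continuousAt_id.prodMk (cγ.fst.prodMk cγ.snd)
    exact this.eventually_mem hU
  have ev3 : ∀ᶠ t in 𝓝 t₀, (t, ((γ t).1, (0 : Covec))) ∈ U := by
    have : ContinuousAt (fun t => (t, ((γ t).1, (0 : Covec)))) t₀ :=
      continuousAt_id.prodMk (cγ.fst.prodMk continuousAt_const)
    refine this.eventually_mem ?_
    rw [← hγ0]; exact hU
  obtain ⟨ε, hε, hb⟩ := Metric.eventually_nhds_iff.1 (ev1.and (ev2.and ev3))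
  have hb' : ∀ t ∈ Set.Ioo (t₀ - ε) (t₀ + ε), (φ t x).proj ∈ (chartAt ℂ a).source ∧
      (t, ((γ t).1, (γ t).2)) ∈ U ∧ (t, ((γ t).1, (0 : Covec))) ∈ U := fun t ht => hb (by
    rw [Real.dist_eq, abs_lt]; constructor <;> linarith [ht.1, ht.2])
  have hV0 : ∀ t ∈ Set.Ioo (t₀ - ε) (t₀ + ε), V t 0 = 0 := by
    intro t ht
    have hq := tgt t (hb' t ht).1
    have hd := (sK (t, ((γ t).1, 0)) hq).differentiableAt (by simp)
    have hc : HasFDerivAt (fun q => K (t, (q, (0 : Covec)))) ((fderiv ℝ K (t, ((γ t).1, 0))).comp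
        ((0 : ℂ →L[ℝ] ℝ).prod ((ContinuousLinearMap.id ℝ ℂ).prod 0))) (γ t).1 :=
      HasFDerivAt.comp (f := fun q => (t, (q, (0 : Covec)))) (γ t).1 hd.hasFDerivAt
        ((hasFDerivAt_const t _).prodMk ((hasFDerivAt_id _).prodMk (hasFDerivAt_const (0 : Covec) _)))
    have hz : (fun q => K (t, (q, (0 : Covec)))) =ᶠ[𝓝 (γ t).1] fun _ => 0 := by
      filter_upwards [(chartAt ℂ a).open_target.mem_nhds hq] with q hq
      have : (cotChart a).symm (q, 0) = covector ((chartAt ℂ a).symm q) 0 := by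
        have hs := (chartAt ℂ a).map_target hq
        have e := cotChart_zero hs
        rw [(chartAt ℂ a).right_inv hq] at e
        rw [← e, (cotChart a).left_inv]
        exact mem_cotChart_source.2 hs
      simp only [hK, this]
      exact hH t _
    have := hc.unique ((hasFDerivAt_const (0 : ℝ) _).congr_of_eventuallyEq hz)
    simp only [V]
    rw [neg_eq_zero]
    exact this
  have hVL : ∀ t ∈ Set.Ioo (t₀ - ε) (t₀ + ε), LipschitzOnWith C (V t)
      {η | (t, ((γ t).1, η)) ∈ U} := by
    intro t ht
    refine LipschitzOnWith.of_dist_le_mul fun η hη η' hη' => ?_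
    have := hL.dist_le_mul _ hη _ hη'
    have e : dist (t, ((γ t).1, η)) (t, ((γ t).1, η')) = dist η η' := by simp [Prod.dist_eq]
    rw [e, dist_eq_norm] at this
    simp only [V]
    rw [dist_neg_neg, dist_eq_norm, ← ContinuousLinearMap.sub_comp]
    refine ContinuousLinearMap.opNorm_le_bound _ (by positivity) fun v => ?_
    rw [ContinuousLinearMap.comp_apply]
    refine (ContinuousLinearMap.le_of_opNorm_le _ this _).trans ?_
    gcongr
    simp [Prod.norm_def]
  have hsol : ∀ t ∈ Set.Ioo (t₀ - ε) (t₀ + ε), HasDerivAt (fun t => (γ t).2) (V t (γ t).2) t := by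
    intro t ht
    have hs := (hb' t ht).1
    have hd := (h.differentiableAt_chart_curve hs).hasDerivAt.hasFDerivAt.snd.hasDerivAt
    refine hd.congr_deriv ?_
    ext v : 1
    have e := h.hamilton_chart hs ((v, 0) : ℂ × Covec)
    have hdK := (sK (t, γ t) (tgt t hs)).differentiableAt (by simp)
    have hc : HasFDerivAt (fun y => K (t, y)) ((fderiv ℝ K (t, γ t)).comp
        ((0 : (ℂ × Covec) →L[ℝ] ℝ).prod (ContinuousLinearMap.id ℝ _))) (γ t) :=
      HasFDerivAt.comp (f := fun y => (t, y)) (γ t) hdK.hasFDerivAt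
        ((hasFDerivAt_const t (γ t)).prodMk (hasFDerivAt_id (γ t)))
    have e2 := congrArg (fun L => L ((v, 0) : ℂ × Covec)) hc.fderiv
    have e3 := e2.symm.trans e
    simp [stdForm] at e3
    simp [V, e3]
  have := ODE_solution_unique_of_mem_Ioo hVL (t₀ := t₀) ⟨by linarith, by linarith⟩
    (f := fun t => (γ t).2) (g := fun _ => 0) (fun t ht => ⟨hsol t ht, (hb' t ht).2.1⟩)
    (fun t ht => ⟨by rw [hV0 t ht]; exact hasDerivAt_const _ _, (hb' t ht).2.2⟩) hγ0
  filter_upwards [Ioo_mem_nhds (by linarith : t₀ - ε < t₀) (by linarith : t₀ < t₀ + ε)] with t ht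
  exact (cotChart_snd_eq_zero_iff (hb' t ht).1).1 (this ht)

/-- The set of times that a trajectory spends on the zero-section is open by the local statement and
closed by continuity. The line is connected, so this set is empty or everything. -/
theorem IsHamiltonianFlow.cov_eq_zero_iff {H : ℝ → Cotangent S → ℝ}
    {φ : ℝ → Diffeomorph IT IT (Cotangent S) (Cotangent S) ∞} (h : IsHamiltonianFlow H φ)
    (hH : ∀ t, VanishesOnZeroSection (H t)) {x : Cotangent S} (t : ℝ) :
    cov (φ t x) = 0 ↔ cov x = 0 := by
  have hclosed : IsClosed {t | cov (φ t x) = 0} := by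
    have : {t | cov (φ t x) = 0} = {t | ¬ (∀ᶠ s in 𝓝 t, cov (φ s x) ≠ 0)} := by
      ext t
      constructor
      · intro ht hn
        exact hn.self_of_nhds ht
      · intro hn
        by_contra ht
        apply hn
        set a := (φ t x).proj
        have ha : (φ t x).proj ∈ (chartAt ℂ a).source := mem_chart_source ℂ _
        have hcφ : Continuous fun t => (φ t x).proj :=
          continuous_proj'.comp (h.contMDiff_curve x).continuous
        have ev1 : ∀ᶠ t in 𝓝 t, (φ t x).proj ∈ (chartAt ℂ a).source :=
          hcφ.continuousAt.eventually_mem ((chartAt ℂ a).open_source.mem_nhds ha)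
        have hne : (cotChart a (φ t x)).2 ≠ 0 := fun e => ht ((cotChart_snd_eq_zero_iff ha).1 e)
        have ev2 := (h.differentiableAt_chart_curve ha).continuousAt.snd.eventually_ne hne
        filter_upwards [ev1, ev2] with s h1 h2 e
        exact h2 ((cotChart_snd_eq_zero_iff h1).2 e)
    rw [this]
    have : IsOpen {t | ∀ᶠ s in 𝓝 t, cov (φ s x) ≠ 0} := isOpen_setOfPred_eventually_nhds
    exact this.isClosed_compl
  have hopen : IsOpen {t | cov (φ t x) = 0} := by
    rw [isOpen_iff_mem_nhds]
    intro t ht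
    exact h.eventually_cov_eq_zero hH ht
  rcases isClopen_iff.1 ⟨hclosed, hopen⟩ with he | he
  · have h1 : ¬ cov (φ t x) = 0 := fun e => by
      have : t ∈ {t | cov (φ t x) = 0} := e
      rw [he] at this; exact this
    have h2 : ¬ cov x = 0 := fun e => by
      have : (0 : ℝ) ∈ {t | cov (φ t x) = 0} := by simpa [h.start] using e
      rw [he] at this; exact this
    simp [h1, h2]
  · have h1 : t ∈ {t | cov (φ t x) = 0} := by rw [he]; trivial
    have h2 : (0 : ℝ) ∈ {t | cov (φ t x) = 0} := by rw [he]; trivial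
    have h2' : cov (φ 0 x) = 0 := h2
    rw [h.start] at h2'
    exact ⟨fun _ => h2', fun _ => h1⟩

/-- The diffeomorphism of the surface induced by a diffeomorphism of the cotangent bundle that
preserves the zero section. -/
def baseDiffeo (φ : Diffeomorph IT IT (Cotangent S) (Cotangent S) ∞)
    (h : ∀ x, cov (φ x) = 0 ↔ cov x = 0) : Diffeo S where
  toFun z := (φ (covector z 0)).proj
  invFun z := (φ.symm (covector z 0)).proj
  left_inv z := by
    have h1 : cov (φ (covector z 0)) = 0 := (h _).2 rfl
    rw [cov_eq_zero_iff] at h1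
    dsimp only
    rw [← h1, φ.symm_apply_apply]
    rfl
  right_inv z := by
    have h1 : cov (φ.symm (covector z 0)) = 0 := by
      rw [← h, φ.apply_symm_apply]; rfl
    rw [cov_eq_zero_iff] at h1
    dsimp only
    rw [← h1, φ.apply_symm_apply]
    rfl
  contMDiff_toFun := contMDiff_proj'.comp (φ.contMDiff.comp contMDiff_zero_covector)
  contMDiff_invFun := contMDiff_proj'.comp (φ.symm.contMDiff.comp contMDiff_zero_covector)

theorem IsHamiltonianFlow.isotopicToId {H : ℝ → Cotangent S → ℝ}
    {φ : ℝ → Diffeomorph IT IT (Cotangent S) (Cotangent S) ∞} (h : IsHamiltonianFlow H φ)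
    (hH : ∀ t, VanishesOnZeroSection (H t)) :
    IsotopicToId (baseDiffeo (φ 1) fun _ => h.cov_eq_zero_iff hH 1) := by
  refine ⟨fun t => baseDiffeo (φ t) fun _ => h.cov_eq_zero_iff hH t, ?_, ?_, rfl⟩
  · exact contMDiff_proj'.comp (h.smooth_flow.comp
      (contMDiff_fst.prodMk (contMDiff_zero_covector.comp contMDiff_snd)))
  · intro z
    change (φ 0 (covector z 0)).proj = z
    rw [h.start]; rfl

end

/-! ### Leading fibre jets along the zero-section. -/

section

variable {E V : Type*} [NormedAddCommGroup E] [NormedSpace ℝ E] [NormedAddCommGroup V] [NormedSpace ℝ V]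

/-- The homogeneous part of degree `k` in the second variable of the Taylor expansion of `F` along
`η = 0`. -/
def fibreJet (k : ℕ) (F : E × V → ℂ) (q : E) (η : V) : ℂ :=
  (k.factorial : ℂ)⁻¹ * iteratedFDeriv ℝ k F (q, 0) fun _ => (0, η)

theorem isLittleO_sq_of_deriv {g : ℝ → ℂ} (hd : ∀ᶠ s in 𝓝 (0 : ℝ), DifferentiableAt ℝ g s)
    (h0 : g 0 = 0) (h1 : deriv g 0 = 0) (h2 : HasDerivAt (deriv g) 0 0) :
    g =o[𝓝 0] fun s : ℝ => s ^ 2 := by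
  obtain ⟨ε, hε, hb⟩ := Metric.eventually_nhds_iff_ball.1 hd
  have hder : (deriv g) =o[𝓝[Metric.ball 0 ε] 0] fun s : ℝ => (s - 0) ^ 1 := by
    have := hasDerivAt_iff_isLittleO.1 h2
    simp only [h1, smul_zero, sub_zero, pow_one] at this ⊢
    exact this.mono nhdsWithin_le_nhds
  have := (convex_ball (0 : ℝ) ε).isLittleO_pow_succ_real (Metric.mem_ball_self hε)
    (f := g) (f' := deriv g) (fun s hs => (hb s hs).hasDerivAt.hasDerivWithinAt) hder
  rw [nhdsWithin_eq_nhds.2 (Metric.ball_mem_nhds _ hε)] at this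
  simpa [h0] using this

theorem hasDerivAt_fibre_line {F : E × V → ℂ} {q : E} (hF : DifferentiableAt ℝ F (q, 0)) (η : V) :
    HasDerivAt (fun s : ℝ => F (q, s • η)) (fderiv ℝ F (q, 0) (0, η)) 0 := by
  have hc : HasDerivAt (fun s : ℝ => (q, s • η)) ((0 : E), η) 0 := by
    have := (hasDerivAt_id (0 : ℝ)).smul_const η
    rw [one_smul] at this
    exact (hasDerivAt_const (0 : ℝ) q).prodMk this
  refine HasFDerivAt.comp_hasDerivAt (f := fun s : ℝ => (q, s • η)) 0 ?_ hc
  simpa using hF.hasFDerivAt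

/-- A function of order `k` in every nearby fibre has, along any smooth curve meeting the
zero-section, a leading term that depends on the vertical velocity alone: all derivatives of total
order at most `k` with a base direction vanish there. The curve need not stay in one fibre, and this
makes the lemma applicable to images of fibre lines under a diffeomorphism. -/
theorem isLittleO_fibreJet {k : ℕ} (hk : k = 1 ∨ k = 2) {F : E × V → ℂ} {q₀ : E}
    (hF : ContDiffAt ℝ ∞ F (q₀, 0))
    (hO : ∀ᶠ q in 𝓝 q₀, ∀ η : V, (fun s : ℝ => F (q, s • η)) =O[𝓝 0] fun s : ℝ => s ^ k)
    {γ : ℝ → E × V} (hγ : ContDiffAt ℝ ∞ γ 0) (hγ0 : γ 0 = (q₀, 0)) :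
    (fun s => F (γ s) - (s : ℂ) ^ k * fibreJet k F q₀ (deriv γ 0).2) =o[𝓝 0] fun s : ℝ => s ^ k := by
  set v := deriv γ 0 with hv
  have evF : ∀ᶠ y in 𝓝 ((q₀, 0) : E × V), DifferentiableAt ℝ F y := by
    have := (hF.of_le two_le_infty).eventually (by simp)
    exact this.mono fun y hy => hy.differentiableAt (by simp)
  have hq : Filter.Tendsto (fun q : E => (q, (0 : V))) (𝓝 q₀) (𝓝 (q₀, 0)) :=
    (show ContinuousAt (fun q : E => (q, (0 : V))) q₀ by fun_prop)
  have hF1 : DifferentiableAt ℝ F (q₀, 0) := evF.self_of_nhds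
  have z0 : ∀ᶠ q in 𝓝 q₀, F (q, 0) = 0 := by
    filter_upwards [hO] with q hq
    have h1 : (fun s : ℝ => F (q, s • (0 : V))) =O[𝓝 0] fun s : ℝ => ‖s - 0‖ ^ k := by
      simpa using (hq 0).norm_right
    simpa using h1.eq_zero_of_norm_pow (by rcases hk with rfl | rfl <;> simp)
  have base : ∀ w : E, ∀ᶠ q in 𝓝 q₀, fderiv ℝ F (q, 0) (w, 0) = 0 := by
    intro w
    filter_upwards [z0.eventually_nhds, hq.eventually evF] with q h1 h2
    have hc : HasFDerivAt (fun q : E => F (q, 0)) ((fderiv ℝ F (q, 0)).comp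
        ((ContinuousLinearMap.id ℝ E).prod 0)) q :=
      HasFDerivAt.comp (f := fun q : E => (q, (0 : V))) q h2.hasFDerivAt
        ((hasFDerivAt_id q).prodMk (hasFDerivAt_const (0 : V) q))
    have := hc.unique ((hasFDerivAt_const (0 : ℂ) q).congr_of_eventuallyEq h1)
    have := congrArg (fun L => L w) this
    simpa using this
  have hγ1 : HasDerivAt γ v 0 := (hγ.differentiableAt (by simp)).hasDerivAt
  rcases hk with rfl | rfl
  · have e : fderiv ℝ F (q₀, 0) v = fibreJet 1 F q₀ v.2 := by
      have h1 : v = (v.1, 0) + (0, v.2) := by simp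
      conv_lhs => rw [h1, map_add, (base v.1).self_of_nhds, zero_add]
      simp [fibreJet]
    have hd : HasDerivAt (fun s => F (γ s)) (fderiv ℝ F (q₀, 0) v) 0 := by
      refine HasFDerivAt.comp_hasDerivAt (f := γ) 0 ?_ hγ1
      rw [hγ0]; exact hF1.hasFDerivAt
    have := hasDerivAt_iff_isLittleO.1 hd
    simp only [hγ0, z0.self_of_nhds, e, sub_zero] at this
    simpa using this
  -- In order two the whole differential vanishes along the zero-section, in base directions because
  -- `F` does and in fibre directions by the order condition.
  · have fib : ∀ᶠ q in 𝓝 q₀, fderiv ℝ F (q, 0) = 0 := by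
      filter_upwards [hO, hq.eventually evF, z0.eventually_nhds] with q h1 h2 h3
      refine ContinuousLinearMap.ext fun w => ?_
      have hw : w = (w.1, 0) + (0, w.2) := by simp
      have a1 : fderiv ℝ F (q, 0) (w.1, 0) = 0 := by
        have hc : HasFDerivAt (fun q : E => F (q, 0)) ((fderiv ℝ F (q, 0)).comp
            ((ContinuousLinearMap.id ℝ E).prod 0)) q :=
          HasFDerivAt.comp (f := fun q : E => (q, (0 : V))) q h2.hasFDerivAt
            ((hasFDerivAt_id q).prodMk (hasFDerivAt_const (0 : V) q))
        have := hc.unique ((hasFDerivAt_const (0 : ℂ) q).congr_of_eventuallyEq h3)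
        have := congrArg (fun L => L w.1) this
        simpa using this
      have a2 : fderiv ℝ F (q, 0) (0, w.2) = 0 := by
        have d := hasDerivAt_fibre_line h2 w.2
        have d0 : HasDerivAt (fun s : ℝ => F (q, s • w.2)) 0 0 := by
          rw [hasDerivAt_iff_isLittleO]
          have z : F (q, (0 : ℝ) • w.2) = 0 := by
            rw [zero_smul]; exact h3.self_of_nhds
          simp only [z, smul_zero, sub_zero]
          exact (h1 w.2).trans_isLittleO (by simpa using Asymptotics.isLittleO_pow_pow (𝕜 := ℝ) (m := 1) (n := 2) (by norm_num))
        exact d.unique d0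
      rw [hw, map_add, a1, a2]; simp
    have hF2 : DifferentiableAt ℝ (fderiv ℝ F) (q₀, 0) :=
      ((hF.of_le two_le_infty).fderiv_right (m := 1) (by norm_num)).differentiableAt (by simp)
    have sF : IsSymmSndFDerivAt ℝ F (q₀, 0) := (hF.of_le two_le_infty).isSymmSndFDerivAt (by simp)
    have b2 : ∀ w : E, fderiv ℝ (fderiv ℝ F) (q₀, 0) (w, 0) = 0 := by
      intro w
      have hc : HasFDerivAt (fun q : E => fderiv ℝ F (q, 0)) ((fderiv ℝ (fderiv ℝ F) (q₀, 0)).comp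
          ((ContinuousLinearMap.id ℝ E).prod 0)) q₀ :=
        HasFDerivAt.comp (f := fun q : E => (q, (0 : V))) q₀ hF2.hasFDerivAt
          ((hasFDerivAt_id q₀).prodMk (hasFDerivAt_const (0 : V) q₀))
      have := hc.unique ((hasFDerivAt_const (0 : E × V →L[ℝ] ℂ) q₀).congr_of_eventuallyEq fib)
      have := congrArg (fun L => L w) this
      simpa using this
    -- The Hessian kills base directions in the first slot by `b2` and in the second by symmetry.
    -- The factor is the `2!` in the normalization of `fibreJet`.
    have e : fderiv ℝ (fderiv ℝ F) (q₀, 0) v v = 2 * fibreJet 2 F q₀ v.2 := by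
      have h1 : v = (v.1, 0) + (0, v.2) := by simp
      have h2 : fderiv ℝ (fderiv ℝ F) (q₀, 0) v = fderiv ℝ (fderiv ℝ F) (q₀, 0) (0, v.2) := by
        conv_lhs => rw [h1, map_add, b2, zero_add]
      rw [h2, sF.eq, h2]
      simp [fibreJet, iteratedFDeriv_two_apply]
    have evγ : ∀ᶠ s in 𝓝 (0 : ℝ), DifferentiableAt ℝ γ s := by
      have := (hγ.of_le two_le_infty).eventually (by simp)
      exact this.mono fun y hy => hy.differentiableAt (by simp)
    have tγ : Filter.Tendsto γ (𝓝 0) (𝓝 (q₀, 0)) := by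
      rw [← hγ0]; exact hγ1.continuousAt
    have dh : ∀ᶠ s in 𝓝 (0 : ℝ), HasDerivAt (fun s => F (γ s)) (fderiv ℝ F (γ s) (deriv γ s)) s := by
      filter_upwards [evγ, tγ.eventually evF] with s h1 h2
      exact HasFDerivAt.comp_hasDerivAt (f := γ) s h2.hasFDerivAt h1.hasDerivAt
    set c := fibreJet 2 F q₀ v.2
    have dp : ∀ s : ℝ, HasDerivAt (fun s : ℝ => (s : ℂ) ^ 2 * c) (2 * s * c) s := by
      intro s
      have := ((hasDerivAt_id s).ofReal_comp.pow 2).mul_const c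
      simpa using this
    have dg : ∀ᶠ s in 𝓝 (0 : ℝ), HasDerivAt (fun s => F (γ s) - (s : ℂ) ^ 2 * c)
        (fderiv ℝ F (γ s) (deriv γ s) - 2 * s * c) s := dh.mono fun s hs => hs.sub (dp s)
    have deq : deriv (fun s => F (γ s) - (s : ℂ) ^ 2 * c) =ᶠ[𝓝 0]
        fun s => fderiv ℝ F (γ s) (deriv γ s) - 2 * s * c := dg.mono fun s hs => hs.deriv
    have dγ2 : DifferentiableAt ℝ (deriv γ) 0 :=
      by
      have := (((hγ.of_le two_le_infty).fderiv_right (m := 1) (by norm_num)).differentiableAt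
        (by simp)).clm_apply (differentiableAt_const (1 : ℝ))
      exact this
    have dd : HasDerivAt (fun s : ℝ => fderiv ℝ F (γ s) (deriv γ s) - 2 * s * c) 0 0 := by
      have h1 : HasDerivAt (fun s => fderiv ℝ F (γ s)) (fderiv ℝ (fderiv ℝ F) (q₀, 0) v) 0 := by
        refine HasFDerivAt.comp_hasDerivAt (f := γ) 0 ?_ hγ1
        rw [hγ0]; exact hF2.hasFDerivAt
      have h2 := h1.clm_apply dγ2.hasDerivAt
      have h3 : HasDerivAt (fun s : ℝ => (2 : ℂ) * s * c) (2 * c) 0 := by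
        have := ((hasDerivAt_id (0 : ℝ)).ofReal_comp.const_mul (2 : ℂ)).mul_const c
        simpa using this
      have h4 := h2.sub h3
      rw [← hv, e, hγ0, fib.self_of_nhds] at h4
      refine h4.congr_deriv ?_
      simp
    refine isLittleO_sq_of_deriv (dg.mono fun s hs => hs.differentiableAt) ?_ ?_
      (dd.congr_of_eventuallyEq deq)
    · simp [hγ0, z0.self_of_nhds]
    · rw [deq.self_of_nhds]; simp [hγ0, fib.self_of_nhds]

theorem contDiffAt_fibreJet (k : ℕ) {F : E × V → ℂ} {q : E} (hF : ContDiffAt ℝ ∞ F (q, 0)) (η : V) :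
    ContDiffAt ℝ ∞ (fun q => fibreJet k F q η) q := by
  have h1 : ContDiffAt ℝ ∞ (iteratedFDeriv ℝ k F) (q, 0) := hF.iteratedFDeriv_right (m := ∞) (WithTop.coe_le_coe.2 le_top)
  have h2 : ContDiffAt ℝ ∞ (fun q : E => (q, (0 : V))) q := by fun_prop
  have h3 : ContDiffAt ℝ ∞ (fun q : E => iteratedFDeriv ℝ k F (q, 0)) q := ContDiffAt.comp q h1 h2
  have h4 := ((ContinuousMultilinearMap.apply ℝ (fun _ : Fin k => E × V) ℂ (fun _ => (0, η))).contDiff.contDiffAt).comp q h3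
  exact contDiffAt_const.mul h4

end

/-! ### Symplectic diffeomorphisms near the zero-section. -/

section

variable {S : Type*} [TopologicalSpace S] [ChartedSpace ℂ S] [IsManifold 𝓘(ℂ) ω S]

theorem cotChart_covector_self (z : S) (ξ : Covec) :
    cotChart z (covector z ξ) = (chartAt ℂ z z, ξ) := by
  rw [cotChart_apply (mem_chart_source ℂ z), cov_covector]
  change (chartAt ℂ z z, ξ.comp (fderiv ℝ (transition z z) (chartAt ℂ z z))) = _
  rw [fderiv_transition_self z (mem_chart_target ℂ z), ContinuousLinearMap.comp_id]

theorem cotChart_symm_self (z : S) (ξ : Covec) :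
    (cotChart z).symm (chartAt ℂ z z, ξ) = covector z ξ := by
  rw [← cotChart_covector_self, (cotChart z).left_inv]
  exact mem_cotChart_source.2 (mem_chart_source ℂ z)

theorem cotChart_symm_zero {a : S} {q : ℂ} (hq : q ∈ (chartAt ℂ a).target) :
    (cotChart a).symm (q, 0) = covector ((chartAt ℂ a).symm q) 0 := by
  have hs := (chartAt ℂ a).map_target hq
  have e := cotChart_zero hs
  rw [(chartAt ℂ a).right_inv hq] at e
  rw [← e, (cotChart a).left_inv]
  exact mem_cotChart_source.2 hs

theorem contDiffAt_diffeo_in_cotChart (φ : Diffeomorph IT IT (Cotangent S) (Cotangent S) ∞) {a b : S}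
    {y : ℂ × Covec} (hy : y.1 ∈ (chartAt ℂ a).target)
    (hb : (φ ((cotChart a).symm y)).proj ∈ (chartAt ℂ b).source) :
    ContDiffAt ℝ ∞ (fun y => cotChart b (φ ((cotChart a).symm y))) y := by
  rw [← contMDiffAt_iff_contDiffAt]
  exact (contMDiffAt_cotChart hb).comp y (φ.contMDiff.contMDiffAt.comp y (contMDiffAt_cotChart_symm hy))

theorem mfderiv_diffeo_in_cotChart (φ : Diffeomorph IT IT (Cotangent S) (Cotangent S) ∞) {b : S}
    {x : Cotangent S} (hb : (φ x).proj ∈ (chartAt ℂ b).source) (w : TangentSpace IT x) :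
    (mfderiv IT 𝓘(ℝ, ℂ × Covec) (cotChart b) (φ x) (mfderiv IT IT φ x w) : ℂ × Covec) =
      fderiv ℝ (fun y => cotChart b (φ ((cotChart x.proj).symm y))) (cotChart x.proj x) w := by
  have d1 := (contMDiffAt_cotChart hb).mdifferentiableAt (by simp)
  have d2 := (φ.contMDiff x).mdifferentiableAt (by simp)
  have c := mfderiv_comp_apply (I' := IT) x d1 d2 w
  refine c.symm.trans ?_
  have c' : MDifferentiableAt IT 𝓘(ℝ, ℂ × Covec) (cotChart b ∘ φ) x := d1.comp x d2
  rw [c'.mfderiv]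
  simp only [writtenInExtChartAt, extChartAt_eq_cotChart,
    ModelWithCorners.range_eq_univ, fderivWithin_univ, extChartAt_model_space_eq_id]
  rfl

omit [IsManifold 𝓘(ℂ) ω S] in
theorem differential_eq (f : Diffeo S) (z : S) :
    differential f z = fderiv ℝ (fun q => chartAt ℂ (f z) (f ((chartAt ℂ z).symm q))) (chartAt ℂ z z) := by
  rw [differential, ((f.contMDiff z).mdifferentiableAt (by simp)).mfderiv]
  simp [writtenInExtChartAt]
  rfl

/-- `φ` preserves the canonical symplectic form. -/
def IsSymplectic (φ : Cotangent S → Cotangent S) : Prop :=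
  ∀ (x : Cotangent S) (v w : TangentSpace IT x),
    symplecticForm (φ x) (mfderiv IT IT φ x v) (mfderiv IT IT φ x w) = symplecticForm x v w

/-- The normal derivative along the zero section of the inverse of a symplectic diffeomorphism is
the pullback of covectors by the induced diffeomorphism of the surface. -/
theorem IsSymplectic.fibre_deriv {φ : Diffeomorph IT IT (Cotangent S) (Cotangent S) ∞}
    (hφ : IsSymplectic φ) (h : ∀ x, cov (φ x) = 0 ↔ cov x = 0) (z : S) (ξ : Covec) :
    ContDiffAt ℝ ∞ (fun s : ℝ => cotChart z (φ.symm (covector (baseDiffeo φ h z) (s • ξ)))) 0 ∧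
    cotChart z (φ.symm (covector (baseDiffeo φ h z) ((0 : ℝ) • ξ))) = (chartAt ℂ z z, 0) ∧
    (deriv (fun s : ℝ => cotChart z (φ.symm (covector (baseDiffeo φ h z) (s • ξ)))) 0).2 =
      ξ.comp (differential (baseDiffeo φ h) z) := by
  set f := baseDiffeo φ h with hf
  set w := f z with hw
  have hφz : φ (covector z 0) = covector w 0 := cov_eq_zero_iff.1 ((h _).2 rfl)
  have hφw : φ.symm (covector w 0) = covector z 0 := by rw [← hφz, φ.symm_apply_apply]
  have tz := mem_chart_target ℂ z
  have tw := mem_chart_target ℂ w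
  have sz := mem_chart_source ℂ z
  have sw := mem_chart_source ℂ w
  set y0 : ℂ × Covec := (chartAt ℂ z z, 0) with hy0
  set y1 : ℂ × Covec := (chartAt ℂ w w, 0) with hy1
  set Θ : ℂ × Covec → ℂ × Covec := fun y => cotChart w (φ ((cotChart z).symm y)) with hΘ
  set Θ' : ℂ × Covec → ℂ × Covec := fun y => cotChart z (φ.symm ((cotChart w).symm y)) with hΘ'
  have h0 : (cotChart z).symm y0 = covector z 0 := cotChart_symm_self z 0
  have h1 : (cotChart w).symm y1 = covector w 0 := cotChart_symm_self w 0
  have v0 : Θ y0 = y1 := by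
    simp only [hΘ, h0, hφz]; exact cotChart_covector_self w 0
  have v1 : Θ' y1 = y0 := by
    simp only [hΘ', h1, hφw]; exact cotChart_covector_self z 0
  have cΘ : ContDiffAt ℝ ∞ Θ y0 := contDiffAt_diffeo_in_cotChart φ tz (by rw [h0, hφz]; exact sw)
  have cΘ' : ContDiffAt ℝ ∞ Θ' y1 := contDiffAt_diffeo_in_cotChart φ.symm tw (by rw [h1, hφw]; exact sz)
  have symp : ∀ u u' : ℂ × Covec, stdForm (fderiv ℝ Θ y0 u) (fderiv ℝ Θ y0 u') = stdForm u u' := by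
    intro u u'
    have hb : (φ (covector z 0)).proj ∈ (chartAt ℂ w).source := by rw [hφz]; exact sw
    have e := hφ (covector z 0) u u'
    rw [symplecticForm_eq hb] at e
    have e1 := mfderiv_diffeo_in_cotChart φ hb u
    have e2 := mfderiv_diffeo_in_cotChart φ hb u'
    have e3 : cotChart (covector z (0 : Covec) : Cotangent S).proj (covector z 0) = y0 :=
      cotChart_covector_self z 0
    rw [e3] at e1 e2
    have := congrArg₂ (fun a b => stdForm a b) e1 e2
    exact this.symm.trans e
  have inv : (fderiv ℝ Θ y0).comp (fderiv ℝ Θ' y1) = ContinuousLinearMap.id ℝ _ := by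
    have ev : Θ ∘ Θ' =ᶠ[𝓝 y1] id := by
      have c0 : ∀ᶠ y in 𝓝 y1, y ∈ (cotChart w).target :=
        (isOpen_cotChart_target w).mem_nhds (mem_cotChart_target.2 tw)
      have c1 : ∀ᶠ y in 𝓝 y1, (φ.symm ((cotChart w).symm y)).proj ∈ (chartAt ℂ z).source := by
        have c2 : ContinuousAt (cotChart w).symm y1 := (contMDiffAt_cotChart_symm tw).continuousAt
        have c3 : ContinuousAt (fun y => (φ.symm ((cotChart w).symm y)).proj) y1 :=
          ContinuousAt.comp (f := (cotChart w).symm)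
            (continuous_proj'.comp φ.symm.contMDiff.continuous).continuousAt c2
        refine c3.eventually_mem ((chartAt ℂ z).open_source.mem_nhds ?_)
        rw [h1, hφw]; exact sz
      filter_upwards [c0, c1] with y g0 g1
      simp only [hΘ, hΘ', Function.comp, id]
      rw [(cotChart z).left_inv (mem_cotChart_source.2 g1), φ.apply_symm_apply, (cotChart w).right_inv g0]
    rw [← fderiv_id (𝕜 := ℝ) (x := y1), ← ev.fderiv_eq, fderiv_comp, v1]
    · rw [v1]; exact cΘ.differentiableAt (by simp)
    · exact cΘ'.differentiableAt (by simp)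
  -- The zero-section is mapped to itself by the base map, so directions along it are transported by
  -- the differential of that map.
  have horiz : ∀ v : ℂ, fderiv ℝ Θ y0 (v, 0) = (differential f z v, 0) := by
    intro v
    have ev : (fun q : ℂ => Θ (q, 0)) =ᶠ[𝓝 (chartAt ℂ z z)]
        fun q => (chartAt ℂ w (f ((chartAt ℂ z).symm q)), 0) := by
      have c1 : ∀ᶠ q in 𝓝 (chartAt ℂ z z), f ((chartAt ℂ z).symm q) ∈ (chartAt ℂ w).source := by
        have c2 : ContinuousAt (fun q => f ((chartAt ℂ z).symm q)) (chartAt ℂ z z) :=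
          ContinuousAt.comp f.contMDiff.continuous.continuousAt ((chartAt ℂ z).continuousAt_symm tz)
        refine c2.eventually_mem ((chartAt ℂ w).open_source.mem_nhds ?_)
        rw [(chartAt ℂ z).left_inv sz]; exact sw
      filter_upwards [(chartAt ℂ z).open_target.mem_nhds tz, c1] with q g0 g1
      have e : φ (covector ((chartAt ℂ z).symm q) 0) = covector (f ((chartAt ℂ z).symm q)) 0 :=
        cov_eq_zero_iff.1 ((h _).2 rfl)
      simp only [hΘ, cotChart_symm_zero g0, e]
      exact cotChart_zero g1
    have l : HasFDerivAt (fun q : ℂ => Θ (q, 0)) ((fderiv ℝ Θ y0).comp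
        ((ContinuousLinearMap.id ℝ ℂ).prod 0)) (chartAt ℂ z z) :=
      HasFDerivAt.comp (f := fun q : ℂ => (q, (0 : Covec))) (chartAt ℂ z z)
        (cΘ.differentiableAt (by simp)).hasFDerivAt
        ((hasFDerivAt_id _).prodMk (hasFDerivAt_const (0 : Covec) _))
    have hl2 := l.congr_of_eventuallyEq ev.symm
    have hl3 := hl2.fst
    rw [differential_eq, hl3.fderiv]
    have hl4 := hl2.snd.unique (hasFDerivAt_const (0 : Covec) _)
    have := congrArg (fun L => L v) hl4
    refine Prod.ext (by simp) ?_
    simpa using this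
  have line : HasDerivAt (fun s : ℝ => (chartAt ℂ w w, s • ξ)) ((0 : ℂ), ξ) 0 := by
    have := (hasDerivAt_id (0 : ℝ)).smul_const ξ
    rw [one_smul] at this
    exact (hasDerivAt_const (0 : ℝ) _).prodMk this
  have hγ : (fun s : ℝ => cotChart z (φ.symm (covector w (s • ξ)))) =
      fun s : ℝ => Θ' (chartAt ℂ w w, s • ξ) := by
    funext s
    simp only [hΘ', cotChart_symm_self]
  have hγ1 : HasDerivAt (fun s : ℝ => Θ' (chartAt ℂ w w, s • ξ)) (fderiv ℝ Θ' y1 (0, ξ)) 0 := by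
    have hd : HasFDerivAt Θ' (fderiv ℝ Θ' y1) (chartAt ℂ w w, (0 : ℝ) • ξ) := by
      rw [zero_smul]
      exact (cΘ'.differentiableAt (by simp)).hasFDerivAt
    exact HasFDerivAt.comp_hasDerivAt (f := fun s : ℝ => (chartAt ℂ w w, s • ξ)) 0 hd line
  refine ⟨?_, ?_, ?_⟩
  · rw [hγ]
    have hc : ContDiffAt ℝ ∞ Θ' (chartAt ℂ w w, (0 : ℝ) • ξ) := by rw [zero_smul]; exact cΘ'
    exact ContDiffAt.comp (f := fun s : ℝ => (chartAt ℂ w w, s • ξ)) 0 hc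
      (contDiffAt_const.prodMk (contDiffAt_id.smul contDiffAt_const))
  · rw [zero_smul, hφw]; exact cotChart_covector_self z 0
  · rw [hγ, hγ1.deriv]
    ext v : 1
    -- Pairing with a horizontal vector extracts the fibre component: before transport it is the
    -- unknown component applied to `v`, after transport it is `ξ` applied to the image of `v`.
    have e := symp (v, 0) (fderiv ℝ Θ' y1 (0, ξ))
    have e2 : fderiv ℝ Θ y0 (fderiv ℝ Θ' y1 (0, ξ)) = (0, ξ) := congrArg (fun L => L ((0 : ℂ), ξ)) inv
    rw [e2, horiz] at e
    simp [stdForm] at e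
    simpa using e.symm

end

/-! ### Jets of functions belonging to a family of ideals. -/

section

variable {S : Type*} [TopologicalSpace S] [ChartedSpace ℂ S] [IsManifold 𝓘(ℂ) ω S]

theorem pCoord_smul (s : ℝ) (ξ : Covec) : pCoord (s • ξ) = s * pCoord ξ := by
  simp [pCoord]; ring

theorem pbarCoord_smul (s : ℝ) (ξ : Covec) : pbarCoord (s • ξ) = s * pbarCoord ξ := by
  simp [pbarCoord]; ring

theorem evalAt_smul (s : ℝ) (ξ : Covec) (P : Poly) :
    evalAt (s • ξ) P = (lineRes (pCoord ξ) (pbarCoord ξ) P).eval (s : ℂ) := by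
  rw [evalAt, eval_lineRes, pCoord_smul, pbarCoord_smul, mul_comm (s : ℂ), mul_comm (s : ℂ)]

/-- A real covector is `p dz + p̄ dz̄`; this formula makes pullbacks of covectors explicit in `p`
and `p̄`. -/
theorem ofReal_coe_apply (ξ : Covec) (v : ℂ) :
    ((ξ v : ℝ) : ℂ) = pCoord ξ * v + pbarCoord ξ * (starRingEnd ℂ) v := by
  have h : ξ v = v.re * ξ 1 + v.im * ξ Complex.I := by
    conv_lhs => rw [show v = v.re • (1 : ℂ) + v.im • Complex.I by simp, map_add, map_smul, map_smul]
    simp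
  have hc : (starRingEnd ℂ) v = v.re - v.im * Complex.I := by simp [Complex.ext_iff]
  rw [h, hc]
  have hv : v = v.re + v.im * Complex.I := (Complex.re_add_im v).symm
  generalize v.re = x at *
  generalize v.im = y at *
  rw [hv]
  simp only [pCoord, pbarCoord]
  push_cast
  linear_combination (y * ξ Complex.I : ℂ) * Complex.I_sq

theorem isBigO_eval_sub {Q : Polynomial ℂ} {k : ℕ} (h : Polynomial.X ^ k ∣ Q) :
    (fun s : ℝ => Q.eval (s : ℂ) - (s : ℂ) ^ k * Q.coeff k) =O[𝓝 0] fun s : ℝ => s ^ (k + 1) := by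
  obtain ⟨R, rfl⟩ := h
  obtain ⟨R', hR'⟩ : Polynomial.X ∣ R - Polynomial.C (R.coeff 0) := by
    rw [Polynomial.X_dvd_iff]; simp
  have hR : R = Polynomial.C (R.coeff 0) + Polynomial.X * R' := by rw [← hR']; ring
  have e : (fun s : ℝ => (Polynomial.X ^ k * R).eval (s : ℂ) -
      (s : ℂ) ^ k * (Polynomial.X ^ k * R).coeff k) = fun s : ℝ => (s : ℂ) ^ (k + 1) * R'.eval (s : ℂ) := by
    funext s
    have : (Polynomial.X ^ k * R).coeff k = R.coeff 0 := by
      simpa using Polynomial.coeff_X_pow_mul R k 0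
    rw [this]
    conv_lhs => rw [hR]
    simp
    ring
  rw [e]
  have h1 : (fun s : ℝ => R'.eval (s : ℂ)) =O[𝓝 0] fun _ : ℝ => (1 : ℝ) := by
    have hc : ContinuousAt (fun s : ℝ => R'.eval (s : ℂ)) 0 :=
      (R'.continuous.comp Complex.continuous_ofReal).continuousAt
    exact Filter.Tendsto.isBigO_one ℝ hc
  have h2 : (fun s : ℝ => (s : ℂ) ^ (k + 1)) =O[𝓝 0] fun s : ℝ => s ^ (k + 1) :=
    Asymptotics.IsBigO.of_bound 1 (Filter.Eventually.of_forall fun s => by simp)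
  simpa using h2.mul h1

/-- The leading term, on a fibre, of a function with a given fibrewise jet. -/
theorem AgreesAt.isBigO_line {m k : ℕ} (hkm : k + 1 ≤ m) {F : Cotangent S → ℂ} {z : S} {P : Poly}
    (h : AgreesAt m F z P) (hP : P ∈ maxIdeal ^ k) (ξ : Covec) :
    (fun s : ℝ => F (covector z (s • ξ)) - (s : ℂ) ^ k * homPart k P (pCoord ξ) (pbarCoord ξ))
      =O[𝓝 0] fun s : ℝ => s ^ (k + 1) := by
  have ht : Filter.Tendsto (fun s : ℝ => s • ξ) (𝓝 0) (𝓝 0) := by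
    have : Continuous (fun s : ℝ => s • ξ) := by fun_prop
    simpa using this.tendsto 0
  have h1 := h.comp_tendsto ht
  have h2 : (fun s : ℝ => ‖s • ξ‖ ^ m) =O[𝓝 0] fun s : ℝ => s ^ (k + 1) := by
    have e : (fun s : ℝ => ‖s • ξ‖ ^ m) = fun s : ℝ => ‖ξ‖ ^ m * ‖s ^ m‖ := by
      funext s; rw [norm_smul, mul_pow, norm_pow, mul_comm]
    rw [e]
    have h0 : (fun s : ℝ => s ^ m) =O[𝓝 0] fun s : ℝ => s ^ (k + 1) := by
      rcases hkm.eq_or_lt with rfl | hlt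
      · exact Asymptotics.isBigO_refl _ _
      · exact (Asymptotics.isLittleO_pow_pow hlt).isBigO
    exact h0.norm_left.const_mul_left _
  have h3 := isBigO_eval_sub (X_pow_dvd_lineRes hP (pCoord ξ) (pbarCoord ξ))
  have := (h1.trans h2).add h3
  refine this.congr_left fun s => ?_
  simp only [Function.comp, evalAt_smul, coeff_lineRes]
  ring

theorem eq_zero_of_pow_mul_isLittleO {k : ℕ} {c : ℂ}
    (h : (fun s : ℝ => (s : ℂ) ^ k * c) =o[𝓝 0] fun s : ℝ => s ^ k) : c = 0 := by
  have h1 : (fun s : ℝ => s ^ k • c) =o[𝓝[≠] 0] fun s : ℝ => s ^ k • (1 : ℝ) := by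
    refine (h.mono nhdsWithin_le_nhds).congr (fun s => ?_) (fun s => by simp)
    rw [Complex.real_smul]; push_cast; rfl
  have h2 := (Asymptotics.isLittleO_iff_tendsto' (f := fun s : ℝ => ‖c‖ * ‖s ^ k‖) (g := fun s : ℝ => ‖s ^ k‖)
    (l := 𝓝[≠] 0) ?_).1 ?_
  · have h3 : Filter.Tendsto (fun s : ℝ => ‖c‖ * ‖s ^ k‖ / ‖s ^ k‖) (𝓝[≠] 0) (𝓝 ‖c‖) := by
      refine tendsto_const_nhds.congr' ?_
      filter_upwards [self_mem_nhdsWithin] with s hs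
      have : ‖s ^ k‖ ≠ 0 := norm_ne_zero_iff.2 (pow_ne_zero _ hs)
      field_simp
    exact norm_eq_zero.1 (tendsto_nhds_unique h3 h2)
  · filter_upwards [self_mem_nhdsWithin] with s hs h
    exact absurd h (norm_ne_zero_iff.2 (pow_ne_zero _ hs))
  · refine (h1.norm_norm).congr (fun s => by rw [norm_smul, mul_comm]) (fun s => by simp)

theorem cotChart_symm_smul {a : S} {q : ℂ} (hq : q ∈ (chartAt ℂ a).target) (s : ℝ) (η : Covec) :
    (cotChart a).symm (q, s • η) =
      covector ((chartAt ℂ a).symm q) (s • cov ((cotChart a).symm (q, η))) := by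
  have hs := (chartAt ℂ a).map_target hq
  have h := cotChart_symm_snd (y := (q, η)) hq
  have e : cotChart a (covector ((chartAt ℂ a).symm q) (s • cov ((cotChart a).symm (q, η)))) = (q, s • η) := by
    rw [cotChart_apply hs, cov_covector]
    refine Prod.ext ((chartAt ℂ a).right_inv hq) ?_
    change (s • cov ((cotChart a).symm (q, η))).comp (fderiv ℝ (transition a ((chartAt ℂ a).symm q))
      (chartAt ℂ a ((chartAt ℂ a).symm q))) = s • η
    rw [(chartAt ℂ a).right_inv hq, ContinuousLinearMap.smul_comp, h]
  rw [← e, (cotChart a).left_inv (mem_cotChart_source.2 hs)]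

theorem contDiffAt_fun_in_cotChart {F : Cotangent S → ℂ} (hF : ContMDiff IT 𝓘(ℝ, ℂ) ∞ F) {a : S}
    {y : ℂ × Covec} (hy : y.1 ∈ (chartAt ℂ a).target) :
    ContDiffAt ℝ ∞ (fun y => F ((cotChart a).symm y)) y := by
  rw [← contMDiffAt_iff_contDiffAt]
  exact hF.contMDiffAt.comp y (contMDiffAt_cotChart_symm hy)

theorem BelongsTo.isBigO_line {m k : ℕ} (hkm : k + 1 ≤ m) {I : S → Ideal Poly} {F : Cotangent S → ℂ}
    (h : BelongsTo m I F) (hI : ∀ z, I z ≤ maxIdeal ^ k) {a : S} {q : ℂ}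
    (hq : q ∈ (chartAt ℂ a).target) (η : Covec) :
    (fun s : ℝ => F ((cotChart a).symm (q, s • η))) =O[𝓝 0] fun s : ℝ => s ^ k := by
  obtain ⟨P, hP, hA⟩ := h ((chartAt ℂ a).symm q)
  have h1 := hA.isBigO_line hkm (hI _ hP) (cov ((cotChart a).symm (q, η)))
  have h2 : (fun s : ℝ => (s : ℂ) ^ k * homPart k P (pCoord (cov ((cotChart a).symm (q, η))))
      (pbarCoord (cov ((cotChart a).symm (q, η))))) =O[𝓝 0] fun s : ℝ => s ^ k := by
    refine Asymptotics.IsBigO.of_bound ‖homPart k P (pCoord (cov ((cotChart a).symm (q, η))))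
      (pbarCoord (cov ((cotChart a).symm (q, η))))‖ (Filter.Eventually.of_forall fun s => ?_)
    rw [norm_mul, mul_comm]
    simp
  have h3 : (fun s : ℝ => s ^ (k + 1)) =O[𝓝 0] fun s : ℝ => s ^ k := by
    refine Asymptotics.IsLittleO.isBigO ?_
    exact Asymptotics.isLittleO_pow_pow (by omega)
  refine ((h1.trans h3).add h2).congr_left fun s => ?_
  rw [cotChart_symm_smul hq]
  ring

/-- Two expansions of `F` on one fibre line, by its polynomial jet and by its derivatives, have the
same term of degree `k`. The leading form of a jet is therefore determined by `F` and varies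
smoothly with the base point. -/
theorem AgreesAt.homPart_eq_fibreJet {m k : ℕ} (hk : k = 1 ∨ k = 2) (hkm : k + 1 ≤ m)
    {I : S → Ideal Poly} {F : Cotangent S → ℂ} (hF : ContMDiff IT 𝓘(ℝ, ℂ) ∞ F)
    (h : BelongsTo m I F) (hI : ∀ z, I z ≤ maxIdeal ^ k) {a : S} {q : ℂ}
    (hq : q ∈ (chartAt ℂ a).target) {P : Poly} (hP : P ∈ maxIdeal ^ k)
    (hA : AgreesAt m F ((chartAt ℂ a).symm q) P) (η : Covec) :
    homPart k P (pCoord (cov ((cotChart a).symm (q, η)))) (pbarCoord (cov ((cotChart a).symm (q, η)))) =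
      fibreJet k (fun y => F ((cotChart a).symm y)) q η := by
  set ξ := cov ((cotChart a).symm (q, η))
  have hO : ∀ᶠ q' in 𝓝 q, ∀ η' : Covec,
      (fun s : ℝ => F ((cotChart a).symm (q', s • η'))) =O[𝓝 0] fun s : ℝ => s ^ k := by
    filter_upwards [(chartAt ℂ a).open_target.mem_nhds hq] with q' hq' η'
    exact h.isBigO_line hkm hI hq' η'
  have hγ : ContDiffAt ℝ ∞ (fun s : ℝ => (q, s • η)) 0 :=
    contDiffAt_const.prodMk (contDiffAt_id.smul contDiffAt_const)
  have hd : HasDerivAt (fun s : ℝ => (q, s • η)) ((0 : ℂ), η) 0 := by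
    have := (hasDerivAt_id (0 : ℝ)).smul_const η
    rw [one_smul] at this
    exact (hasDerivAt_const (0 : ℝ) q).prodMk this
  have h1 := isLittleO_fibreJet hk (contDiffAt_fun_in_cotChart hF (y := (q, 0)) hq) hO hγ (by simp)
  rw [hd.deriv] at h1
  have h2 := (hA.isBigO_line hkm hP ξ).trans_isLittleO
    (Asymptotics.isLittleO_pow_pow (𝕜 := ℝ) (m := k) (n := k + 1) (by omega))
  have h3 := h1.sub h2
  rw [← sub_eq_zero]
  refine eq_zero_of_pow_mul_isLittleO (k := k) (h3.congr_left fun s => ?_)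
  simp only
  rw [cotChart_symm_smul hq]
  ring

end

/-! ### The action of higher diffeomorphisms on slopes. -/

section

variable {S : Type*} [TopologicalSpace S] [ChartedSpace ℂ S] [IsManifold 𝓘(ℂ) ω S]

/-- The pullback of covectors by a real linear map, on the coordinates `p, p̄`. -/
def pullPoly (D : ℂ →L[ℝ] ℂ) : Poly →ₐ[ℂ] Poly :=
  linSubst ((D 1 - Complex.I * D Complex.I) / 2)
    (((starRingEnd ℂ) (D 1) - Complex.I * (starRingEnd ℂ) (D Complex.I)) / 2)
    ((D 1 + Complex.I * D Complex.I) / 2)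
    (((starRingEnd ℂ) (D 1) + Complex.I * (starRingEnd ℂ) (D Complex.I)) / 2)

theorem pCoord_comp (D : ℂ →L[ℝ] ℂ) (ξ : Covec) : pCoord (ξ.comp D) =
    ((D 1 - Complex.I * D Complex.I) / 2) * pCoord ξ +
      (((starRingEnd ℂ) (D 1) - Complex.I * (starRingEnd ℂ) (D Complex.I)) / 2) * pbarCoord ξ := by
  conv_lhs => rw [pCoord]
  simp only [ContinuousLinearMap.comp_apply]
  rw [ofReal_coe_apply ξ (D 1), ofReal_coe_apply ξ (D Complex.I)]
  ring

theorem pbarCoord_comp (D : ℂ →L[ℝ] ℂ) (ξ : Covec) : pbarCoord (ξ.comp D) =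
    ((D 1 + Complex.I * D Complex.I) / 2) * pCoord ξ +
      (((starRingEnd ℂ) (D 1) + Complex.I * (starRingEnd ℂ) (D Complex.I)) / 2) * pbarCoord ξ := by
  conv_lhs => rw [pbarCoord]
  simp only [ContinuousLinearMap.comp_apply]
  rw [ofReal_coe_apply ξ (D 1), ofReal_coe_apply ξ (D Complex.I)]
  ring

theorem evalAt_comp (D : ℂ →L[ℝ] ℂ) (ξ : Covec) (P : Poly) :
    evalAt (ξ.comp D) P = evalAt ξ (pullPoly D P) := by
  rw [evalAt, evalAt, pullPoly, eval_linSubst, pCoord_comp, pbarCoord_comp]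

/-- Leading forms of `I`, pulled back by `D`, are leading forms of `J` and vanish at `(1, μ')`. So
all leading forms of `I` vanish at the image of `(1, μ')` under the substitution given by `D`, which
forces this image onto the line of slope `μ`. -/
theorem HasSlope.identifies {k : ℕ} {μ μ' : ℂ} {I J : Ideal Poly} (hI : HasSlope k I μ)
    (hJ : HasSlope k J μ') (hk : 1 ≤ k) (D : ℂ →L[ℝ] ℂ)
    (h : ∀ P ∈ I, ∃ P' ∈ J, ∀ ξ : Covec, homPart k P' (pCoord ξ) (pbarCoord ξ) =
      homPart k P (pCoord (ξ.comp D)) (pbarCoord (ξ.comp D))) :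
    ∃ c : ℂ, ∀ ξ : Covec, vector01 μ (ξ.comp D) = c * vector01 μ' ξ := by
  set α := (D 1 - Complex.I * D Complex.I) / 2 with hα
  set β := ((starRingEnd ℂ) (D 1) - Complex.I * (starRingEnd ℂ) (D Complex.I)) / 2 with hβ
  set γ := (D 1 + Complex.I * D Complex.I) / 2 with hγ
  set δ := ((starRingEnd ℂ) (D 1) + Complex.I * (starRingEnd ℂ) (D Complex.I)) / 2 with hδ
  have key : ∀ P ∈ I, homPart k P (α + β * μ') (γ + δ * μ') = 0 := by
    intro P hP
    obtain ⟨P', hP', e⟩ := h P hP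
    have h0 : MvPolynomial.homogeneousComponent k P' -
        pullPoly D (MvPolynomial.homogeneousComponent k P) = 0 := by
      refine eq_zero_of_evalAt fun ξ => ?_
      have e1 := e ξ
      have e2 := evalAt_comp D ξ (MvPolynomial.homogeneousComponent k P)
      simp only [evalAt, homPart] at e1 e2 ⊢
      rw [map_sub, ← e2, e1, sub_self]
    have h1 := congrArg (MvPolynomial.eval ![1, μ']) h0
    rw [map_sub, pullPoly, eval_linSubst, map_zero] at h1
    have h2 := homPart_eq_zero_of_mem (hJ.le hP')
    rw [homPart] at h2 ⊢
    rw [h2, zero_sub, neg_eq_zero] at h1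
    simpa using h1
  -- If the image point were off the line, the forms `x ^ (k - 1) (y - μ x)` and `y ^ (k - 1) (y - μ
  -- x)` would force both its coordinates to vanish for `k > 1`, and would contain a nonzero value
  -- for `k = 1`; the origin itself lies on the line.
  have slope : γ + δ * μ' = μ * (α + β * μ') := by
    rw [← sub_eq_zero]
    by_contra hne
    obtain ⟨P, hP, e⟩ := hI.gen (k - 1) 0 (by omega)
    obtain ⟨Q, hQ, e'⟩ := hI.gen 0 (k - 1) (by omega)
    have h1 := key P hP
    have h2 := key Q hQ
    rw [e] at h1
    rw [e'] at h2
    rw [mul_eq_zero] at h1 h2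
    have h1 := h1.resolve_right hne
    have h2 := h2.resolve_right hne
    simp only [pow_zero, mul_one, one_mul] at h1 h2
    have ha := eq_zero_of_pow_eq_zero h1
    have hb := eq_zero_of_pow_eq_zero h2
    rw [ha, hb] at hne
    simp at hne
  -- The factor is the coefficient of `p̄` in the pullback of `p̄ - μ p`; the coefficient of `p`
  -- then matches by `slope`.
  refine ⟨δ - μ * β, fun ξ => ?_⟩
  rw [vector01, vector01, pCoord_comp, pbarCoord_comp]
  linear_combination (pCoord ξ) * slope

/-- A smooth `F` belonging to `I` with jet `P` at `z` is transported to `F ∘ φ⁻¹`, which belongs to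
`J`. Along the line of `ξ` over the image of `z`, its leading term is that of `F` along the image
curve under `φ⁻¹`, whose vertical velocity is the pullback of `ξ` by the base differential. -/
theorem exists_homPart_eq_of_carries {m k : ℕ} (hk : k = 1 ∨ k = 2) (hkm : k + 1 ≤ m)
    {φ : Diffeomorph IT IT (Cotangent S) (Cotangent S) ∞} (hφ : IsSymplectic φ)
    (h : ∀ x, cov (φ x) = 0 ↔ cov x = 0) {I J : HilbSection m S} (hc : Carries φ I J)
    (hI : ∀ z, I.ideal z ≤ maxIdeal ^ k) (hJ : ∀ z, J.ideal z ≤ maxIdeal ^ k) (z : S)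
    {P : Poly} (hP : P ∈ I.ideal z) :
    ∃ P' ∈ J.ideal (baseDiffeo φ h z), ∀ ξ : Covec, homPart k P' (pCoord ξ) (pbarCoord ξ) =
      homPart k P (pCoord (ξ.comp (differential (baseDiffeo φ h) z)))
        (pbarCoord (ξ.comp (differential (baseDiffeo φ h) z))) := by
  obtain ⟨F, hF, hB, hA⟩ := I.smooth z P hP
  have hB' : BelongsTo m J.ideal (fun x => F (φ.symm x)) := by
    refine (hc _ (hF.comp φ.symm.contMDiff)).2 ?_
    simpa using hB
  obtain ⟨P', hP', hA'⟩ := hB' (baseDiffeo φ h z)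
  refine ⟨P', hP', fun ξ => ?_⟩
  have tz := mem_chart_target ℂ z
  have sz := mem_chart_source ℂ z
  obtain ⟨g1, g2, g3⟩ := hφ.fibre_deriv h z ξ
  set f := baseDiffeo φ h with hf
  have hz : (chartAt ℂ z).symm (chartAt ℂ z z) = z := (chartAt ℂ z).left_inv sz
  have j1 := AgreesAt.homPart_eq_fibreJet hk hkm hF hB hI tz (hI z hP) (by rw [hz]; exact hA)
    (ξ.comp (differential f z))
  rw [cotChart_symm_self, cov_covector] at j1
  rw [j1, ← g3]
  have hO : ∀ᶠ q' in 𝓝 (chartAt ℂ z z), ∀ η' : Covec,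
      (fun s : ℝ => F ((cotChart z).symm (q', s • η'))) =O[𝓝 0] fun s : ℝ => s ^ k := by
    filter_upwards [(chartAt ℂ z).open_target.mem_nhds tz] with q' hq' η'
    exact hB.isBigO_line hkm hI hq' η'
  have l1 := isLittleO_fibreJet hk (contDiffAt_fun_in_cotChart hF (y := (chartAt ℂ z z, 0)) tz) hO g1 g2
  have l2 := (hA'.isBigO_line hkm (hJ _ hP') ξ).trans_isLittleO
    (Asymptotics.isLittleO_pow_pow (𝕜 := ℝ) (m := k) (n := k + 1) (by omega))
  have hcont : ∀ᶠ s : ℝ in 𝓝 0, (φ.symm (covector (f z) (s • ξ))).proj ∈ (chartAt ℂ z).source := by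
    have c1 : ContinuousAt (fun s : ℝ => (cotChart (f z)).symm (chartAt ℂ (f z) (f z), s • ξ)) 0 :=
      ContinuousAt.comp (f := fun s : ℝ => (chartAt ℂ (f z) (f z), s • ξ))
        (contMDiffAt_cotChart_symm (mem_chart_target ℂ (f z))).continuousAt (by fun_prop)
    have c2 : ContinuousAt (fun s : ℝ => (φ.symm (covector (f z) (s • ξ))).proj) 0 := by
      have := ContinuousAt.comp (g := fun x => (φ.symm x).proj)
        (continuous_proj'.comp φ.symm.contMDiff.continuous).continuousAt c1
      simpa only [Function.comp_def, cotChart_symm_self] using this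
    refine c2.eventually_mem ((chartAt ℂ z).open_source.mem_nhds ?_)
    have : (φ.symm (covector (f z) ((0 : ℝ) • ξ))).proj = z := by
      rw [zero_smul]; exact f.symm_apply_apply z
    rw [this]; exact sz
  rw [← sub_eq_zero]
  refine eq_zero_of_pow_mul_isLittleO (k := k) ((l1.sub l2).congr' ?_ (Filter.EventuallyEq.refl _ _))
  filter_upwards [hcont] with s hs
  rw [(cotChart z).left_inv (mem_cotChart_source.2 hs)]
  ring

theorem IsFibrewiseOdd.vanishesOnZeroSection {H : Cotangent S → ℝ} (h : IsFibrewiseOdd H) :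
    VanishesOnZeroSection H := by
  intro z
  have := h z 0
  rw [neg_zero] at this
  linarith

theorem ClassicalType.AdmissibleHamiltonian.vanishesOnZeroSection {T : ClassicalType}
    {H : Cotangent S → ℝ} (h : T.AdmissibleHamiltonian H) : VanishesOnZeroSection H := by
  cases T
  · exact h
  all_goals exact IsFibrewiseOdd.vanishesOnZeroSection h

/-- A higher diffeomorphism induces an isotopically trivial diffeomorphism of the surface that
identifies the complex structures given by the slopes. -/
theorem exists_identifies_of_carries {m k : ℕ} (hk : k = 1 ∨ k = 2) (hkm : k + 1 ≤ m)
    {φ : Diffeomorph IT IT (Cotangent S) (Cotangent S) ∞}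
    (hφ : IsHamiltonianDiffeo VanishesOnZeroSection φ) {I J : HilbSection m S} (hc : Carries φ I J)
    {μ μ' : Beltrami S} (hI : ∀ z, HasSlope k (I.ideal z) (μ.toFun z))
    (hJ : ∀ z, HasSlope k (J.ideal z) (μ'.toFun z)) :
    ∃ f : Diffeo S, IsotopicToId f ∧ Identifies f μ μ' := by
  obtain ⟨H, Φ, hH, hΦ, rfl⟩ := hφ
  refine ⟨_, hΦ.isotopicToId hH, fun z => ?_⟩
  refine (hI z).identifies (hJ _) (by omega) _ fun P hP => ?_
  exact exists_homPart_eq_of_carries hk hkm (hΦ.symplecticForm_mfderiv 1) _ hc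
    (fun z P hP => (mem_slopeIdeal.1 ((hI z).le hP)).2)
    (fun z P hP => (mem_slopeIdeal.1 ((hJ z).le hP)).2) z hP

end

/-! ### Beltrami differentials in charts. -/

section

variable {S : Type*} [TopologicalSpace S] [ChartedSpace ℂ S] [IsManifold 𝓘(ℂ) ω S]

/-- The derivative at `z` of the transition map from the preferred chart at `z` to the one at `a`. -/
def jac (a z : S) : ℂ := deriv (transition z a) (chartAt ℂ z z)

theorem deriv_transition_mul_jac {a z : S} (hz : z ∈ (chartAt ℂ a).source) :
    deriv (transition a z) (chartAt ℂ a z) * jac a z = 1 := by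
  have sz := mem_chart_source ℂ z
  have tz := mem_chart_target ℂ z
  have e : (chartAt ℂ z).symm (chartAt ℂ z z) = z := (chartAt ℂ z).left_inv sz
  have h := fderiv_transition_comp z a z tz (by rwa [e]) (by rwa [e])
  rw [fderiv_transition_self z tz] at h
  have h1 := congrArg (fun L => L 1) h
  have e2 : transition z a (chartAt ℂ z z) = chartAt ℂ a z := by rw [transition, e]
  simp only [ContinuousLinearMap.comp_apply, e2] at h1
  rw [fderiv_transition_apply z a tz (by rwa [e]),
    fderiv_transition_apply a z ((chartAt ℂ a).map_source hz) (by rw [(chartAt ℂ a).left_inv hz]; exact sz)] at h1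
  simpa [jac] using h1

theorem jac_ne_zero {a z : S} (hz : z ∈ (chartAt ℂ a).source) : jac a z ≠ 0 :=
  right_ne_zero_of_mul_eq_one (deriv_transition_mul_jac hz)

theorem deriv_transition_eq {a z : S} (hz : z ∈ (chartAt ℂ a).source) :
    deriv (transition a z) (chartAt ℂ a z) = (jac a z)⁻¹ :=
  eq_inv_of_mul_eq_one_left (deriv_transition_mul_jac hz)

theorem jac_self (a : S) : jac a a = 1 := by
  have h := fderiv_transition_self a (mem_chart_target ℂ a)
  have h1 := congrArg (fun L => L 1) h
  have sz := mem_chart_source ℂ a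
  simp only [ContinuousLinearMap.id_apply] at h1
  rw [fderiv_transition_apply a a (mem_chart_target ℂ a) (by rw [(chartAt ℂ a).left_inv sz]; exact sz)] at h1
  simpa [jac] using h1

theorem apply_fderiv_transition {a z : S} (hz : z ∈ (chartAt ℂ a).source) (v : ℂ) :
    fderiv ℝ (transition a z) (chartAt ℂ a z) v = (jac a z)⁻¹ * v := by
  rw [fderiv_transition_apply a z ((chartAt ℂ a).map_source hz)
    (by rw [(chartAt ℂ a).left_inv hz]; exact mem_chart_source ℂ z), deriv_transition_eq hz]

/-- A conjugate-linear endomorphism field of the tangent bundle, in the preferred chart at `a`. -/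
def chartSlope (m : S → ℂ) (a : S) (q : ℂ) : ℂ :=
  m ((chartAt ℂ a).symm q) *
    (jac a ((chartAt ℂ a).symm q) / (starRingEnd ℂ) (jac a ((chartAt ℂ a).symm q)))

omit [IsManifold 𝓘(ℂ) ω S] in
theorem chartSlope_apply (m : S → ℂ) {a z : S} (hz : z ∈ (chartAt ℂ a).source) :
    chartSlope m a (chartAt ℂ a z) = m z * (jac a z / (starRingEnd ℂ) (jac a z)) := by
  rw [chartSlope, (chartAt ℂ a).left_inv hz]

/-- Holomorphic chart changes do not mix `p` and `p̄`: they scale them by conjugate factors. -/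
theorem pCoord_symm {a z : S} (hz : z ∈ (chartAt ℂ a).source) (η : Covec) :
    pCoord (cov ((cotChart a).symm (chartAt ℂ a z, η))) = jac a z * pCoord η ∧
    pbarCoord (cov ((cotChart a).symm (chartAt ℂ a z, η))) = (starRingEnd ℂ) (jac a z) * pbarCoord η := by
  have h := cotChart_symm_snd (a := a) (y := (chartAt ℂ a z, η)) ((chartAt ℂ a).map_source hz)
  have e : (chartAt ℂ a).symm (chartAt ℂ a z) = z := (chartAt ℂ a).left_inv hz
  dsimp only at h
  rw [e] at h
  set ξ := cov ((cotChart a).symm (chartAt ℂ a z, η))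
  have hj := jac_ne_zero hz
  have hj' : (starRingEnd ℂ) (jac a z) ≠ 0 := by simpa using hj
  rw [← h, pCoord_comp, pbarCoord_comp, apply_fderiv_transition hz, apply_fderiv_transition hz]
  simp only [mul_one, map_mul, Complex.conj_I, map_inv₀]
  constructor
  · field_simp
    linear_combination (pCoord ξ * (starRingEnd ℂ) (jac a z) - pbarCoord ξ * jac a z) * Complex.I_sq
  · field_simp
    linear_combination (- pCoord ξ * (starRingEnd ℂ) (jac a z) + pbarCoord ξ * jac a z) * Complex.I_sq

theorem trivializationAt_tangent (a : S) (v : TangentBundle 𝓘(ℝ, ℂ) S) (hv : v.proj ∈ (chartAt ℂ a).source) :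
    (trivializationAt ℂ (TangentSpace 𝓘(ℝ, ℂ)) a v).2 = jac a v.proj * (show ℂ from v.snd) := by
  rw [TangentBundle.trivializationAt_apply]
  simp only [modelWithCornersSelf_coe, Set.range_id, fderivWithin_univ]
  have sz := mem_chart_source ℂ v.proj
  exact fderiv_transition_apply v.proj a (mem_chart_target ℂ v.proj)
    (by rwa [(chartAt ℂ v.proj).left_inv sz]) _

theorem Beltrami.contDiffAt_chartSlope (μ : Beltrami S) {a : S} {q : ℂ} (hq : q ∈ (chartAt ℂ a).target) :
    ContDiffAt ℝ ∞ (chartSlope μ.toFun a) q := by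
  set e := trivializationAt ℂ (TangentSpace 𝓘(ℝ, ℂ)) a
  -- The coordinate field that is constantly `1` in the chart at `a`; applying the endomorphism
  -- field to it returns the chart expression of the slope.
  let V : ℂ → TangentBundle 𝓘(ℝ, ℂ) S := fun q =>
    ⟨(chartAt ℂ a).symm q, ((jac a ((chartAt ℂ a).symm q))⁻¹ : ℂ)⟩
  have ev : ∀ᶠ q' in 𝓝 q, q' ∈ (chartAt ℂ a).target := (chartAt ℂ a).open_target.mem_nhds hq
  have hsymm : ContMDiffAt 𝓘(ℝ, ℂ) 𝓘(ℝ, ℂ) ∞ (chartAt ℂ a).symm q :=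
    (contMDiffOn_chart_symm (I := 𝓘(ℝ, ℂ)) (n := ∞) (x := a)).contMDiffAt ev
  have hs : ∀ q' ∈ (chartAt ℂ a).target, (V q') ∈ e.source := fun q' hq' => (chartAt ℂ a).map_target hq'
  have hV : ContMDiffAt 𝓘(ℝ, ℂ) 𝓘(ℝ, ℂ).tangent ∞ V q := by
    refine (Trivialization.contMDiffAt_iff (e := e) (hs q hq)).2 ⟨hsymm, ?_⟩
    refine (contMDiffAt_const (c := (1 : ℂ))).congr_of_eventuallyEq ?_
    filter_upwards [ev] with q' hq'
    rw [trivializationAt_tangent a _ ((chartAt ℂ a).map_target hq')]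
    exact mul_inv_cancel₀ (jac_ne_zero ((chartAt ℂ a).map_target hq'))
  have hB := μ.smooth.contMDiffAt.comp q hV
  have h2 := ((Trivialization.contMDiffAt_iff (e := e) (by exact hs q hq)).1 hB).2
  rw [← contMDiffAt_iff_contDiffAt]
  refine h2.congr_of_eventuallyEq ?_
  filter_upwards [ev] with q' hq'
  refine Eq.trans ?_ (trivializationAt_tangent a _ ((chartAt ℂ a).map_target hq')).symm
  change chartSlope μ.toFun a q' = jac a ((chartAt ℂ a).symm q') *
    (μ.toFun ((chartAt ℂ a).symm q') * (starRingEnd ℂ) (jac a ((chartAt ℂ a).symm q'))⁻¹)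
  rw [chartSlope, map_inv₀, div_eq_mul_inv]
  ring

/-- In the trivialization at `a` the map is `w ↦ chartSlope · w̄`. Smoothness at the centre of each
chart suffices, because every tangent vector lies over the centre of its own preferred chart. -/
theorem contMDiff_of_chartSlope {m : S → ℂ}
    (h : ∀ a : S, ContDiffAt ℝ ∞ (chartSlope m a) (chartAt ℂ a a)) :
    ContMDiff 𝓘(ℝ, ℂ).tangent 𝓘(ℝ, ℂ).tangent ∞
      (fun v : TangentBundle 𝓘(ℝ, ℂ) S =>
        (⟨v.proj, (m v.proj * (starRingEnd ℂ) (show ℂ from v.snd) : ℂ)⟩ : TangentBundle 𝓘(ℝ, ℂ) S)) := by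
  intro v
  set a := v.proj with ha
  set e := trivializationAt ℂ (TangentSpace 𝓘(ℝ, ℂ)) a
  have hsrc : v ∈ e.source := mem_chart_source ℂ v.proj
  have hproj : ContMDiffAt 𝓘(ℝ, ℂ).tangent 𝓘(ℝ, ℂ) ∞ (fun v : TangentBundle 𝓘(ℝ, ℂ) S => v.proj) v :=
    (contMDiff_proj (F := ℂ) (TangentSpace 𝓘(ℝ, ℂ))) v
  refine (Trivialization.contMDiffAt_iff (e := e) (by exact hsrc)).2 ⟨hproj, ?_⟩
  have hid := ((Trivialization.contMDiffAt_iff (e := e) hsrc).1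
    (contMDiffAt_id (I := 𝓘(ℝ, ℂ).tangent) (n := ∞) (x := v))).2
  have hch : ContMDiffAt 𝓘(ℝ, ℂ).tangent 𝓘(ℝ, ℂ) ∞
      (fun v : TangentBundle 𝓘(ℝ, ℂ) S => chartSlope m a (chartAt ℂ a v.proj)) v := by
    have h1 : ContMDiffAt 𝓘(ℝ, ℂ) 𝓘(ℝ, ℂ) ∞ (chartSlope m a) (chartAt ℂ a a) :=
      contMDiffAt_iff_contDiffAt.2 (h a)
    have h2 : ContMDiffAt 𝓘(ℝ, ℂ) 𝓘(ℝ, ℂ) ∞ (chartAt ℂ a) a :=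
      (contMDiffOn_chart (I := 𝓘(ℝ, ℂ)) (n := ∞) (x := a)).contMDiffAt
        ((chartAt ℂ a).open_source.mem_nhds (mem_chart_source ℂ a))
    exact ContMDiffAt.comp (g := chartSlope m a) v h1 (ContMDiffAt.comp v h2 hproj)
  have hconj : ContMDiffAt 𝓘(ℝ, ℂ).tangent 𝓘(ℝ, ℂ) ∞
      (fun v : TangentBundle 𝓘(ℝ, ℂ) S => (starRingEnd ℂ) (e v).2) v := by
    have h1 : ContMDiffAt 𝓘(ℝ, ℂ) 𝓘(ℝ, ℂ) ∞ (fun w : ℂ => (starRingEnd ℂ) w) (e v).2 :=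
      contMDiffAt_iff_contDiffAt.2 Complex.conjCLE.contDiff.contDiffAt
    exact ContMDiffAt.comp (g := fun w : ℂ => (starRingEnd ℂ) w) v h1 hid
  have hmul : ContMDiffAt 𝓘(ℝ, ℂ).tangent 𝓘(ℝ, ℂ) ∞ (fun v : TangentBundle 𝓘(ℝ, ℂ) S =>
      chartSlope m a (chartAt ℂ a v.proj) * (starRingEnd ℂ) (e v).2) v := by
    have h1 : ContMDiffAt 𝓘(ℝ, ℂ × ℂ) 𝓘(ℝ, ℂ) ∞ (fun w : ℂ × ℂ => w.1 * w.2)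
        (chartSlope m a (chartAt ℂ a v.proj), (starRingEnd ℂ) (e v).2) :=
      contMDiffAt_iff_contDiffAt.2 (contDiff_mul.contDiffAt)
    exact ContMDiffAt.comp (g := fun w : ℂ × ℂ => w.1 * w.2) v h1 (hch.prodMk_space hconj)
  refine hmul.congr_of_eventuallyEq ?_
  have ev : ∀ᶠ w in 𝓝 v, w.proj ∈ (chartAt ℂ a).source :=
    hproj.continuousAt.eventually_mem ((chartAt ℂ a).open_source.mem_nhds (mem_chart_source ℂ v.proj))
  filter_upwards [ev] with w hw
  refine (trivializationAt_tangent a ⟨w.proj, (m w.proj * (starRingEnd ℂ) (show ℂ from w.snd) : ℂ)⟩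
    hw).trans ?_
  have e2 : (e w).2 = jac a w.proj * (show ℂ from w.snd) := trivializationAt_tangent a w hw
  rw [e2, chartSlope_apply m hw, map_mul]
  have hj' : (starRingEnd ℂ) (jac a w.proj) ≠ 0 := by simpa using jac_ne_zero hw
  field_simp

end

/-! ### Smoothness of the slope of a smooth family of ideals. -/

section

variable {S : Type*} [TopologicalSpace S] [ChartedSpace ℂ S] [IsManifold 𝓘(ℂ) ω S]

theorem exists_homPart_two (P : Poly) :
    ∃ A B C : ℂ, ∀ x y, homPart 2 P x y = A * x ^ 2 + B * (x * y) + C * y ^ 2 := by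
  induction P using MvPolynomial.induction_on' with
  | monomial d c =>
    have h : ∀ x y, homPart 2 (MvPolynomial.monomial d c) x y =
        if 2 = d 0 + d 1 then c * (x ^ d 0 * y ^ d 1) else 0 := by
      intro x y
      rw [← coeff_lineRes, lineRes_monomial, Polynomial.coeff_C_mul_X_pow]
    by_cases hd : 2 = d 0 + d 1
    · obtain ⟨h0, h1⟩ | ⟨h0, h1⟩ | ⟨h0, h1⟩ : (d 0 = 2 ∧ d 1 = 0) ∨ (d 0 = 1 ∧ d 1 = 1) ∨
          (d 0 = 0 ∧ d 1 = 2) := by omega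
      · exact ⟨c, 0, 0, fun x y => by rw [h, if_pos hd, h0, h1]; ring⟩
      · exact ⟨0, c, 0, fun x y => by rw [h, if_pos hd, h0, h1]; ring⟩
      · exact ⟨0, 0, c, fun x y => by rw [h, if_pos hd, h0, h1]; ring⟩
    · exact ⟨0, 0, 0, fun x y => by rw [h, if_neg hd]; ring⟩
  | add P Q hP hQ =>
    obtain ⟨A, B, C, hP⟩ := hP
    obtain ⟨A', B', C', hQ⟩ := hQ
    refine ⟨A + A', B + B', C + C', fun x y => ?_⟩
    have : homPart 2 (P + Q) x y = homPart 2 P x y + homPart 2 Q x y := by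
      simp only [homPart, map_add]
    rw [this, hP, hQ]; ring

theorem coords_reCLM : pCoord Complex.reCLM = 1 / 2 ∧ pbarCoord Complex.reCLM = 1 / 2 := by
  simp [pCoord, pbarCoord]

theorem coords_imCLM : pCoord Complex.imCLM = -Complex.I / 2 ∧ pbarCoord Complex.imCLM = Complex.I / 2 := by
  simp [pCoord, pbarCoord]

theorem coords_reCLM_add_imCLM : pCoord (Complex.reCLM + Complex.imCLM) = (1 - Complex.I) / 2 ∧
    pbarCoord (Complex.reCLM + Complex.imCLM) = (1 + Complex.I) / 2 := by
  simp [pCoord, pbarCoord]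

theorem contDiffAt_of_linear_relation {μ α β : ℂ → ℂ} {q : ℂ} (hα : ContDiffAt ℝ ∞ α q)
    (hβ : ContDiffAt ℝ ∞ β q) (h0 : β q ≠ 0) (h : ∀ᶠ q' in 𝓝 q, α q' + β q' * μ q' = 0) :
    ContDiffAt ℝ ∞ μ q := by
  refine (hα.neg.mul (hβ.inv h0)).congr_of_eventuallyEq ?_
  filter_upwards [h, hβ.continuousAt.eventually_ne h0] with q' h1 h2
  simp only [Pi.inv_apply]
  field_simp
  linear_combination h1

/-- Extending an element of the ideal at `a` to a smooth function and taking fibre jets gives a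
smoothly varying form of degree `k`. At each nearby point it is the leading form of an ideal
element, hence vanishes on the line of the slope there. -/
theorem HilbSection.exists_jet {m k : ℕ} (hk : k = 1 ∨ k = 2) (hkm : k + 1 ≤ m) (I : HilbSection m S)
    {μ : S → ℂ} (h : ∀ z, HasSlope k (I.ideal z) (μ z)) (a : S) {P : Poly} (hP : P ∈ I.ideal a) :
    ∃ G : Covec → ℂ → ℂ, (∀ η, ContDiffAt ℝ ∞ (G η) (chartAt ℂ a a)) ∧
      (∀ η, G η (chartAt ℂ a a) = homPart k P (pCoord η) (pbarCoord η)) ∧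
      ∀ z ∈ (chartAt ℂ a).source, ∃ Q : Poly, homPart k Q 1 (μ z) = 0 ∧ ∀ η, G η (chartAt ℂ a z) =
        homPart k Q (jac a z * pCoord η) ((starRingEnd ℂ) (jac a z) * pbarCoord η) := by
  obtain ⟨F, hF, hB, hA⟩ := I.smooth a P hP
  have hI : ∀ z, I.ideal z ≤ maxIdeal ^ k := fun z P hP => (mem_slopeIdeal.1 ((h z).le hP)).2
  have ta := mem_chart_target ℂ a
  have sa := mem_chart_source ℂ a
  refine ⟨fun η q => fibreJet k (fun y => F ((cotChart a).symm y)) q η, fun η =>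
    contDiffAt_fibreJet k (contDiffAt_fun_in_cotChart hF (y := (chartAt ℂ a a, 0)) ta) η,
    fun η => ?_, fun z hz => ?_⟩
  · have e : (chartAt ℂ a).symm (chartAt ℂ a a) = a := (chartAt ℂ a).left_inv sa
    have := AgreesAt.homPart_eq_fibreJet hk hkm hF hB hI ta (hI _ hP) (by rw [e]; exact hA) η
    rw [cotChart_symm_self, cov_covector] at this
    exact this.symm
  · obtain ⟨Q, hQ, hAQ⟩ := hB z
    refine ⟨Q, homPart_eq_zero_of_mem ((h z).le hQ), fun η => ?_⟩
    have e : (chartAt ℂ a).symm (chartAt ℂ a z) = z := (chartAt ℂ a).left_inv hz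
    have := AgreesAt.homPart_eq_fibreJet hk hkm hF hB hI ((chartAt ℂ a).map_source hz) (hI _ hQ)
      (by rw [e]; exact hAQ) η
    rw [(pCoord_symm hz η).1, (pCoord_symm hz η).2] at this
    exact this.symm

/-- For `k = 1` a smooth linear form `A x + B y` vanishing at `(1, μ)` gives `A + B μ = 0`. For `k =
2` there are two relations `A + B μ + C μ² = 0`, and eliminating the square leaves a linear one. In
both cases the coefficient of `μ` is `1` at the centre, so `μ` is a smooth quotient nearby. -/
theorem contDiffAt_slope {m k : ℕ} (hk : k = 1 ∨ k = 2) (hkm : k + 1 ≤ m) (I : HilbSection m S)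
    {μ : S → ℂ} (h : ∀ z, HasSlope k (I.ideal z) (μ z)) (a : S) :
    ContDiffAt ℝ ∞ (chartSlope μ a) (chartAt ℂ a a) := by
  have ev : ∀ {p : ℂ → Prop}, (∀ z ∈ (chartAt ℂ a).source, p (chartAt ℂ a z)) →
      ∀ᶠ q in 𝓝 (chartAt ℂ a a), p q := by
    intro p hp
    filter_upwards [(chartAt ℂ a).open_target.mem_nhds (mem_chart_target ℂ a)] with q hq
    have := hp _ ((chartAt ℂ a).map_target hq)
    rwa [(chartAt ℂ a).right_inv hq] at this
  rcases hk with rfl | rfl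
  · obtain ⟨P, hP, eP⟩ := (h a).gen 0 0 rfl
    obtain ⟨G, hG, hG0, hG1⟩ := I.exists_jet (Or.inl rfl) hkm h a hP
    -- The real and imaginary part covectors have coordinates `(1, 1) / 2` and `(-i, i) / 2`, so
    -- these combinations extract the coefficients of `p` and of `p̄`.
    refine contDiffAt_of_linear_relation
      (α := fun q => G Complex.reCLM q + Complex.I * G Complex.imCLM q)
      (β := fun q => G Complex.reCLM q - Complex.I * G Complex.imCLM q)
      ((hG _).add (contDiffAt_const.mul (hG _))) ((hG _).sub (contDiffAt_const.mul (hG _))) ?_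
      (ev fun z hz => ?_)
    · simp only [hG0, eP, coords_reCLM.1, coords_reCLM.2, coords_imCLM.1, coords_imCLM.2]
      refine ne_of_eq_of_ne (b := 1) ?_ one_ne_zero
      linear_combination (-(1 + μ a) / 2) * Complex.I_sq
    · obtain ⟨Q, hQ, e⟩ := hG1 z hz
      rw [chartSlope_apply μ hz]
      simp only [e, homPart_one, coords_reCLM.1, coords_reCLM.2, coords_imCLM.1, coords_imCLM.2] at hQ ⊢
      have hj' : (starRingEnd ℂ) (jac a z) ≠ 0 := by simpa using jac_ne_zero hz
      field_simp
      ring_nf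
      simp only [Complex.I_sq]
      linear_combination 2 * jac a z * (starRingEnd ℂ) (jac a z) * hQ
  · obtain ⟨P, hP, eP⟩ := (h a).gen 1 0 rfl
    obtain ⟨P', hP', eP'⟩ := (h a).gen 0 1 rfl
    obtain ⟨G, hG, hG0, hG1⟩ := I.exists_jet (Or.inr rfl) hkm h a hP
    obtain ⟨G', hG', hG0', hG1'⟩ := I.exists_jet (Or.inr rfl) hkm h a hP'
    -- Polarization: three real covectors determine the three coefficients of a quadratic form in
    -- `p, p̄`.
    have key : ∀ (A B C x y : ℂ) (G : Covec → ℂ), (∀ η, G η = A * (x * pCoord η) ^ 2 +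
        B * ((x * pCoord η) * (y * pbarCoord η)) + C * (y * pbarCoord η) ^ 2) →
        2 * (G Complex.reCLM + G Complex.imCLM) = B * (x * y) ∧
        (G Complex.reCLM - G Complex.imCLM) + Complex.I / 2 * (2 * G (Complex.reCLM + Complex.imCLM) -
          2 * (G Complex.reCLM + G Complex.imCLM)) = A * x ^ 2 ∧
        (G Complex.reCLM - G Complex.imCLM) - Complex.I / 2 * (2 * G (Complex.reCLM + Complex.imCLM) -
          2 * (G Complex.reCLM + G Complex.imCLM)) = C * y ^ 2 := by
      intro A B C x y G hG
      simp only [hG, coords_reCLM.1, coords_reCLM.2, coords_imCLM.1, coords_imCLM.2,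
        coords_reCLM_add_imCLM.1, coords_reCLM_add_imCLM.2]
      have i2 := Complex.I_sq
      refine ⟨?_, ?_, ?_⟩ <;> ring_nf <;> simp only [i2] <;> ring
    let B := fun (G : Covec → ℂ → ℂ) q => 2 * (G Complex.reCLM q + G Complex.imCLM q)
    let A := fun (G : Covec → ℂ → ℂ) q => (G Complex.reCLM q - G Complex.imCLM q) + Complex.I / 2 *
      (2 * G (Complex.reCLM + Complex.imCLM) q - 2 * (G Complex.reCLM q + G Complex.imCLM q))
    let C := fun (G : Covec → ℂ → ℂ) q => (G Complex.reCLM q - G Complex.imCLM q) - Complex.I / 2 *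
      (2 * G (Complex.reCLM + Complex.imCLM) q - 2 * (G Complex.reCLM q + G Complex.imCLM q))
    have smooth : ∀ {G : Covec → ℂ → ℂ}, (∀ η, ContDiffAt ℝ ∞ (G η) (chartAt ℂ a a)) →
        ContDiffAt ℝ ∞ (A G) (chartAt ℂ a a) ∧ ContDiffAt ℝ ∞ (B G) (chartAt ℂ a a) ∧
        ContDiffAt ℝ ∞ (C G) (chartAt ℂ a a) := by
      intro G hG
      have hB : ContDiffAt ℝ ∞ (B G) (chartAt ℂ a a) := contDiffAt_const.mul ((hG _).add (hG _))
      have hD : ContDiffAt ℝ ∞ (fun q => Complex.I / 2 *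
        (2 * G (Complex.reCLM + Complex.imCLM) q - 2 * (G Complex.reCLM q + G Complex.imCLM q)))
        (chartAt ℂ a a) := contDiffAt_const.mul ((contDiffAt_const.mul (hG _)).sub hB)
      exact ⟨((hG _).sub (hG _)).add hD, hB, ((hG _).sub (hG _)).sub hD⟩
    obtain ⟨sA, sB, sC⟩ := smooth hG
    obtain ⟨sA', sB', sC'⟩ := smooth hG'
    -- The two forms start as `x (y - μ x)` and `y (y - μ x)`, with `(B, C)` equal to `(1, 0)` and
    -- `(-μ, 1)`; hence `C' B - C B' = 1` at the centre.
    refine contDiffAt_of_linear_relation (α := fun q => C G' q * A G q - C G q * A G' q)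
      (β := fun q => C G' q * B G q - C G q * B G' q)
      ((sC'.mul sA).sub (sC.mul sA')) ((sC'.mul sB).sub (sC.mul sB')) ?_ (ev fun z hz => ?_)
    · obtain ⟨b1, -, c1⟩ := key (-μ a) 1 0 1 1 (fun η => G η (chartAt ℂ a a)) (fun η => by
        rw [hG0, eP]; ring)
      obtain ⟨b2, -, c2⟩ := key 0 (-μ a) 1 1 1 (fun η => G' η (chartAt ℂ a a)) (fun η => by
        rw [hG0', eP']; ring)
      simp only [B, C, b1, b2, c1, c2]
      simp
    · obtain ⟨Q, hQ, e⟩ := hG1 z hz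
      obtain ⟨Q', hQ', e'⟩ := hG1' z hz
      obtain ⟨A1, B1, C1, h1⟩ := exists_homPart_two Q
      obtain ⟨A2, B2, C2, h2⟩ := exists_homPart_two Q'
      rw [h1] at hQ
      rw [h2] at hQ'
      obtain ⟨b1, a1, c1⟩ := key A1 B1 C1 (jac a z) ((starRingEnd ℂ) (jac a z))
        (fun η => G η (chartAt ℂ a z)) (fun η => by rw [e, h1])
      obtain ⟨b2, a2, c2⟩ := key A2 B2 C2 (jac a z) ((starRingEnd ℂ) (jac a z))
        (fun η => G' η (chartAt ℂ a z)) (fun η => by rw [e', h2])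
      rw [chartSlope_apply μ hz]
      simp only [A, B, C, b1, b2, c1, c2, a1, a2]
      have hj' : (starRingEnd ℂ) (jac a z) ≠ 0 := by simpa using jac_ne_zero hz
      field_simp
      linear_combination (jac a z * (starRingEnd ℂ) (jac a z)) ^ 2 * (C2 * hQ - C1 * hQ')

end

/-! ### Slope ideals as a smooth family, and their behaviour under linear pullback. -/

section

variable {S : Type*} [TopologicalSpace S] [ChartedSpace ℂ S] [IsManifold 𝓘(ℂ) ω S]

theorem contDiffAt_eval {E : Type*} [NormedAddCommGroup E] [NormedSpace ℝ E] {f g : E → ℂ} {x : E}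
    (hf : ContDiffAt ℝ ∞ f x) (hg : ContDiffAt ℝ ∞ g x) (P : Poly) :
    ContDiffAt ℝ ∞ (fun x => MvPolynomial.eval ![f x, g x] P) x := by
  induction P using MvPolynomial.induction_on with
  | C c => simpa using contDiffAt_const
  | add P Q hP hQ => simpa using hP.add hQ
  | mul_X P i hP =>
    fin_cases i
    · simpa using hP.mul hf
    · simpa using hP.mul hg

theorem contDiff_pCoord : ContDiff ℝ ∞ pCoord := by
  have h : ∀ v : ℂ, ContDiff ℝ ∞ fun ξ : Covec => ((ξ v : ℝ) : ℂ) := fun v =>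
    Complex.ofRealCLM.contDiff.comp (contDiff_id.clm_apply contDiff_const)
  exact ((h 1).sub (contDiff_const.mul (h Complex.I))).div_const 2

theorem contDiff_pbarCoord : ContDiff ℝ ∞ pbarCoord := by
  have h : ∀ v : ℂ, ContDiff ℝ ∞ fun ξ : Covec => ((ξ v : ℝ) : ℂ) := fun v =>
    Complex.ofRealCLM.contDiff.comp (contDiff_id.clm_apply contDiff_const)
  exact ((h 1).add (contDiff_const.mul (h Complex.I))).div_const 2

theorem coords_cotChart {a : S} {z : S} (hz : z ∈ (chartAt ℂ a).source) (ξ : Covec) :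
    pCoord (cotChart a (covector z ξ)).2 = (jac a z)⁻¹ * pCoord ξ ∧
    pbarCoord (cotChart a (covector z ξ)).2 = ((starRingEnd ℂ) (jac a z))⁻¹ * pbarCoord ξ := by
  have h := pCoord_symm hz (cotChart a (covector z ξ)).2
  have e : (chartAt ℂ a z, (cotChart a (covector z ξ)).2) = cotChart a (covector z ξ) := by
    refine Prod.ext ?_ rfl
    rw [cotChart_apply (show (covector z ξ : Cotangent S).proj ∈ _ from hz)]
    rfl
  have hj := jac_ne_zero hz
  have hj' : (starRingEnd ℂ) (jac a z) ≠ 0 := by simpa using hj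
  rw [e, (cotChart a).left_inv (mem_cotChart_source.2 hz), cov_covector] at h
  rw [h.1, h.2]
  constructor <;> field_simp

/-- The section of the Hilbert scheme bundle given by the ideals of slope `μ`. -/
theorem slopeIdeal_smooth [T2Space S] (μ : Beltrami S) (k M m : ℕ) (a : S) {P : Poly}
    (hP : P ∈ slopeIdeal k M (μ.toFun a)) : ∃ F : Cotangent S → ℂ,
      ContMDiff IT 𝓘(ℝ, ℂ) ∞ F ∧ BelongsTo m (fun z => slopeIdeal k M (μ.toFun z)) F ∧ AgreesAt m F a P := by
  obtain ⟨χ⟩ : Nonempty (SmoothBumpFunction 𝓘(ℝ, ℂ) a) := inferInstance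
  let σ := chartSlope μ.toFun a
  -- Over a point with chart slope `σ` the shear `p̄ ↦ p̄ - (σ - μ(a)) p` moves the line of slope
  -- `σ` to that of slope `μ(a)`, so `P` pulls back into the slope ideal there. A bump function
  -- makes the extension global.
  let Γ : ℂ × Covec → ℂ := fun y => MvPolynomial.eval
    ![pCoord y.2, pbarCoord y.2 + (-(σ y.1 - μ.toFun a)) * pCoord y.2] P
  have sa := mem_chart_source ℂ a
  have hΓ : ∀ y : ℂ × Covec, y.1 ∈ (chartAt ℂ a).target → ContDiffAt ℝ ∞ Γ y := by
    intro y hy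
    have h1 : ContDiffAt ℝ ∞ (fun y : ℂ × Covec => pCoord y.2) y :=
      contDiff_pCoord.contDiffAt.comp y contDiffAt_snd
    have h2 : ContDiffAt ℝ ∞ (fun y : ℂ × Covec => pbarCoord y.2) y :=
      contDiff_pbarCoord.contDiffAt.comp y contDiffAt_snd
    have h3 : ContDiffAt ℝ ∞ (fun y : ℂ × Covec => σ y.1) y :=
      ContDiffAt.comp (g := σ) y (μ.contDiffAt_chartSlope hy) contDiffAt_fst
    exact contDiffAt_eval h1 (h2.add ((h3.sub contDiffAt_const).neg.mul h1)) P
  -- The sheared polynomial rewritten from the chart at `a` in the coordinates at `z`, where `p` and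
  -- `p̄` pick up conjugate factors.
  let Q : S → Poly := fun z => linSubst (jac a z)⁻¹ 0 (-(σ (chartAt ℂ a z) - μ.toFun a) * (jac a z)⁻¹)
    ((starRingEnd ℂ) (jac a z))⁻¹ P
  have hQ : ∀ z ∈ (chartAt ℂ a).source, ∀ ξ : Covec, Γ (cotChart a (covector z ξ)) = evalAt ξ (Q z) := by
    intro z hz ξ
    have e1 : (cotChart a (covector z ξ)).1 = chartAt ℂ a z := by
      rw [cotChart_apply (show (covector z ξ : Cotangent S).proj ∈ _ from hz)]; rfl
    simp only [Γ, Q, evalAt, eval_linSubst, e1, (coords_cotChart hz ξ).1, (coords_cotChart hz ξ).2]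
    congr 2
    ext i
    fin_cases i
    · simp
    · simp; ring
  have hQm : ∀ z ∈ (chartAt ℂ a).source, Q z ∈ slopeIdeal k M (μ.toFun z) := by
    intro z hz
    refine linSubst_mem_slopeIdeal (c := (jac a z)⁻¹) (by ring) ?_ hP
    have hj := jac_ne_zero hz
    have hj' : (starRingEnd ℂ) (jac a z) ≠ 0 := by simpa using hj
    simp only [σ, chartSlope_apply _ hz]
    field_simp
    ring
  refine ⟨fun x => (χ x.proj : ℂ) * Γ (cotChart a x), fun x => ?_, fun z => ?_, ?_⟩
  · by_cases hx : x.proj ∈ (chartAt ℂ a).source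
    · have h1 : ContMDiffAt IT 𝓘(ℝ, ℂ) ∞ (fun x : Cotangent S => (χ x.proj : ℂ)) x := by
        have h2 : ContMDiffAt IT 𝓘(ℝ, ℝ) ∞ (fun x : Cotangent S => χ x.proj) x :=
          χ.contMDiff.contMDiffAt.comp x (contMDiff_proj' x)
        exact ContMDiffAt.comp (I' := 𝓘(ℝ, ℝ)) (g := fun r : ℝ => (r : ℂ)) x
          (contMDiffAt_iff_contDiffAt.2 Complex.ofRealCLM.contDiff.contDiffAt) h2
      have h2 : ContMDiffAt IT 𝓘(ℝ, ℂ) ∞ (fun x : Cotangent S => Γ (cotChart a x)) x := by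
        refine ContMDiffAt.comp (I' := 𝓘(ℝ, ℂ × Covec)) (g := Γ) x (contMDiffAt_iff_contDiffAt.2 (hΓ _ ?_))
          (contMDiffAt_cotChart hx)
        exact mem_cotChart_target.1 ((cotChart a).map_source (mem_cotChart_source.2 hx))
      have h3 : ContMDiffAt 𝓘(ℝ, ℂ × ℂ) 𝓘(ℝ, ℂ) ∞ (fun w : ℂ × ℂ => w.1 * w.2)
          ((χ x.proj : ℂ), Γ (cotChart a x)) := contMDiffAt_iff_contDiffAt.2 contDiff_mul.contDiffAt
      exact ContMDiffAt.comp (g := fun w : ℂ × ℂ => w.1 * w.2) x h3 (h1.prodMk_space h2)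
    · have h1 : x.proj ∉ tsupport χ := fun h => hx (χ.tsupport_subset_chartAt_source h)
      have h2 : ∀ᶠ z in 𝓝 x.proj, χ z = 0 := by
        filter_upwards [(isClosed_tsupport χ).isOpen_compl.mem_nhds h1] with z hz
        exact image_eq_zero_of_notMem_tsupport hz
      refine (contMDiffAt_const (c := (0 : ℂ))).congr_of_eventuallyEq ?_
      filter_upwards [continuous_proj'.continuousAt.eventually h2] with x' hx'
      rw [hx']; simp
  · by_cases hz : z ∈ (chartAt ℂ a).source
    · refine ⟨MvPolynomial.C (χ z : ℂ) * Q z, Ideal.mul_mem_left _ _ (hQm z hz), ?_⟩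
      refine (Asymptotics.isBigO_zero _ _).congr_left fun ξ => ?_
      change 0 = (χ z : ℂ) * Γ (cotChart a (covector z ξ)) - _
      rw [hQ z hz, evalAt, evalAt]
      simp
    · refine ⟨0, zero_mem _, (Asymptotics.isBigO_zero _ _).congr_left fun ξ => ?_⟩
      change 0 = (χ z : ℂ) * Γ (cotChart a (covector z ξ)) - _
      have h1 : χ z = 0 := by
        refine image_eq_zero_of_notMem_tsupport fun h => hz (χ.tsupport_subset_chartAt_source h)
      rw [h1, evalAt]
      simp
  · refine (Asymptotics.isBigO_zero _ _).congr_left fun ξ => ?_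
    change 0 = (χ a : ℂ) * Γ (cotChart a (covector a ξ)) - _
    have h1 : χ a = 1 := χ.eq_one
    have h2 : σ (chartAt ℂ a a) = μ.toFun a := by
      simp only [σ]
      rw [chartSlope_apply _ sa, jac_self]; simp
    rw [h1, cotChart_covector_self]
    simp [Γ, h2, evalAt]

/-- The two real coordinate covectors separate the coefficients of `p` and `p̄` in the hypothesis.
The result is that the substitution sends `(1, μ')` to a multiple of `(1, μ)`. -/
theorem pullPoly_mem_slopeIdeal {k M : ℕ} {μ μ' : ℂ} {D : ℂ →L[ℝ] ℂ}
    (h : ∃ c : ℂ, ∀ ξ : Covec, vector01 μ (ξ.comp D) = c * vector01 μ' ξ) {P : Poly}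
    (hP : P ∈ slopeIdeal k M μ) : pullPoly D P ∈ slopeIdeal k M μ' := by
  obtain ⟨c, hc⟩ := h
  refine linSubst_mem_slopeIdeal rfl ?_ hP
  have h1 := hc Complex.reCLM
  have h2 := hc Complex.imCLM
  simp only [vector01, pCoord_comp, pbarCoord_comp, coords_reCLM.1, coords_reCLM.2, coords_imCLM.1,
    coords_imCLM.2] at h1 h2
  generalize (D 1 - Complex.I * D Complex.I) / 2 = α at *
  generalize ((starRingEnd ℂ) (D 1) - Complex.I * (starRingEnd ℂ) (D Complex.I)) / 2 = β at *
  generalize (D 1 + Complex.I * D Complex.I) / 2 = γ at *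
  generalize ((starRingEnd ℂ) (D 1) + Complex.I * (starRingEnd ℂ) (D Complex.I)) / 2 = δ at *
  have i2 := Complex.I_sq
  linear_combination (1 + μ') * h1 + Complex.I * (1 - μ') * h2 +
    ((γ - μ * α + c * μ') - (δ - μ * β - c)) * (1 - μ') / 2 * i2

theorem AgreesAt.pullPoly {m : ℕ} {F F' : Cotangent S → ℂ} {z z' : S} {P : Poly} (h : AgreesAt m F z P)
    {D : ℂ →L[ℝ] ℂ} (hF : ∀ ξ : Covec, F' (covector z' ξ) = F (covector z (ξ.comp D))) :
    AgreesAt m F' z' (pullPoly D P) := by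
  have ht : Filter.Tendsto (fun ξ : Covec => ξ.comp D) (𝓝 0) (𝓝 0) := by
    have : Continuous (fun ξ : Covec => ξ.comp D) := by fun_prop
    simpa using this.tendsto 0
  have h1 := h.comp_tendsto ht
  have h2 : (fun ξ : Covec => ‖ξ.comp D‖ ^ m) =O[𝓝 0] fun ξ : Covec => ‖ξ‖ ^ m := by
    refine Asymptotics.IsBigO.pow ?_ m
    refine Asymptotics.IsBigO.of_bound ‖D‖ (Filter.Eventually.of_forall fun ξ => ?_)
    rw [norm_norm, norm_norm, mul_comm]
    exact ContinuousLinearMap.opNorm_comp_le _ _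
  refine (h1.trans h2).congr_left fun ξ => ?_
  simp only [Function.comp, hF, evalAt_comp]

end

/-! ### Isotopies in charts; smoothness of the inverse isotopy. -/

section

/-- The inverse function theorem for `(t, q) ↦ (t, u (t, q))`: its derivative is block triangular,
so injectivity in the `q` direction is enough. -/
theorem exists_smooth_fibre_inverse {E : Type*} [NormedAddCommGroup E] [NormedSpace ℝ E]
    [FiniteDimensional ℝ E] {u : ℝ × E → E} {t : ℝ} {q : E} (hu : ContDiffAt ℝ ∞ u (t, q))
    (hinj : ∀ v, fderiv ℝ (fun q => u (t, q)) q v = 0 → v = 0) :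
    ∃ g : ℝ × E → E, ContDiffAt ℝ ∞ g (t, u (t, q)) ∧ g (t, u (t, q)) = q ∧
      ∀ᶠ y in 𝓝 (t, u (t, q)), u (y.1, g y) = y.2 := by
  have : CompleteSpace E := FiniteDimensional.complete ℝ E
  let U : ℝ × E → ℝ × E := fun p => (p.1, u p)
  have hU : ContDiffAt ℝ ∞ U (t, q) := contDiffAt_fst.prodMk hu
  have hd := (hU.differentiableAt (by simp)).hasFDerivAt
  have hud : DifferentiableAt ℝ u (t, q) := hu.differentiableAt (by simp)
  have e1 : ∀ w : ℝ × E, fderiv ℝ U (t, q) w = (w.1, fderiv ℝ u (t, q) w) := by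
    intro w
    have := hd.unique (hasFDerivAt_fst.prodMk hud.hasFDerivAt)
    rw [this]; rfl
  have e2 : ∀ v : E, fderiv ℝ (fun q => u (t, q)) q v = fderiv ℝ u (t, q) (0, v) := by
    intro v
    have : HasFDerivAt (fun q => u (t, q)) ((fderiv ℝ u (t, q)).comp
        ((0 : E →L[ℝ] ℝ).prod (ContinuousLinearMap.id ℝ E))) q :=
      HasFDerivAt.comp (f := fun q : E => (t, q)) q hud.hasFDerivAt
        ((hasFDerivAt_const t q).prodMk (hasFDerivAt_id q))
    rw [this.fderiv]; rfl
  have inj : Function.Injective (fderiv ℝ U (t, q) : ℝ × E →ₗ[ℝ] ℝ × E) := by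
    rw [← LinearMap.ker_eq_bot, LinearMap.ker_eq_bot']
    rintro ⟨τ, v⟩ h
    have h' : fderiv ℝ U (t, q) (τ, v) = 0 := h
    rw [e1, Prod.mk_eq_zero] at h'
    obtain ⟨h1, h2⟩ := h'
    dsimp only at h1
    subst h1
    rw [← e2] at h2
    rw [hinj v h2]; rfl
  let L : (ℝ × E) ≃L[ℝ] (ℝ × E) := (LinearEquiv.ofInjectiveEndo _ inj).toContinuousLinearEquiv
  have hL : HasFDerivAt U (L : ℝ × E →L[ℝ] ℝ × E) (t, q) := by
    convert! hd using 1
  have hn : (∞ : ℕ∞ω) ≠ 0 := by simp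
  let g := hU.localInverse hL hn
  have hg : ContDiffAt ℝ ∞ g (t, u (t, q)) := hU.to_localInverse hL hn
  have hr : ∀ᶠ y in 𝓝 (t, u (t, q)), U (g y) = y :=
    (hU.hasStrictFDerivAt' hL hn).eventually_right_inverse
  refine ⟨fun y => (g y).2, contDiffAt_snd.comp _ hg, congrArg Prod.snd (hU.localInverse_apply_image hL hn), ?_⟩
  filter_upwards [hr] with y hy
  have h1 : (U (g y)).1 = y.1 := by rw [hy]
  change (g y).1 = y.1 at h1
  have h2 : (U (g y)).2 = y.2 := by rw [hy]
  change u (g y) = y.2 at h2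
  rw [← h1]; exact h2

variable {S : Type*} [TopologicalSpace S] [ChartedSpace ℂ S] [IsManifold 𝓘(ℂ) ω S]

/-- The map `f` of the surface in the preferred charts at `a` and `b`. -/
def inCharts (f : S → S) (a b : S) (q : ℂ) : ℂ := chartAt ℂ b (f ((chartAt ℂ a).symm q))

theorem contMDiffAt_chart {a z : S} (hz : z ∈ (chartAt ℂ a).source) :
    ContMDiffAt 𝓘(ℝ, ℂ) 𝓘(ℝ, ℂ) ∞ (chartAt ℂ a) z :=
  (contMDiffOn_chart (I := 𝓘(ℝ, ℂ)) (n := ∞) (x := a)).contMDiffAt ((chartAt ℂ a).open_source.mem_nhds hz)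

theorem contMDiffAt_chart_symm {a : S} {q : ℂ} (hq : q ∈ (chartAt ℂ a).target) :
    ContMDiffAt 𝓘(ℝ, ℂ) 𝓘(ℝ, ℂ) ∞ (chartAt ℂ a).symm q :=
  (contMDiffOn_chart_symm (I := 𝓘(ℝ, ℂ)) (n := ∞) (x := a)).contMDiffAt
    ((chartAt ℂ a).open_target.mem_nhds hq)

theorem contDiffAt_inCharts_family {Ψ : ℝ → S → S}
    (hΨ : ContMDiff (𝓘(ℝ, ℝ).prod 𝓘(ℝ, ℂ)) 𝓘(ℝ, ℂ) ∞ (fun q : ℝ × S => Ψ q.1 q.2)) {a b : S} {t : ℝ}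
    {q : ℂ} (hq : q ∈ (chartAt ℂ a).target) (hb : Ψ t ((chartAt ℂ a).symm q) ∈ (chartAt ℂ b).source) :
    ContDiffAt ℝ ∞ (fun p : ℝ × ℂ => inCharts (Ψ p.1) a b p.2) (t, q) := by
  rw [← contMDiffAt_prod_self_iff]
  have h1 : ContMDiffAt (𝓘(ℝ, ℝ).prod 𝓘(ℝ, ℂ)) (𝓘(ℝ, ℝ).prod 𝓘(ℝ, ℂ)) ∞
      (fun p : ℝ × ℂ => (p.1, (chartAt ℂ a).symm p.2)) (t, q) :=
    contMDiffAt_fst.prodMk ((contMDiffAt_chart_symm hq).comp (t, q) contMDiffAt_snd)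
  have h2 : ContMDiffAt (𝓘(ℝ, ℝ).prod 𝓘(ℝ, ℂ)) 𝓘(ℝ, ℂ) ∞
      (fun p : ℝ × ℂ => Ψ p.1 ((chartAt ℂ a).symm p.2)) (t, q) :=
    ContMDiffAt.comp (g := fun q : ℝ × S => Ψ q.1 q.2) (t, q) hΨ.contMDiffAt h1
  exact ContMDiffAt.comp (g := chartAt ℂ b) (t, q) (contMDiffAt_chart hb) h2

theorem contDiffAt_inCharts (f : Diffeo S) {a b : S} {q : ℂ} (hq : q ∈ (chartAt ℂ a).target)
    (hb : f ((chartAt ℂ a).symm q) ∈ (chartAt ℂ b).source) : ContDiffAt ℝ ∞ (inCharts f a b) q := by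
  rw [← contMDiffAt_iff_contDiffAt]
  refine ContMDiffAt.comp (g := chartAt ℂ b) q (contMDiffAt_chart hb) ?_
  exact (f.contMDiff.contMDiffAt).comp q (contMDiffAt_chart_symm hq)

omit [IsManifold 𝓘(ℂ) ω S] in
theorem eventually_inCharts (f : Diffeo S) {a b : S} {q : ℂ} (hq : q ∈ (chartAt ℂ a).target)
    (hb : f ((chartAt ℂ a).symm q) ∈ (chartAt ℂ b).source) :
    ∀ᶠ q' in 𝓝 q, q' ∈ (chartAt ℂ a).target ∧ f ((chartAt ℂ a).symm q') ∈ (chartAt ℂ b).source := by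
  have h1 : ContinuousAt (fun q => f ((chartAt ℂ a).symm q)) q :=
    ContinuousAt.comp f.contMDiff.continuous.continuousAt ((chartAt ℂ a).continuousAt_symm hq)
  exact Filter.Eventually.and ((chartAt ℂ a).open_target.mem_nhds hq)
    (h1.eventually_mem ((chartAt ℂ b).open_source.mem_nhds hb))

theorem fderiv_inCharts_comp (f g : Diffeo S) {a b c z : S} (hz : z ∈ (chartAt ℂ a).source)
    (hb : f z ∈ (chartAt ℂ b).source) (hc : g (f z) ∈ (chartAt ℂ c).source) :
    (fderiv ℝ (inCharts g b c) (chartAt ℂ b (f z))).comp (fderiv ℝ (inCharts f a b) (chartAt ℂ a z)) =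
      fderiv ℝ (inCharts (fun z => g (f z)) a c) (chartAt ℂ a z) := by
  have e : (chartAt ℂ a).symm (chartAt ℂ a z) = z := (chartAt ℂ a).left_inv hz
  have e' : (chartAt ℂ b).symm (chartAt ℂ b (f z)) = f z := (chartAt ℂ b).left_inv hb
  have tz := (chartAt ℂ a).map_source hz
  have h : inCharts g b c ∘ inCharts f a b =ᶠ[𝓝 (chartAt ℂ a z)] inCharts (fun z => g (f z)) a c := by
    filter_upwards [eventually_inCharts f tz (by rwa [e])] with q' h'
    simp [inCharts, (chartAt ℂ b).left_inv h'.2]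
  have e2 : inCharts f a b (chartAt ℂ a z) = chartAt ℂ b (f z) := by rw [inCharts, e]
  rw [← h.fderiv_eq, fderiv_comp, e2]
  · rw [e2]
    exact (contDiffAt_inCharts g ((chartAt ℂ b).map_source hb) (by rwa [e'])).differentiableAt (by simp)
  · exact (contDiffAt_inCharts f tz (by rwa [e])).differentiableAt (by simp)

theorem differential_comp_transition (f : Diffeo S) {a b z : S} (hz : z ∈ (chartAt ℂ a).source)
    (hb : f z ∈ (chartAt ℂ b).source) :
    (differential f z).comp (fderiv ℝ (transition a z) (chartAt ℂ a z)) =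
      (fderiv ℝ (transition b (f z)) (chartAt ℂ b (f z))).comp (fderiv ℝ (inCharts f a b) (chartAt ℂ a z)) := by
  have h1 := fderiv_inCharts_comp (Diffeomorph.refl 𝓘(ℝ, ℂ) S ∞) f hz (mem_chart_source ℂ z)
    (mem_chart_source ℂ (f z))
  have h2 := fderiv_inCharts_comp f (Diffeomorph.refl 𝓘(ℝ, ℂ) S ∞) hz hb (mem_chart_source ℂ (f z))
  rw [differential_eq]
  exact h1.trans h2.symm

theorem differential_symm_comp (f : Diffeo S) (z : S) :
    (differential f.symm (f z)).comp (differential f z) = ContinuousLinearMap.id ℝ ℂ := by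
  have h := fderiv_inCharts_comp f f.symm (mem_chart_source ℂ z) (mem_chart_source ℂ (f z))
    (by rw [f.symm_apply_apply]; exact mem_chart_source ℂ z : f.symm (f z) ∈ (chartAt ℂ z).source)
  rw [differential_eq, differential_eq]
  have e : (fun z => f.symm (f z)) = id := funext fun z => f.symm_apply_apply z
  rw [e] at h
  rw [f.symm_apply_apply]
  exact h.trans (fderiv_transition_self z (mem_chart_target ℂ z))

theorem differential_comp_symm (f : Diffeo S) (z : S) :
    (differential f z).comp (differential f.symm (f z)) = ContinuousLinearMap.id ℝ ℂ := by
  have h := differential_symm_comp f.symm (f z)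
  rw [f.symm_apply_apply] at h
  exact h

/-- Smoothness of each inverse does not give joint smoothness in time. The latter comes from the
fibrewise inverse function theorem, whose local inverse coincides with the actual inverse because
chart and isotopy are injective. -/
theorem contMDiff_isotopy_symm {G : ℝ → Diffeo S}
    (hG : ContMDiff (𝓘(ℝ, ℝ).prod 𝓘(ℝ, ℂ)) 𝓘(ℝ, ℂ) ∞ (fun q : ℝ × S => G q.1 q.2)) :
    ContMDiff (𝓘(ℝ, ℝ).prod 𝓘(ℝ, ℂ)) 𝓘(ℝ, ℂ) ∞ (fun q : ℝ × S => (G q.1).symm q.2) := by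
  rintro ⟨t, w⟩
  obtain ⟨z, rfl⟩ : ∃ z, G t z = w := ⟨(G t).symm w, (G t).apply_symm_apply w⟩
  set b := G t z with hb
  have sz := mem_chart_source ℂ z
  have sb := mem_chart_source ℂ b
  have ez : (chartAt ℂ z).symm (chartAt ℂ z z) = z := (chartAt ℂ z).left_inv sz
  let u : ℝ × ℂ → ℂ := fun p => inCharts (G p.1) z b p.2
  have hu : ContDiffAt ℝ ∞ u (t, chartAt ℂ z z) :=
    contDiffAt_inCharts_family (Ψ := fun t z => G t z) hG (mem_chart_target ℂ z) (by rw [ez]; exact sb)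
  have u0 : u (t, chartAt ℂ z z) = chartAt ℂ b b := by simp only [u, inCharts, ez, hb]
  obtain ⟨g, hg, g0, gr⟩ := exists_smooth_fibre_inverse hu fun v hv => by
    have h := differential_symm_comp (G t) z
    have h' := congrArg (fun L => L v) h
    rw [differential_eq (G t) z] at h'
    have hv' : fderiv ℝ (fun q => chartAt ℂ (G t z) (G t ((chartAt ℂ z).symm q))) (chartAt ℂ z z) v = 0 := hv
    simp only [ContinuousLinearMap.comp_apply, hv', map_zero] at h'
    exact h'.symm
  rw [u0] at hg g0 gr
  have hκ : ContMDiffAt (𝓘(ℝ, ℝ).prod 𝓘(ℝ, ℂ)) (𝓘(ℝ, ℝ).prod 𝓘(ℝ, ℂ)) ∞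
      (fun p : ℝ × S => (p.1, chartAt ℂ b p.2)) (t, b) :=
    contMDiffAt_fst.prodMk ((contMDiffAt_chart sb).comp (t, b) contMDiffAt_snd)
  have hgM : ContMDiffAt (𝓘(ℝ, ℝ).prod 𝓘(ℝ, ℂ)) 𝓘(ℝ, ℂ) ∞ g (t, chartAt ℂ b b) :=
    contMDiffAt_prod_self_iff.2 hg
  have h1 : ContMDiffAt (𝓘(ℝ, ℝ).prod 𝓘(ℝ, ℂ)) 𝓘(ℝ, ℂ) ∞
      (fun p : ℝ × S => g (p.1, chartAt ℂ b p.2)) (t, b) := ContMDiffAt.comp (t, b) hgM hκ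
  have h2 : ContMDiffAt (𝓘(ℝ, ℝ).prod 𝓘(ℝ, ℂ)) 𝓘(ℝ, ℂ) ∞
      (fun p : ℝ × S => (chartAt ℂ z).symm (g (p.1, chartAt ℂ b p.2))) (t, b) := by
    refine ContMDiffAt.comp (g := (chartAt ℂ z).symm) (t, b) (contMDiffAt_chart_symm ?_) h1
    rw [g0]; exact mem_chart_target ℂ z
  refine h2.congr_of_eventuallyEq ?_
  have hcont := hκ.continuousAt
  have ev1 := hcont.eventually gr
  have ev2 : ∀ᶠ p : ℝ × S in 𝓝 (t, b), p.2 ∈ (chartAt ℂ b).source :=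
    continuous_snd.continuousAt.eventually_mem ((chartAt ℂ b).open_source.mem_nhds sb)
  have ev3 : ∀ᶠ p : ℝ × S in 𝓝 (t, b), G p.1 ((chartAt ℂ z).symm (g (p.1, chartAt ℂ b p.2))) ∈
      (chartAt ℂ b).source := by
    have c : ContinuousAt (fun p : ℝ × S => G p.1 ((chartAt ℂ z).symm (g (p.1, chartAt ℂ b p.2)))) (t, b) :=
      ContinuousAt.comp (g := fun q : ℝ × S => G q.1 q.2) hG.continuous.continuousAt
        (continuousAt_fst.prodMk h2.continuousAt)
    refine c.eventually_mem ((chartAt ℂ b).open_source.mem_nhds ?_)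
    simp only [g0, ez]
    exact sb
  filter_upwards [ev1, ev2, ev3] with p p1 p2 p3
  have := (chartAt ℂ b).injOn p3 p2 p1
  rw [← this, (G p.1).symm_apply_apply, this]

end

/-! ### The cotangent lift of a diffeomorphism. -/

section

theorem contDiffAt_pullback_family {E V : Type*} [NormedAddCommGroup E] [NormedSpace ℝ E]
    [NormedAddCommGroup V] [NormedSpace ℝ V] {v u : ℝ × E → E} {t : ℝ} {q : E} (η : E →L[ℝ] V)
    (hv : ContDiffAt ℝ ∞ v (t, u (t, q))) (hu : ContDiffAt ℝ ∞ u (t, q)) :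
    ContDiffAt ℝ ∞ (fun p : ℝ × (E × (E →L[ℝ] V)) =>
      p.2.2.comp (fderiv ℝ (fun q' => v (p.1, q')) (u (p.1, p.2.1)))) (t, (q, η)) := by
  have h1 : ContDiffAt ℝ ∞ (fun p : ℝ × (E × (E →L[ℝ] V)) => (p.1, p.2.1)) (t, (q, η)) :=
    contDiffAt_fst.prodMk (contDiffAt_fst.comp _ contDiffAt_snd)
  have h2 : ContDiffAt ℝ ∞ (fun p : ℝ × (E × (E →L[ℝ] V)) => u (p.1, p.2.1)) (t, (q, η)) :=
    ContDiffAt.comp (g := u) _ hu h1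
  have h3 : ContDiffAt ℝ ∞ (Function.uncurry fun (p : ℝ × (E × (E →L[ℝ] V))) (q' : E) => v (p.1, q'))
      ((t, (q, η)), u (t, q)) := by
    refine ContDiffAt.comp (g := v) _ hv ?_
    exact (contDiffAt_fst.comp _ contDiffAt_fst).prodMk contDiffAt_snd
  have h4 := ContDiffAt.fderiv (m := ∞) h3 h2 (by simp)
  exact (contDiffAt_snd.comp _ contDiffAt_snd).clm_comp h4

variable {S : Type*} [TopologicalSpace S] [ChartedSpace ℂ S] [IsManifold 𝓘(ℂ) ω S]

theorem trivializationAt_cotangent (x y : Cotangent S) :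
    (trivializationAt Covec (fun z : S => TangentSpace 𝓘(ℝ, ℂ) z →L[ℝ] Trivial S ℝ z) x.proj y).2 =
      (cotChart x.proj y).2 := by
  rw [cotChart, FiberBundle.extChartAt]
  rfl

theorem contMDiffAt_cotangent_iff {E H N : Type*} [NormedAddCommGroup E] [NormedSpace ℝ E]
    [TopologicalSpace H] {J : ModelWithCorners ℝ E H} [TopologicalSpace N] [ChartedSpace H N]
    {F : N → Cotangent S} {n : N} :
    ContMDiffAt J IT ∞ F n ↔ ContMDiffAt J 𝓘(ℝ, ℂ) ∞ (fun x => (F x).proj) n ∧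
      ContMDiffAt J 𝓘(ℝ, Covec) ∞ (fun x => (cotChart (F n).proj (F x)).2) n := by
  have h := contMDiffAt_totalSpace (IM := J) (IB := 𝓘(ℝ, ℂ)) (n := ∞) (F := Covec)
    (E := fun z : S => TangentSpace 𝓘(ℝ, ℂ) z →L[ℝ] Trivial S ℝ z) (f := F) (x₀ := n)
  simp only [trivializationAt_cotangent] at h
  exact h

/-- The action of a diffeomorphism of the surface on covectors. -/
def cotangentMap (f : Diffeo S) (x : Cotangent S) : Cotangent S :=
  covector (f x.proj) ((cov x).comp (differential f.symm (f x.proj)))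

theorem cotangentMap_covector (f : Diffeo S) (z : S) (ξ : Covec) :
    cotangentMap f (covector z ξ) = covector (f z) (ξ.comp (differential f.symm (f z))) := rfl

theorem cotangentMap_symm (f : Diffeo S) (x : Cotangent S) :
    cotangentMap f.symm (cotangentMap f x) = x := by
  change covector (f.symm (f x.proj)) (((cov x).comp (differential f.symm (f x.proj))).comp
    (differential f (f.symm (f x.proj)))) = x
  rw [f.symm_apply_apply, ContinuousLinearMap.comp_assoc, differential_symm_comp,
    ContinuousLinearMap.comp_id]
  exact covector_proj_cov x

theorem cotChart_cotangentMap (f : Diffeo S) {a b : S} {x : Cotangent S}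
    (ha : x.proj ∈ (chartAt ℂ a).source) (hb : f x.proj ∈ (chartAt ℂ b).source) :
    (cotChart b (cotangentMap f x)).2 =
      (cotChart a x).2.comp (fderiv ℝ (inCharts f.symm b a) (inCharts f a b (cotChart a x).1)) := by
  have e1 : (cotChart a x).1 = chartAt ℂ a x.proj := by rw [cotChart_apply ha]
  have e2 : inCharts f a b (chartAt ℂ a x.proj) = chartAt ℂ b (f x.proj) := by
    rw [inCharts, (chartAt ℂ a).left_inv ha]
  have h := differential_comp_transition f.symm (a := b) (b := a) hb
    (by rw [f.symm_apply_apply]; exact ha)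
  rw [f.symm_apply_apply] at h
  rw [e1, e2, cotChart_apply (show (cotangentMap f x).proj ∈ _ from hb), cotChart_apply ha]
  change ((cov x).comp (differential f.symm (f x.proj))).comp
    (fderiv ℝ (transition b (f x.proj)) (chartAt ℂ b (f x.proj))) = _
  rw [ContinuousLinearMap.comp_assoc, h, ContinuousLinearMap.comp_assoc]

theorem contMDiff_cotangentMap_family {G : ℝ → Diffeo S}
    (hG : ContMDiff (𝓘(ℝ, ℝ).prod 𝓘(ℝ, ℂ)) 𝓘(ℝ, ℂ) ∞ (fun q : ℝ × S => G q.1 q.2))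
    (hG' : ContMDiff (𝓘(ℝ, ℝ).prod 𝓘(ℝ, ℂ)) 𝓘(ℝ, ℂ) ∞ (fun q : ℝ × S => (G q.1).symm q.2)) :
    ContMDiff (𝓘(ℝ, ℝ).prod IT) IT ∞ (fun q : ℝ × Cotangent S => cotangentMap (G q.1) q.2) := by
  rintro ⟨t, x⟩
  rw [contMDiffAt_cotangent_iff]
  have hproj : ContMDiff (𝓘(ℝ, ℝ).prod IT) 𝓘(ℝ, ℂ) ∞ (fun q : ℝ × Cotangent S => G q.1 q.2.proj) := by
    have h1 : ContMDiff (𝓘(ℝ, ℝ).prod IT) (𝓘(ℝ, ℝ).prod 𝓘(ℝ, ℂ)) ∞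
        (fun q : ℝ × Cotangent S => (q.1, q.2.proj)) :=
      contMDiff_fst.prodMk (contMDiff_proj'.comp contMDiff_snd)
    exact hG.comp h1
  refine ⟨hproj (t, x), ?_⟩
  set a := x.proj with ha
  set b := G t a with hb
  have sa : x.proj ∈ (chartAt ℂ a).source := mem_chart_source ℂ _
  have ta := (chartAt ℂ a).map_source sa
  have sb : G t x.proj ∈ (chartAt ℂ b).source := mem_chart_source ℂ _
  have tb := (chartAt ℂ b).map_source sb
  have ea : (chartAt ℂ a).symm (chartAt ℂ a x.proj) = x.proj := (chartAt ℂ a).left_inv sa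
  have eb : (chartAt ℂ b).symm (chartAt ℂ b (G t x.proj)) = G t x.proj := (chartAt ℂ b).left_inv sb
  have e1 : (cotChart a x).1 = chartAt ℂ a x.proj := by rw [cotChart_apply sa]
  have e2 : inCharts (G t) a b (chartAt ℂ a x.proj) = chartAt ℂ b (G t x.proj) := by
    rw [inCharts, ea]
  have hu := contDiffAt_inCharts_family (Ψ := fun t z => G t z) hG (t := t) (b := b) ta (by rw [ea]; exact sb)
  have hv := contDiffAt_inCharts_family (Ψ := fun t z => (G t).symm z) hG' (t := t) (b := a) tb (by
    rw [eb, (G t).symm_apply_apply]; exact sa)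
  have hK := contDiffAt_pullback_family (u := fun p : ℝ × ℂ => inCharts (G p.1) a b p.2)
    (v := fun p : ℝ × ℂ => inCharts (G p.1).symm b a p.2) (cotChart a x).2 (t := t)
    (q := chartAt ℂ a x.proj) (by simp only [e2]; exact hv) hu
  have e3 : (chartAt ℂ a x.proj, (cotChart a x).2) = cotChart a x := Prod.ext e1.symm rfl
  rw [e3] at hK
  have hκ : ContMDiffAt (𝓘(ℝ, ℝ).prod IT) (𝓘(ℝ, ℝ).prod 𝓘(ℝ, ℂ × Covec)) ∞
      (fun p : ℝ × Cotangent S => (p.1, cotChart a p.2)) (t, x) :=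
    contMDiffAt_fst.prodMk ((contMDiffAt_cotChart sa).comp (t, x) contMDiffAt_snd)
  have hKM := contMDiffAt_prod_self_iff.2 hK
  refine (ContMDiffAt.comp (t, x) hKM hκ).congr_of_eventuallyEq ?_
  have ev1 : ∀ᶠ q : ℝ × Cotangent S in 𝓝 (t, x), q.2.proj ∈ (chartAt ℂ a).source :=
    (continuous_proj'.comp continuous_snd).continuousAt.eventually_mem ((chartAt ℂ a).open_source.mem_nhds sa)
  have ev2 : ∀ᶠ q : ℝ × Cotangent S in 𝓝 (t, x), G q.1 q.2.proj ∈ (chartAt ℂ b).source :=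
    hproj.continuous.continuousAt.eventually_mem ((chartAt ℂ b).open_source.mem_nhds sb)
  filter_upwards [ev1, ev2] with q h1 h2
  exact cotChart_cotangentMap (G q.1) h1 h2

theorem contMDiff_cotangentMap (f : Diffeo S) : ContMDiff IT IT ∞ (cotangentMap f) := by
  have h := contMDiff_cotangentMap_family (G := fun _ => f) (f.contMDiff.comp contMDiff_snd)
    (f.symm.contMDiff.comp contMDiff_snd)
  have h1 : ContMDiff IT (𝓘(ℝ, ℝ).prod IT) ∞ (fun x : Cotangent S => ((0 : ℝ), x)) :=
    contMDiff_const.prodMk contMDiff_id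
  exact h.comp h1

/-- The lift of a diffeomorphism of the surface to the cotangent bundle. -/
def cotangentDiffeo (f : Diffeo S) : Diffeomorph IT IT (Cotangent S) (Cotangent S) ∞ where
  toFun := cotangentMap f
  invFun := cotangentMap f.symm
  left_inv := cotangentMap_symm f
  right_inv := cotangentMap_symm f.symm
  contMDiff_toFun := contMDiff_cotangentMap f
  contMDiff_invFun := contMDiff_cotangentMap f.symm

theorem identifies_symm {f : Diffeo S} {μ μ' : Beltrami S} (h : Identifies f μ μ') (z : S) :
    ∃ c : ℂ, ∀ ξ : Covec, vector01 (μ'.toFun (f z)) (ξ.comp (differential f.symm (f z))) =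
      c * vector01 (μ.toFun z) ξ := by
  obtain ⟨c, hc⟩ := h z
  have key : ∀ ξ : Covec, vector01 (μ.toFun z) ξ =
      c * vector01 (μ'.toFun (f z)) (ξ.comp (differential f.symm (f z))) := by
    intro ξ
    rw [← hc, ContinuousLinearMap.comp_assoc, differential_symm_comp, ContinuousLinearMap.comp_id]
  -- Otherwise `p̄ - μ p` would vanish on all real covectors, whereas its values on the two
  -- coordinate covectors exclude this.
  have hc0 : c ≠ 0 := by
    rintro rfl
    have h1 := key Complex.reCLM
    have h2 := key Complex.imCLM
    simp only [vector01, coords_reCLM.1, coords_reCLM.2, coords_imCLM.1, coords_imCLM.2, zero_mul] at h1 h2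
    have : (1 : ℂ) = 0 := by
      linear_combination h1 - Complex.I * h2 + (1 / 2 + μ.toFun z / 2) * Complex.I_sq
    exact one_ne_zero this
  refine ⟨c⁻¹, fun ξ => ?_⟩
  rw [key ξ]
  field_simp

/-- The lift is linear in the fibres, so it acts on jets by a linear substitution in `p, p̄` without
mixing degrees. The substitution and its inverse exchange the lines of the two slopes, hence the
slope ideals. -/
theorem carries_cotangentDiffeo {k M m : ℕ} {f : Diffeo S} {μ μ' : Beltrami S} (h : Identifies f μ μ')
    {I J : HilbSection m S} (hI : ∀ z, I.ideal z = slopeIdeal k M (μ.toFun z))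
    (hJ : ∀ z, J.ideal z = slopeIdeal k M (μ'.toFun z)) : Carries (cotangentDiffeo f) I J := by
  intro F _
  constructor
  · intro hF z
    obtain ⟨P, hP, hA⟩ := hF (f z)
    rw [hJ] at hP
    refine ⟨pullPoly (differential f.symm (f z)) P, ?_, hA.pullPoly fun ξ => rfl⟩
    rw [hI]
    exact pullPoly_mem_slopeIdeal (identifies_symm h z) hP
  · intro hF w
    obtain ⟨z, rfl⟩ : ∃ z, f z = w := ⟨f.symm w, f.apply_symm_apply w⟩
    obtain ⟨P, hP, hA⟩ := hF z
    rw [hI] at hP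
    refine ⟨pullPoly (differential f z) P, ?_, hA.pullPoly fun ξ => ?_⟩
    · rw [hJ]
      exact pullPoly_mem_slopeIdeal (h z) hP
    · change F (covector (f z) ξ) = F (cotangentMap f (covector z (ξ.comp (differential f z))))
      rw [cotangentMap_covector, ContinuousLinearMap.comp_assoc, differential_comp_symm,
        ContinuousLinearMap.comp_id]

end

/-! ### Hamilton's equations for a lifted flow in a vector space. -/

section

theorem deriv_partial {E F : Type*} [NormedAddCommGroup E] [NormedSpace ℝ E] [NormedAddCommGroup F]
    [NormedSpace ℝ F] {u : ℝ × E → F} {t : ℝ} {q : E} (hu : DifferentiableAt ℝ u (t, q)) :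
    HasDerivAt (fun s => u (s, q)) (fderiv ℝ u (t, q) (1, 0)) t :=
  HasFDerivAt.comp_hasDerivAt (f := fun s : ℝ => (s, q)) t hu.hasFDerivAt
    ((hasDerivAt_id t).prodMk (hasDerivAt_const t q))

/-- Hamilton's equations for the cotangent lift of a flow. -/
theorem hamilton_of_lift {E : Type*} [NormedAddCommGroup E] [NormedSpace ℝ E] {u v : ℝ × E → E}
    {t : ℝ} {q : E} (ξ : E →L[ℝ] ℝ) (hu : ContDiffAt ℝ ∞ u (t, q)) (hv : ContDiffAt ℝ ∞ v (t, u (t, q)))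
    (hvu : ∀ᶠ p in 𝓝 (t, q), v (p.1, u p) = p.2)
    (huv : ∀ᶠ p in 𝓝 (t, u (t, q)), u (p.1, v p) = p.2) (w : E × (E →L[ℝ] ℝ)) :
    let γ : ℝ → E × (E →L[ℝ] ℝ) := fun s => (u (s, q), ξ.comp (fderiv ℝ (fun q' => v (s, q')) (u (s, q))))
    fderiv ℝ (fun y : E × (E →L[ℝ] ℝ) => y.2 (deriv (fun s => u (s, v (t, y.1))) t)) (γ t) w =
      w.2 (deriv γ t).1 - (deriv γ t).2 w.1 := by
  intro γ
  have hvq : v (t, u (t, q)) = q := hvu.self_of_nhds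
  set r := u (t, q) with hr
  have hu1 : DifferentiableAt ℝ u (t, q) := hu.differentiableAt (by simp)
  have hv1 : DifferentiableAt ℝ v (t, r) := hv.differentiableAt (by simp)
  have hu2 : DifferentiableAt ℝ (fderiv ℝ u) (t, q) :=
    ((hu.of_le two_le_infty).fderiv_right (m := 1) (by norm_num)).differentiableAt (by simp)
  have evu : ∀ᶠ p in 𝓝 (t, q), DifferentiableAt ℝ u p := by
    have := (hu.of_le two_le_infty).eventually (by simp)
    exact this.mono fun y hy => hy.differentiableAt (by simp)
  have evv : ∀ᶠ p in 𝓝 (t, r), DifferentiableAt ℝ v p := by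
    have := (hv.of_le two_le_infty).eventually (by simp)
    exact this.mono fun y hy => hy.differentiableAt (by simp)
  -- the velocity field
  set Y : E → E := fun q' => deriv (fun s => u (s, v (t, q'))) t with hY
  have cv : ContinuousAt (fun q' => (t, v (t, q'))) r :=
    continuousAt_const.prodMk (ContinuousAt.comp (g := v) (f := fun q' => (t, q')) hv1.continuousAt (by fun_prop))
  have cv' : Filter.Tendsto (fun q' => (t, v (t, q'))) (𝓝 r) (𝓝 (t, q)) := by
    have := cv.tendsto
    rwa [hvq] at this
  have eY : Y =ᶠ[𝓝 r] fun q' => fderiv ℝ u (t, v (t, q')) (1, 0) := by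
    filter_upwards [cv'.eventually evu] with q' h
    exact (deriv_partial h).deriv
  have dY : DifferentiableAt ℝ Y r := by
    refine DifferentiableAt.congr_of_eventuallyEq ?_ eY
    have h1 : DifferentiableAt ℝ (fun q' => (t, v (t, q'))) r :=
      (differentiableAt_const t).prodMk (DifferentiableAt.comp (g := v) (f := fun q' => (t, q')) r hv1
        ((differentiableAt_const t).prodMk differentiableAt_id))
    have h2 : DifferentiableAt ℝ (fderiv ℝ u) (t, v (t, r)) := by rw [hvq]; exact hu2
    exact (DifferentiableAt.comp (g := fderiv ℝ u) (f := fun q' => (t, v (t, q'))) r h2 h1).clm_apply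
      (differentiableAt_const _)
  have Yr : Y r = fderiv ℝ u (t, q) (1, 0) := by
    have := eY.self_of_nhds
    simp only [hvq] at this
    exact this
  -- the curve
  have hη : ContDiffAt ℝ ∞ (fun s : ℝ => ξ.comp (fderiv ℝ (fun q' => v (s, q')) (u (s, q)))) t :=
    ContDiffAt.comp (f := fun s : ℝ => (s, (q, ξ))) t (contDiffAt_pullback_family ξ hv hu)
      (contDiffAt_id.prodMk contDiffAt_const)
  set η : ℝ → (E →L[ℝ] ℝ) := fun s => ξ.comp (fderiv ℝ (fun q' => v (s, q')) (u (s, q))) with hηdef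
  have hη1 : HasDerivAt η (deriv η t) t := (hη.differentiableAt (by simp)).hasDerivAt
  have hγ : HasDerivAt γ (Y r, deriv η t) t := by
    rw [Yr]; exact (deriv_partial hu1).prodMk hη1
  rw [hγ.deriv]
  -- conservation of the covector
  let A : ℝ → E →L[ℝ] E := fun s => (fderiv ℝ u (s, q)).comp ((0 : E →L[ℝ] ℝ).prod (ContinuousLinearMap.id ℝ E))
  have cs : Filter.Tendsto (fun s : ℝ => (s, q)) (𝓝 t) (𝓝 (t, q)) :=
    (show ContinuousAt (fun s : ℝ => (s, q)) t by fun_prop)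
  have cons : (fun s => (η s).comp (A s)) =ᶠ[𝓝 t] fun _ => ξ := by
    have cs2 : Filter.Tendsto (fun s : ℝ => (s, u (s, q))) (𝓝 t) (𝓝 (t, r)) :=
      continuousAt_id.prodMk (deriv_partial hu1).continuousAt
    filter_upwards [cs.eventually hvu.eventually_nhds, cs.eventually evu, cs2.eventually evv] with s h1 h2 h3
    have h4 : ∀ᶠ q' in 𝓝 q, v (s, u (s, q')) = q' := by
      have : Filter.Tendsto (fun q' : E => (s, q')) (𝓝 q) (𝓝 (s, q)) :=
        (show ContinuousAt (fun q' : E => (s, q')) q by fun_prop)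
      exact this.eventually h1
    have d1 : HasFDerivAt (fun q' => u (s, q')) (A s) q :=
      HasFDerivAt.comp (f := fun q : E => (s, q)) q h2.hasFDerivAt
        ((hasFDerivAt_const s q).prodMk (hasFDerivAt_id q))
    have d2 : DifferentiableAt ℝ (fun q' => v (s, q')) (u (s, q)) :=
      DifferentiableAt.comp (g := v) (f := fun q' => (s, q')) (u (s, q)) h3
        ((differentiableAt_const s).prodMk differentiableAt_id)
    have d3 : HasFDerivAt (fun q' => v (s, u (s, q')))
        ((fderiv ℝ (fun q' => v (s, q')) (u (s, q))).comp (A s)) q :=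
      HasFDerivAt.comp (g := fun q' => v (s, q')) (f := fun q' => u (s, q')) q d2.hasFDerivAt d1
    have d4 := d3.unique ((hasFDerivAt_id q).congr_of_eventuallyEq h4)
    rw [hηdef]
    change (ξ.comp _).comp (A s) = ξ
    rw [ContinuousLinearMap.comp_assoc, d4, ContinuousLinearMap.comp_id]
  have hA : HasDerivAt A ((fderiv ℝ (fderiv ℝ u) (t, q) (1, 0)).comp
      ((0 : E →L[ℝ] ℝ).prod (ContinuousLinearMap.id ℝ E))) t := by
    have h1 : HasDerivAt (fun s => fderiv ℝ u (s, q)) (fderiv ℝ (fderiv ℝ u) (t, q) (1, 0)) t :=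
      deriv_partial hu2
    have := h1.clm_comp (hasDerivAt_const t ((0 : E →L[ℝ] ℝ).prod (ContinuousLinearMap.id ℝ E)))
    simpa using this
  have rel := (hη1.clm_comp hA).unique ((hasDerivAt_const t ξ).congr_of_eventuallyEq cons)
  -- the derivative of the velocity field along the flow
  have hsymm : IsSymmSndFDerivAt ℝ u (t, q) := (hu.of_le two_le_infty).isSymmSndFDerivAt (by simp)
  have tq : Filter.Tendsto (fun q' : E => (t, q')) (𝓝 q) (𝓝 (t, q)) :=
    (show ContinuousAt (fun q' : E => (t, q')) q by fun_prop)
  have hAt : HasFDerivAt (fun q' => u (t, q')) (A t) q :=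
    HasFDerivAt.comp (f := fun q : E => (t, q)) q hu1.hasFDerivAt
      ((hasFDerivAt_const t q).prodMk (hasFDerivAt_id q))
  have YA : (fderiv ℝ Y r).comp (A t) = (fderiv ℝ (fderiv ℝ u) (t, q) (1, 0)).comp
      ((0 : E →L[ℝ] ℝ).prod (ContinuousLinearMap.id ℝ E)) := by
    have h1 : HasFDerivAt (fun q' => Y (u (t, q'))) ((fderiv ℝ Y r).comp (A t)) q :=
      HasFDerivAt.comp (g := Y) (f := fun q' => u (t, q')) q dY.hasFDerivAt hAt
    have h2 : (fun q' => Y (u (t, q'))) =ᶠ[𝓝 q] fun q' => fderiv ℝ u (t, q') (1, 0) := by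
      have c : Filter.Tendsto (fun q' => u (t, q')) (𝓝 q) (𝓝 r) := hAt.continuousAt
      filter_upwards [c.eventually eY, tq.eventually hvu] with q' g1 g2
      rw [g1, g2]
    have h3 : HasFDerivAt (fun q' => fderiv ℝ u (t, q')) ((fderiv ℝ (fderiv ℝ u) (t, q)).comp
        ((0 : E →L[ℝ] ℝ).prod (ContinuousLinearMap.id ℝ E))) q :=
      HasFDerivAt.comp (f := fun q : E => (t, q)) q hu2.hasFDerivAt
        ((hasFDerivAt_const t q).prodMk (hasFDerivAt_id q))
    have h4 := h3.clm_apply (hasFDerivAt_const ((1 : ℝ), (0 : E)) q)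
    have h5 := h1.unique (h4.congr_of_eventuallyEq h2)
    rw [h5]
    ext e
    simp
    exact hsymm.eq _ _
  -- surjectivity of the derivative of the flow
  have surj : ∀ e, ∃ e', A t e' = e := by
    intro e
    have d2 : HasFDerivAt (fun q' => v (t, q')) (fderiv ℝ (fun q' => v (t, q')) r) r :=
      (DifferentiableAt.comp (g := v) (f := fun q' => (t, q')) r hv1
        ((differentiableAt_const t).prodMk differentiableAt_id)).hasFDerivAt
    have hAt' : HasFDerivAt (fun q' => u (t, q')) (A t) (v (t, r)) := by rw [hvq]; exact hAt
    have d3 : HasFDerivAt (fun q' => u (t, v (t, q'))) ((A t).comp (fderiv ℝ (fun q' => v (t, q')) r)) r :=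
      HasFDerivAt.comp (g := fun q' => u (t, q')) (f := fun q' => v (t, q')) r hAt' d2
    have tr : Filter.Tendsto (fun q' : E => (t, q')) (𝓝 r) (𝓝 (t, r)) :=
      (show ContinuousAt (fun q' : E => (t, q')) r by fun_prop)
    have d4 := d3.unique ((hasFDerivAt_id r).congr_of_eventuallyEq (tr.eventually huv))
    exact ⟨_, congrArg (fun L => L e) d4⟩
  have hK : HasFDerivAt (fun y : E × (E →L[ℝ] ℝ) => y.2 (Y y.1)) _ (γ t) :=
    HasFDerivAt.clm_apply hasFDerivAt_snd (HasFDerivAt.comp (g := Y) (γ t) dY.hasFDerivAt hasFDerivAt_fst)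
  rw [hK.fderiv]
  obtain ⟨e, he⟩ := surj w.1
  -- Since `η ∘ A` is constant and `A' = DY ∘ A`, differentiation gives `η' ∘ A = -η ∘ DY ∘ A`.
  -- Choosing `A t e` to be the base component of `w` yields the equation for the covector
  -- component.
  have rel' := congrArg (fun L => L e) rel
  rw [← YA] at rel'
  simp [he] at rel'
  simp [γ]
  have e3 : η t (fderiv ℝ Y r w.1) = ξ (fderiv ℝ (fun q' => v (t, q')) r (fderiv ℝ Y r w.1)) := rfl
  rw [← hr]
  linarith

end

/-! ### Lifts of isotopies as Hamiltonian flows. -/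

section

variable {S : Type*} [TopologicalSpace S] [ChartedSpace ℂ S] [IsManifold 𝓘(ℂ) ω S]

/-- The velocity at time `t` of an isotopy, in the preferred chart at `a`. -/
def chartVelocity (G : ℝ → Diffeo S) (a : S) (t : ℝ) (q : ℂ) : ℂ :=
  deriv (fun s => chartAt ℂ a (G s ((G t).symm ((chartAt ℂ a).symm q)))) t

/-- The fibrewise linear Hamiltonian given by the velocity of an isotopy. -/
def velocityHamiltonian (G : ℝ → Diffeo S) (t : ℝ) (x : Cotangent S) : ℝ :=
  cov x (chartVelocity G x.proj t (chartAt ℂ x.proj x.proj))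

variable {G : ℝ → Diffeo S}
  (hG : ContMDiff (𝓘(ℝ, ℝ).prod 𝓘(ℝ, ℂ)) 𝓘(ℝ, ℂ) ∞ (fun q : ℝ × S => G q.1 q.2))

include hG in
theorem differentiableAt_chart_isotopy {a w : S} {t : ℝ} (h : G t w ∈ (chartAt ℂ a).source) :
    DifferentiableAt ℝ (fun s => chartAt ℂ a (G s w)) t := by
  rw [← mdifferentiableAt_iff_differentiableAt]
  have h1 : ContMDiff 𝓘(ℝ, ℝ) 𝓘(ℝ, ℂ) ∞ (fun s => G s w) :=
    hG.comp (contMDiff_id.prodMk contMDiff_const)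
  exact ((contMDiffAt_chart h).comp t h1.contMDiffAt).mdifferentiableAt (by simp)

-- Velocities transform as vectors and `cov x` as a covector, so their pairing is independent of the
-- chart. The definition uses a different chart at each point; this formula in one chart is what can
-- be differentiated.
include hG in
theorem velocityHamiltonian_eq (t : ℝ) {a : S} {x : Cotangent S} (hx : x.proj ∈ (chartAt ℂ a).source) :
    velocityHamiltonian G t x = (cotChart a x).2 (chartVelocity G a t (cotChart a x).1) := by
  set z := x.proj with hz
  set w := (G t).symm z with hw
  have sz := mem_chart_source ℂ z
  have e1 : (chartAt ℂ z).symm (chartAt ℂ z z) = z := (chartAt ℂ z).left_inv sz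
  have e2 : (chartAt ℂ a).symm (chartAt ℂ a z) = z := (chartAt ℂ a).left_inv hx
  have hGw : G t w = z := (G t).apply_symm_apply z
  rw [velocityHamiltonian, cotChart_apply hx, chartVelocity, chartVelocity]
  change cov x (deriv (fun s => chartAt ℂ z (G s ((G t).symm ((chartAt ℂ z).symm (chartAt ℂ z z))))) t) =
    cov x (fderiv ℝ (transition a z) (chartAt ℂ a z)
      (deriv (fun s => chartAt ℂ a (G s ((G t).symm ((chartAt ℂ a).symm (chartAt ℂ a z))))) t))
  rw [e1, e2, ← hw]
  congr 1
  have hd : HasDerivAt (fun s => chartAt ℂ a (G s w)) (deriv (fun s => chartAt ℂ a (G s w)) t) t :=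
    (differentiableAt_chart_isotopy hG (by rw [hGw]; exact hx)).hasDerivAt
  have hτ : HasFDerivAt (transition a z) (fderiv ℝ (transition a z) (chartAt ℂ a z)) (chartAt ℂ a (G t w)) := by
    rw [hGw]
    exact ((contDiffAt_transition a z ((chartAt ℂ a).map_source hx) (by rw [e2]; exact sz)).differentiableAt
      (by simp)).hasFDerivAt
  have hc : HasDerivAt (fun s => transition a z (chartAt ℂ a (G s w))) _ t :=
    HasFDerivAt.comp_hasDerivAt (f := fun s => chartAt ℂ a (G s w)) t hτ hd
  rw [← hc.deriv]
  refine Filter.EventuallyEq.deriv_eq ?_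
  have hcont : Continuous fun s => G s w := hG.continuous.comp (by fun_prop : Continuous fun s : ℝ => (s, w))
  have ev : ∀ᶠ s in 𝓝 t, G s w ∈ (chartAt ℂ a).source :=
    hcont.continuousAt.eventually_mem ((chartAt ℂ a).open_source.mem_nhds (by rw [hGw]; exact hx))
  filter_upwards [ev] with s hs
  rw [transition, (chartAt ℂ a).left_inv hs]

-- The velocity at time `t` is expressed through the point that the isotopy brings to `q`, so the
-- joint smoothness of the inverse isotopy enters.
include hG in
theorem contDiffAt_chartVelocity {a : S} {t : ℝ} {q : ℂ} (hq : q ∈ (chartAt ℂ a).target) :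
    ContDiffAt ℝ ∞ (fun p : ℝ × ℂ => chartVelocity G a p.1 p.2) (t, q) := by
  have hG' := contMDiff_isotopy_symm hG
  set w := (G t).symm ((chartAt ℂ a).symm q) with hw
  have sw := mem_chart_source ℂ w
  have ew : (chartAt ℂ w).symm (chartAt ℂ w w) = w := (chartAt ℂ w).left_inv sw
  have hGw : G t w = (chartAt ℂ a).symm q := (G t).apply_symm_apply _
  have e0 : inCharts (G t).symm a w q = chartAt ℂ w w := rfl
  have hv := contDiffAt_inCharts_family (Ψ := fun t z => (G t).symm z) hG' (t := t) (b := w) hq sw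
  have hu := contDiffAt_inCharts_family (Ψ := fun t z => G t z) hG (t := t) (a := w) (b := a)
    (mem_chart_target ℂ w) (by rw [ew, hGw]; exact (chartAt ℂ a).map_target hq)
  have h3 : ContDiffAt ℝ ∞ (Function.uncurry fun (p : ℝ × ℂ) (s : ℝ) =>
      inCharts (G s) w a (inCharts (G p.1).symm a w p.2)) ((t, q), t) :=
    ContDiffAt.comp (g := fun p : ℝ × ℂ => inCharts (G p.1) w a p.2)
      (f := fun p : (ℝ × ℂ) × ℝ => (p.2, inCharts (G p.1.1).symm a w p.1.2)) ((t, q), t) hu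
      (contDiffAt_snd.prodMk (ContDiffAt.comp (g := fun p : ℝ × ℂ => inCharts (G p.1).symm a w p.2)
        ((t, q), t) hv contDiffAt_fst))
  have h4 := ContDiffAt.fderiv (m := ∞) h3 contDiffAt_fst (by simp)
  have h5 := h4.clm_apply (contDiffAt_const (c := (1 : ℝ)))
  refine h5.congr_of_eventuallyEq ?_
  have ev : ∀ᶠ p : ℝ × ℂ in 𝓝 (t, q), (G p.1).symm ((chartAt ℂ a).symm p.2) ∈ (chartAt ℂ w).source := by
    have c : ContinuousAt (fun p : ℝ × ℂ => (G p.1).symm ((chartAt ℂ a).symm p.2)) (t, q) :=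
      ContinuousAt.comp (g := fun q : ℝ × S => (G q.1).symm q.2) hG'.continuous.continuousAt
        (continuousAt_fst.prodMk (ContinuousAt.comp (g := (chartAt ℂ a).symm)
          ((chartAt ℂ a).continuousAt_symm hq) continuousAt_snd))
    exact c.eventually_mem ((chartAt ℂ w).open_source.mem_nhds sw)
  filter_upwards [ev] with p hp
  rw [chartVelocity]
  have : (fun s => chartAt ℂ a (G s ((G p.1).symm ((chartAt ℂ a).symm p.2)))) =
      fun s => inCharts (G s) w a (inCharts (G p.1).symm a w p.2) := by
    funext s
    rw [inCharts, inCharts, (chartAt ℂ w).left_inv hp]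
  rw [this]
  rfl

include hG in
theorem contMDiff_velocityHamiltonian :
    ContMDiff (𝓘(ℝ, ℝ).prod IT) 𝓘(ℝ, ℝ) ∞ (fun q : ℝ × Cotangent S => velocityHamiltonian G q.1 q.2) := by
  rintro ⟨t, x⟩
  set a := x.proj
  have sa : x.proj ∈ (chartAt ℂ a).source := mem_chart_source ℂ _
  have e1 : (cotChart a x).1 = chartAt ℂ a x.proj := by rw [cotChart_apply sa]
  have hK : ContDiffAt ℝ ∞ (fun p : ℝ × (ℂ × Covec) => p.2.2 (chartVelocity G a p.1 p.2.1))
      (t, cotChart a x) := by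
    have h1 : ContDiffAt ℝ ∞ (fun p : ℝ × (ℂ × Covec) => chartVelocity G a p.1 p.2.1) (t, cotChart a x) := by
      refine ContDiffAt.comp (g := fun p : ℝ × ℂ => chartVelocity G a p.1 p.2)
        (f := fun p : ℝ × (ℂ × Covec) => (p.1, p.2.1)) (t, cotChart a x) ?_
        (contDiffAt_fst.prodMk (contDiffAt_fst.comp _ contDiffAt_snd))
      refine contDiffAt_chartVelocity hG ?_
      rw [e1]; exact (chartAt ℂ a).map_source sa
    exact (contDiffAt_snd.comp _ contDiffAt_snd).clm_apply h1
  have hκ : ContMDiffAt (𝓘(ℝ, ℝ).prod IT) (𝓘(ℝ, ℝ).prod 𝓘(ℝ, ℂ × Covec)) ∞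
      (fun p : ℝ × Cotangent S => (p.1, cotChart a p.2)) (t, x) :=
    contMDiffAt_fst.prodMk ((contMDiffAt_cotChart sa).comp (t, x) contMDiffAt_snd)
  have hKM := contMDiffAt_prod_self_iff.2 hK
  refine (ContMDiffAt.comp (t, x) hKM hκ).congr_of_eventuallyEq ?_
  have ev1 : ∀ᶠ q : ℝ × Cotangent S in 𝓝 (t, x), q.2.proj ∈ (chartAt ℂ a).source :=
    (continuous_proj'.comp continuous_snd).continuousAt.eventually_mem ((chartAt ℂ a).open_source.mem_nhds sa)
  filter_upwards [ev1] with q h1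
  exact velocityHamiltonian_eq hG q.1 h1

theorem IsHamiltonianFlow.of_chart {H : ℝ → Cotangent S → ℝ}
    {φ : ℝ → Diffeomorph IT IT (Cotangent S) (Cotangent S) ∞}
    (hH : ContMDiff (𝓘(ℝ, ℝ).prod IT) 𝓘(ℝ, ℝ) ∞ (fun q : ℝ × Cotangent S => H q.1 q.2))
    (hφ : ContMDiff (𝓘(ℝ, ℝ).prod IT) IT ∞ (fun q : ℝ × Cotangent S => φ q.1 q.2))
    (h0 : ∀ x, φ 0 x = x)
    (h : ∀ t x w, fderiv ℝ (fun y => H t ((cotChart (φ t x).proj).symm y)) (cotChart (φ t x).proj (φ t x)) w =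
      stdForm (deriv (fun s => cotChart (φ t x).proj (φ s x)) t) w) : IsHamiltonianFlow H φ := by
  refine ⟨hH, hφ, h0, fun t x W => ?_⟩
  have ha : (φ t x).proj ∈ (chartAt ℂ (φ t x).proj).source := mem_chart_source ℂ _
  have hHt : ContMDiff IT 𝓘(ℝ, ℝ) ∞ (H t) := hH.comp (contMDiff_const.prodMk contMDiff_id)
  have hφx : ContMDiff 𝓘(ℝ, ℝ) IT ∞ (fun s => φ s x) := hφ.comp (contMDiff_id.prodMk contMDiff_const)
  rw [symplecticForm_eq ha, mfderiv_eq_fderiv_cotChart ha ((hHt _).mdifferentiableAt (by simp))]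
  refine (h t x _).trans ?_
  congr 1
  have := mfderiv_comp_apply (I := 𝓘(ℝ, ℝ)) (I' := IT) (I'' := 𝓘(ℝ, ℂ × Covec)) t
    (g := cotChart (φ t x).proj) (f := fun s => φ s x)
    ((contMDiffAt_cotChart ha).mdifferentiableAt (by simp))
    ((hφx t).mdifferentiableAt (by simp)) (1 : ℝ)
  refine Eq.trans ?_ this
  rw [mfderiv_eq_fderiv]
  rfl

-- In charts around a point and its image at time `t`, the isotopy and its inverse become maps `u`
-- and `v` inverse to each other near the relevant points, and the Hamiltonian becomes the pairing
-- with the velocity field. Hamilton's equations are then those of `hamilton_of_lift`.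
include hG in
theorem isHamiltonianFlow_cotangentDiffeo (h0 : ∀ z, G 0 z = z) :
    IsHamiltonianFlow (velocityHamiltonian G) (fun t => cotangentDiffeo (G t)) := by
  have hG' := contMDiff_isotopy_symm hG
  refine IsHamiltonianFlow.of_chart (contMDiff_velocityHamiltonian hG)
    (contMDiff_cotangentMap_family hG hG') (fun x => ?_) fun t x W => ?_
  · have e : G 0 = Diffeomorph.refl 𝓘(ℝ, ℂ) S ∞ := Diffeomorph.ext h0
    change cotangentMap (G 0) x = x
    rw [e]
    change covector x.proj ((cov x).comp (mfderiv 𝓘(ℝ, ℂ) 𝓘(ℝ, ℂ) id x.proj)) = x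
    rw [mfderiv_id]
    exact covector_proj_cov x
  · set z := x.proj with hz
    set a := G t z with ha
    have hproj : (cotangentDiffeo (G t) x).proj = a := rfl
    rw [hproj]
    have sz : x.proj ∈ (chartAt ℂ z).source := mem_chart_source ℂ z
    have sa : G t x.proj ∈ (chartAt ℂ a).source := mem_chart_source ℂ a
    have ez : (chartAt ℂ z).symm (chartAt ℂ z z) = z := (chartAt ℂ z).left_inv sz
    have ea : (chartAt ℂ a).symm (chartAt ℂ a a) = a := (chartAt ℂ a).left_inv sa
    have tz := (chartAt ℂ z).map_source sz
    have ta := (chartAt ℂ a).map_source sa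
    set q := chartAt ℂ z z with hq
    set ξ := (cotChart z x).2 with hξ
    have e1 : (cotChart z x).1 = q := by rw [cotChart_apply sz]
    let u : ℝ × ℂ → ℂ := fun p => inCharts (G p.1) z a p.2
    let v : ℝ × ℂ → ℂ := fun p => inCharts (G p.1).symm a z p.2
    have hu : ContDiffAt ℝ ∞ u (t, q) :=
      contDiffAt_inCharts_family (Ψ := fun t z => G t z) hG tz (by rw [ez]; exact sa)
    have u0 : u (t, q) = chartAt ℂ a a := by simp only [u, inCharts, ez, ← ha]
    have hv : ContDiffAt ℝ ∞ v (t, u (t, q)) := by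
      rw [u0]
      exact contDiffAt_inCharts_family (Ψ := fun t z => (G t).symm z) hG' ta (by
        rw [ea, ha, (G t).symm_apply_apply]; exact sz)
    have cGu : ∀ᶠ p : ℝ × ℂ in 𝓝 (t, q), p.2 ∈ (chartAt ℂ z).target ∧
        G p.1 ((chartAt ℂ z).symm p.2) ∈ (chartAt ℂ a).source := by
      refine Filter.Eventually.and (continuousAt_snd.eventually_mem ((chartAt ℂ z).open_target.mem_nhds tz)) ?_
      have c : ContinuousAt (fun p : ℝ × ℂ => G p.1 ((chartAt ℂ z).symm p.2)) (t, q) :=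
        ContinuousAt.comp (g := fun q : ℝ × S => G q.1 q.2) hG.continuous.continuousAt
          (continuousAt_fst.prodMk (ContinuousAt.comp (g := (chartAt ℂ z).symm)
            ((chartAt ℂ z).continuousAt_symm tz) continuousAt_snd))
      exact c.eventually_mem ((chartAt ℂ a).open_source.mem_nhds (by simp only [ez]; exact sa))
    have cGv : ∀ᶠ p : ℝ × ℂ in 𝓝 (t, u (t, q)), p.2 ∈ (chartAt ℂ a).target ∧
        (G p.1).symm ((chartAt ℂ a).symm p.2) ∈ (chartAt ℂ z).source := by
      rw [u0]
      refine Filter.Eventually.and (continuousAt_snd.eventually_mem ((chartAt ℂ a).open_target.mem_nhds ta)) ?_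
      have c : ContinuousAt (fun p : ℝ × ℂ => (G p.1).symm ((chartAt ℂ a).symm p.2)) (t, chartAt ℂ a a) :=
        ContinuousAt.comp (g := fun q : ℝ × S => (G q.1).symm q.2) hG'.continuous.continuousAt
          (continuousAt_fst.prodMk (ContinuousAt.comp (g := (chartAt ℂ a).symm)
            ((chartAt ℂ a).continuousAt_symm ta) continuousAt_snd))
      refine c.eventually_mem ((chartAt ℂ z).open_source.mem_nhds ?_)
      simp only [ea]
      rw [ha, (G t).symm_apply_apply]; exact sz
    have hvu : ∀ᶠ p in 𝓝 (t, q), v (p.1, u p) = p.2 := by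
      filter_upwards [cGu] with p hp
      simp only [u, v, inCharts]
      rw [(chartAt ℂ a).left_inv hp.2, (G p.1).symm_apply_apply, (chartAt ℂ z).right_inv hp.1]
    have huv : ∀ᶠ p in 𝓝 (t, u (t, q)), u (p.1, v p) = p.2 := by
      filter_upwards [cGv] with p hp
      simp only [u, v, inCharts]
      rw [(chartAt ℂ z).left_inv hp.2, (G p.1).apply_symm_apply, (chartAt ℂ a).right_inv hp.1]
    have key := hamilton_of_lift ξ hu hv hvu huv W
    have eγ : (fun s => cotChart a (cotangentDiffeo (G s) x)) =ᶠ[𝓝 t]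
        fun s => (u (s, q), ξ.comp (fderiv ℝ (fun q' => v (s, q')) (u (s, q)))) := by
      have cs : Filter.Tendsto (fun s : ℝ => (s, q)) (𝓝 t) (𝓝 (t, q)) :=
        (show ContinuousAt (fun s : ℝ => (s, q)) t by fun_prop)
      filter_upwards [cs.eventually cGu] with s hs
      have hs2 : G s x.proj ∈ (chartAt ℂ a).source := by
        have := hs.2
        rwa [ez] at this
      refine Prod.ext ?_ ?_
      · rw [cotChart_apply (show (cotangentDiffeo (G s) x).proj ∈ _ from hs2)]
        simp only [u, inCharts, ez]
        rfl
      · have := cotChart_cotangentMap (G s) sz hs2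
        rw [e1] at this
        exact this
    rw [eγ.deriv_eq, stdForm]
    refine Eq.trans ?_ key
    have e2 : cotChart a (cotangentDiffeo (G t) x) =
        (u (t, q), ξ.comp (fderiv ℝ (fun q' => v (t, q')) (u (t, q)))) := eγ.self_of_nhds
    rw [e2]
    refine congrArg (fun L : ℂ × Covec →L[ℝ] ℝ => L W) (Filter.EventuallyEq.fderiv_eq ?_)
    have cy : Filter.Tendsto (fun y : ℂ × Covec => (t, y.1))
        (𝓝 (u (t, q), ξ.comp (fderiv ℝ (fun q' => v (t, q')) (u (t, q))))) (𝓝 (t, u (t, q))) :=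
      (show ContinuousAt (fun y : ℂ × Covec => (t, y.1)) _ by fun_prop)
    filter_upwards [cy.eventually cGv] with y hy
    have h1 : ((cotChart a).symm y).proj ∈ (chartAt ℂ a).source := by
      rw [cotChart_symm_proj hy.1]; exact (chartAt ℂ a).map_target hy.1
    rw [velocityHamiltonian_eq hG t h1, (cotChart a).right_inv (mem_cotChart_target.2 hy.1), chartVelocity]
    congr 2
    funext s
    simp only [u, v, inCharts]
    rw [(chartAt ℂ z).left_inv hy.2]

theorem velocityHamiltonian_odd (t : ℝ) : IsFibrewiseOdd (velocityHamiltonian G t) := by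
  intro z ξ
  rw [velocityHamiltonian, velocityHamiltonian, cov_covector, cov_covector]
  exact neg_apply _ _

/-- The Hamiltonian is linear in the fibres, hence odd, and so it is admissible in every type at
once. -/
theorem exists_hamiltonian_of_isotopic {f : Diffeo S} (hf : IsotopicToId f) :
    IsHamiltonianDiffeo IsFibrewiseOdd (cotangentDiffeo f) := by
  obtain ⟨G, hG, h0, rfl⟩ := hf
  exact ⟨velocityHamiltonian G, fun t => cotangentDiffeo (G t), velocityHamiltonian_odd,
    isHamiltonianFlow_cotangentDiffeo hG h0, rfl⟩

end

/-! ### Matrices commuting with a single chain. -/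

section

variable {m L : ℕ}

/-- The entries of a matrix, extended by zero. -/
def ent (X : Matrix (Fin m) (Fin m) ℂ) (i j : ℕ) : ℂ :=
  if h : i < m ∧ j < m then X ⟨i, h.1⟩ ⟨j, h.2⟩ else 0

theorem ent_of_lt (X : Matrix (Fin m) (Fin m) ℂ) {i j : ℕ} (hi : i < m) (hj : j < m) :
    ent X i j = X ⟨i, hi⟩ ⟨j, hj⟩ := dif_pos ⟨hi, hj⟩

theorem ent_val (X : Matrix (Fin m) (Fin m) ℂ) (i j : Fin m) : ent X i j = X i j := ent_of_lt X i.2 j.2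

theorem ent_ext {X Y : Matrix (Fin m) (Fin m) ℂ} (h : ∀ i j, i < m → j < m → ent X i j = ent Y i j) :
    X = Y := by
  ext i j
  have := h i j i.2 j.2
  rwa [ent_val, ent_val] at this

theorem ent_add (X Y : Matrix (Fin m) (Fin m) ℂ) (i j : ℕ) : ent (X + Y) i j = ent X i j + ent Y i j := by
  unfold ent; split_ifs <;> simp

theorem ent_neg (X : Matrix (Fin m) (Fin m) ℂ) (i j : ℕ) : ent (-X) i j = -ent X i j := by
  unfold ent; split_ifs <;> simp

theorem ent_smul (c : ℂ) (X : Matrix (Fin m) (Fin m) ℂ) (i j : ℕ) : ent (c • X) i j = c * ent X i j := by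
  unfold ent; split_ifs <;> simp

theorem ent_zero (i j : ℕ) : ent (0 : Matrix (Fin m) (Fin m) ℂ) i j = 0 := by
  unfold ent; split_ifs <;> simp

theorem sum_fin_eq {f : Fin m → ℂ} {g : ℕ → ℂ} {a : ℕ} (ha : a < m) (h0 : ∀ k : Fin m, (k : ℕ) ≠ a → f k = 0)
    (h1 : f ⟨a, ha⟩ = g a) : ∑ k, f k = g a := by
  rw [Finset.sum_eq_single ⟨a, ha⟩ (fun b _ hb => h0 b fun e => hb (Fin.ext e)) (by simp), h1]

theorem ent_mul_chainF (hL : L ≤ m) (X : Matrix (Fin m) (Fin m) ℂ) {i j : ℕ} (hi : i < m) (hj : j < m) :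
    ent (X * chainF m L) i j = if j + 1 < L then ent X i (j + 1) else 0 := by
  rw [ent_of_lt _ hi hj, Matrix.mul_apply]
  split_ifs with h
  · refine sum_fin_eq (g := fun k => ent X i k) (by omega : j + 1 < m) (fun k hk => ?_) ?_
    · simp [chainF, hk]
    · simp [chainF, h, ent_of_lt X hi (by omega : j + 1 < m)]
  · refine Finset.sum_eq_zero fun k _ => ?_
    simp only [chainF, Matrix.of_apply]
    rw [if_neg (by omega), mul_zero]

theorem ent_chainF_mul (X : Matrix (Fin m) (Fin m) ℂ) {i j : ℕ} (hi : i < m) (hj : j < m) :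
    ent (chainF m L * X) i j = if 1 ≤ i ∧ i < L then ent X (i - 1) j else 0 := by
  rw [ent_of_lt _ hi hj, Matrix.mul_apply]
  split_ifs with h
  · refine sum_fin_eq (g := fun k => ent X k j) (by omega : i - 1 < m) (fun k hk => ?_) ?_
    · simp only [chainF, Matrix.of_apply]
      rw [if_neg (by omega), zero_mul]
    · simp only [chainF, Matrix.of_apply]
      rw [if_pos (by omega), one_mul, ent_of_lt]
  · refine Finset.sum_eq_zero fun k _ => ?_
    simp only [chainF, Matrix.of_apply]
    rw [if_neg (by omega), zero_mul]

theorem ent_transpose_mul_chainForm (hL : L ≤ m) (X : Matrix (Fin m) (Fin m) ℂ) {i j : ℕ} (hi : i < m)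
    (hj : j < m) : ent (X.transpose * chainForm m L) i j =
      if j < L then (-1) ^ (L - 1 - j) * ent X (L - 1 - j) i else ent X j i := by
  rw [ent_of_lt _ hi hj, Matrix.mul_apply]
  split_ifs with h
  · refine sum_fin_eq (g := fun k => (-1) ^ k * ent X k i) (by omega : L - 1 - j < m) (fun k hk => ?_) ?_
    · simp only [chainForm, Matrix.of_apply, Fin.ext_iff]
      rw [if_neg (by omega), if_neg (by omega), mul_zero]
    · simp only [chainForm, Matrix.of_apply, Matrix.transpose_apply]
      rw [if_pos (by omega), ent_of_lt _ (by omega) hi, mul_comm]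
  · refine sum_fin_eq (g := fun k => ent X k i) hj (fun k hk => ?_) ?_
    · simp only [chainForm, Matrix.of_apply, Fin.ext_iff]
      rw [if_neg (by omega), if_neg (by omega), mul_zero]
    · simp only [chainForm, Matrix.of_apply, Matrix.transpose_apply, Fin.ext_iff]
      rw [if_neg (by omega), if_pos ⟨trivial, by omega⟩, ent_of_lt _ hj hi, mul_one]

theorem ent_chainForm_mul (hL : L ≤ m) (X : Matrix (Fin m) (Fin m) ℂ) {i j : ℕ} (hi : i < m) (hj : j < m) :
    ent (chainForm m L * X) i j =
      if i < L then (-1) ^ i * ent X (L - 1 - i) j else ent X i j := by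
  rw [ent_of_lt _ hi hj, Matrix.mul_apply]
  split_ifs with h
  · refine sum_fin_eq (g := fun k => (-1) ^ i * ent X k j) (by omega : L - 1 - i < m) (fun k hk => ?_) ?_
    · simp only [chainForm, Matrix.of_apply, Fin.ext_iff]
      rw [if_neg (by omega), if_neg (by omega), zero_mul]
    · simp only [chainForm, Matrix.of_apply]
      rw [if_pos (by omega), ent_of_lt _ (by omega) hj]
  · refine sum_fin_eq (g := fun k => ent X k j) hi (fun k hk => ?_) ?_
    · simp only [chainForm, Matrix.of_apply, Fin.ext_iff]
      rw [if_neg (by omega), if_neg (by omega), zero_mul]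
    · simp only [chainForm, Matrix.of_apply, Fin.ext_iff]
      rw [if_neg (by omega), if_pos ⟨trivial, by omega⟩, ent_of_lt _ hi hj, one_mul]

theorem ent_chainF_pow (hL : L ≤ m) (k : ℕ) {i j : ℕ} (hi : i < m) (hj : j < m) :
    ent (chainF m L ^ (k + 1)) i j = if i = j + (k + 1) ∧ i < L then 1 else 0 := by
  induction k generalizing j with
  | zero => rw [zero_add, pow_one, ent_of_lt _ hi hj]; rfl
  | succ k ih =>
    rw [pow_succ, ent_mul_chainF hL _ hi hj]
    split_ifs with h1 h2 h2
    · rw [ih (by omega), if_pos (by omega)]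
    · rw [ih (by omega), if_neg (by omega)]
    · omega
    · rfl

theorem ent_chainF_pow_zero (hL : L ≤ m) (hL0 : 0 < L) (k : ℕ) {i : ℕ} (hi : i < m) :
    ent (chainF m L ^ k) i 0 = if i = k ∧ i < L then 1 else 0 := by
  cases k with
  | zero =>
    rw [pow_zero, ent_of_lt _ hi (by omega), Matrix.one_apply]
    simp only [Fin.ext_iff]
    by_cases h : i = 0
    · subst h; simp [hL0]
    · simp [h]
  | succ k => rw [ent_chainF_pow hL k hi (by omega), zero_add]

theorem chainF_pow_eq_zero (hL : L ≤ m) (hL0 : 0 < L) {k : ℕ} (hk : L ≤ k) : chainF m L ^ k = 0 := by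
  obtain ⟨k, rfl⟩ : ∃ k', k = k' + 1 := ⟨k - 1, by omega⟩
  refine ent_ext fun i j hi hj => ?_
  rw [ent_chainF_pow hL k hi hj, if_neg (by omega), ent_zero]

theorem trace_chainF_pow (hL : L ≤ m) (k : ℕ) : (chainF m L ^ (k + 1)).trace = 0 := by
  refine Finset.sum_eq_zero fun i _ => ?_
  have h := ent_chainF_pow hL k i.2 i.2
  rwa [ent_val, if_neg (by omega)] at h

theorem mem_skew_iff {J X : Matrix (Fin m) (Fin m) ℂ} :
    X ∈ skewAdjointMatricesLieSubalgebra J ↔ X.transpose * J = J * -X := by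
  rw [mem_skewAdjointMatricesLieSubalgebra, mem_skewAdjointMatricesSubmodule, Matrix.IsSkewAdjoint,
    Matrix.IsAdjointPair]

theorem chainF_pow_mem_skew (hL : L ≤ m) {k : ℕ} (hk : Odd k) :
    chainF m L ^ k ∈ skewAdjointMatricesLieSubalgebra (chainForm m L) := by
  have h := mem_skew_iff.1 (skew_F m L hL)
  rw [mem_skew_iff, Matrix.transpose_pow, ← hk.neg_pow]
  have hs : SemiconjBy (chainForm m L) (-chainF m L) (chainF m L).transpose := h.symm
  exact (hs.pow_right k).symm

section Commute

variable {X : Matrix (Fin m) (Fin m) ℂ} (hL : L ≤ m) (hX : chainF m L * X = X * chainF m L)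
include hL hX

/-- Multiplication by the chain shifts rows on one side and columns on the other, so commuting makes
the large block constant along diagonals. -/
theorem commute_diag {a d : ℕ} (h : a + d < L) : ent X (a + d) d = ent X a 0 := by
  induction d with
  | zero => rfl
  | succ d ih =>
    have e1 := ent_mul_chainF hL X (by omega : a + (d + 1) < m) (by omega : d < m)
    have e2 := ent_chainF_mul (L := L) X (by omega : a + (d + 1) < m) (by omega : d < m)
    rw [if_pos (by omega)] at e1 e2
    rw [← e1, ← hX, e2, ← ih (by omega)]
    rfl

/-- Moving up a diagonal above the main one reaches the first row, where the chain on the left gives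
zero. -/
theorem commute_upper {i j : ℕ} (h : i < j) (hj : j < L) : ent X i j = 0 := by
  induction i generalizing j with
  | zero =>
    obtain ⟨j, rfl⟩ : ∃ j', j = j' + 1 := ⟨j - 1, by omega⟩
    have e1 := ent_mul_chainF hL X (by omega : 0 < m) (by omega : j < m)
    have e2 := ent_chainF_mul (L := L) X (by omega : 0 < m) (by omega : j < m)
    rw [if_pos (by omega)] at e1
    rw [if_neg (by omega)] at e2
    rw [← e1, ← hX, e2]
  | succ i ih =>
    obtain ⟨j, rfl⟩ : ∃ j', j = j' + 1 := ⟨j - 1, by omega⟩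
    have e1 := ent_mul_chainF hL X (by omega : i + 1 < m) (by omega : j < m)
    have e2 := ent_chainF_mul (L := L) X (by omega : i + 1 < m) (by omega : j < m)
    rw [if_pos (by omega)] at e1 e2
    rw [← e1, ← hX, e2]
    exact ih (by omega) (by omega)

theorem commute_block_zero (h0 : ∀ k < L, ent X k 0 = 0) {i j : ℕ} (hi : i < L) (hj : j < L) :
    ent X i j = 0 := by
  rcases lt_or_ge i j with h | h
  · exact commute_upper hL hX h hj
  · obtain ⟨a, rfl⟩ := Nat.exists_eq_add_of_le' h
    rw [commute_diag hL hX hi]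
    exact h0 a (by omega)

theorem commute_below {i j : ℕ} (hi : L ≤ i) (him : i < m) (hj : j + 1 < L) : ent X i (j + 1) = 0 := by
  have e1 := ent_mul_chainF hL X him (by omega : j < m)
  have e2 := ent_chainF_mul (L := L) X him (by omega : j < m)
  rw [if_pos hj] at e1
  rw [if_neg (by omega)] at e2
  rw [← e1, ← hX, e2]

theorem commute_right {i j : ℕ} (hi : i + 1 < L) (hj : L ≤ j + 1) (hjm : j < m) : ent X i j = 0 := by
  have e1 := ent_mul_chainF hL X (by omega : i + 1 < m) hjm
  have e2 := ent_chainF_mul (L := L) X (by omega : i + 1 < m) hjm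
  rw [if_neg (by omega)] at e1
  rw [if_pos (by omega)] at e2
  rw [hX, e1] at e2
  exact e2.symm

/-- Skewness compares the two ends of the `k`-th subdiagonal, which carry the same entry by
`commute_diag`. For even `k` the signs of the form agree there, so the entry equals its negative. -/
theorem commute_skew_even (hs : X ∈ skewAdjointMatricesLieSubalgebra (chainForm m L)) {k : ℕ} (hk : k < L)
    (hev : Even k) : ent X k 0 = 0 := by
  have h := congrArg (fun Y => ent Y (L - 1 - k) 0) (mem_skew_iff.1 hs)
  simp only [mul_neg, ent_neg] at h
  rw [ent_transpose_mul_chainForm hL _ (by omega) (by omega), ent_chainForm_mul hL _ (by omega) (by omega),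
    if_pos (by omega), if_pos (by omega), show L - 1 - (L - 1 - k) = k by omega, Nat.sub_zero] at h
  have e := commute_diag hL hX (a := k) (d := L - 1 - k) (by omega)
  rw [show k + (L - 1 - k) = L - 1 by omega] at e
  rw [e] at h
  have h2 : (-1 : ℂ) ^ (L - 1) = (-1) ^ (L - 1 - k) := by
    conv_lhs => rw [show L - 1 = (L - 1 - k) + k by omega]
    rw [pow_add, hev.neg_one_pow, mul_one]
  rw [h2] at h
  have h3 : (-1 : ℂ) ^ (L - 1 - k) ≠ 0 := pow_ne_zero _ (by norm_num)
  have h4 : (-1 : ℂ) ^ (L - 1 - k) * (2 * ent X k 0) = 0 := by linear_combination h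
  simpa [h3] using h4

/-- A skew matrix commuting with the chain is determined by the odd entries of its first column. If
there is one basis vector outside the chain, commuting leaves three new entries: the diagonal one is
zero by skewness, and the other two are negatives of each other. -/
theorem commute_skew_eq_zero (hm : L = m ∨ L + 1 = m ∧ Odd L)
    (hs : X ∈ skewAdjointMatricesLieSubalgebra (chainForm m L)) (hL0 : 0 < L)
    (h0 : ∀ k < m, Odd k → ent X k 0 = 0) : X = 0 := by
  have h1 : ∀ k < L, ent X k 0 = 0 := by
    intro k hk
    rcases Nat.even_or_odd k with h | h
    · exact commute_skew_even hL hX hs hk h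
    · exact h0 k (by omega) h
  refine ent_ext fun i j hi hj => ?_
  rw [ent_zero]
  rcases hm with rfl | ⟨rfl, hodd⟩
  · exact commute_block_zero hL hX h1 hi hj
  · have hs' := mem_skew_iff.1 hs
    have hcorner : ent X L L = 0 := by
      have h := congrArg (fun Y => ent Y L L) hs'
      simp only [mul_neg, ent_neg] at h
      rw [ent_transpose_mul_chainForm hL _ (by omega) (by omega),
        ent_chainForm_mul hL _ (by omega) (by omega), if_neg (by omega), if_neg (by omega)] at h
      linear_combination h / 2
    have hrel : ent X L 0 = -ent X (L - 1) L := by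
      have h := congrArg (fun Y => ent Y 0 L) hs'
      simp only [mul_neg, ent_neg] at h
      rw [ent_transpose_mul_chainForm hL _ (by omega) (by omega),
        ent_chainForm_mul hL _ (by omega) (by omega), if_neg (by omega), if_pos (by omega)] at h
      simpa using h
    have hL1 : ent X L 0 = 0 := h0 L (by omega) hodd
    rcases Nat.lt_succ_iff_lt_or_eq.1 hi with hi' | rfl
    · rcases Nat.lt_succ_iff_lt_or_eq.1 hj with hj' | rfl
      · exact commute_block_zero hL hX h1 hi' hj'
      · rcases (by omega : i + 1 < j ∨ i = j - 1) with h | rfl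
        · exact commute_right hL hX h (by omega) hj
        · rw [hL1] at hrel
          simpa using hrel
    · rcases Nat.lt_succ_iff_lt_or_eq.1 hj with hj' | rfl
      · cases j with
        | zero => exact hL1
        | succ j => exact commute_below hL hX le_rfl hi hj'
      · exact hcorner

end Commute

end

/-! ### The ideals of the pairs `(F, μ F)` and of their deformations. -/

section

variable {m L : ℕ}

theorem ent_aeval_chainF_zero (hL : L ≤ m) (hL0 : 0 < L) (Q : Polynomial ℂ) {i : ℕ} (hi : i < m) :
    ent (Polynomial.aeval (chainF m L) Q) i 0 = if i < L then Q.coeff i else 0 := by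
  induction Q using Polynomial.induction_on' with
  | add P Q hP hQ =>
    rw [map_add, ent_add, hP, hQ, Polynomial.coeff_add]
    split_ifs <;> simp
  | monomial n c =>
    rw [← Polynomial.C_mul_X_pow_eq_monomial, map_mul, map_pow, Polynomial.aeval_X, Polynomial.aeval_C,
      ← Algebra.smul_def, ent_smul, ent_chainF_pow_zero hL hL0 n hi, Polynomial.coeff_C_mul_X_pow]
    by_cases h : i = n <;> by_cases h2 : i < L <;> simp [h, h2]

/-- The first column of `Q(F)` lists the first `L` coefficients of `Q`, and `F ^ L = 0`. -/
theorem aeval_chainF_eq_zero (hL : L ≤ m) (hL0 : 0 < L) {Q : Polynomial ℂ} :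
    Polynomial.aeval (chainF m L) Q = 0 ↔ Polynomial.X ^ L ∣ Q := by
  constructor
  · intro h
    refine Polynomial.X_pow_dvd_iff.2 fun i hi => ?_
    have := ent_aeval_chainF_zero hL hL0 Q (by omega : i < m)
    rw [h, ent_zero, if_pos hi] at this
    exact this.symm
  · rintro ⟨R, rfl⟩
    rw [map_mul, map_pow, Polynomial.aeval_X, chainF_pow_eq_zero hL hL0 le_rfl, zero_mul]

/-- The skew endomorphism `e_0 ↦ e_L`, `e_L ↦ -e_{L-1}` that commutes with the chain of length `L`
in dimension `m = L + 1`. -/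
def corner (m L : ℕ) : Matrix (Fin m) (Fin m) ℂ :=
  Matrix.of fun i j => if (i : ℕ) = L ∧ (j : ℕ) = 0 then 1
    else if (i : ℕ) + 1 = L ∧ (j : ℕ) = L then -1 else 0

theorem ent_corner {i j : ℕ} (hi : i < m) (hj : j < m) : ent (corner m L) i j =
    if i = L ∧ j = 0 then 1 else if i + 1 = L ∧ j = L then -1 else 0 := by
  rw [ent_of_lt _ hi hj]; rfl

section Corner

variable (hm : L + 1 = m)
include hm

theorem chainF_mul_corner : chainF m L * corner m L = 0 := by
  refine ent_ext fun i j hi hj => ?_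
  rw [ent_chainF_mul _ hi hj, ent_zero]
  split_ifs with h
  · rw [ent_corner (by omega) hj, if_neg (by omega), if_neg (by omega)]
  · rfl

theorem corner_mul_chainF : corner m L * chainF m L = 0 := by
  refine ent_ext fun i j hi hj => ?_
  rw [ent_mul_chainF (by omega) _ hi hj, ent_zero]
  split_ifs with h
  · rw [ent_corner hi (by omega), if_neg (by omega), if_neg (by omega)]
  · rfl

variable (hL : 2 ≤ L)
include hL

/-- Following the basis, `e_0 ↦ e_L ↦ -e_{L-1}`, and every other path of length two dies. -/
theorem corner_mul_corner : corner m L * corner m L = -chainF m L ^ (L - 1) := by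
  refine ent_ext fun i j hi hj => ?_
  obtain ⟨l, rfl⟩ : ∃ l, L = l + 1 + 1 := ⟨L - 2, by omega⟩
  rw [ent_neg, show l + 1 + 1 - 1 = l + 1 by omega, ent_chainF_pow (by omega) l hi hj, ent_of_lt _ hi hj,
    Matrix.mul_apply]
  refine (sum_fin_eq (g := fun k => ent (corner m (l + 1 + 1)) i k * ent (corner m (l + 1 + 1)) k j)
    (by omega : l + 1 + 1 < m) (fun k hk => ?_) ?_).trans ?_
  · have hk' := k.2
    rw [← ent_val (corner m (l + 1 + 1)) k ⟨j, hj⟩, ent_corner k.2 hj, if_neg (by omega)]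
    split_ifs with h
    · rw [← ent_val (corner m (l + 1 + 1)) ⟨i, hi⟩ k, ent_corner hi k.2]
      rw [if_neg (by omega), if_neg (by omega), zero_mul]
    · rw [mul_zero]
  · rw [ent_of_lt _ hi, ent_of_lt _ _ hj]
  · rw [ent_corner hi (by omega), ent_corner (by omega) hj]
    split_ifs <;> first | omega | simp; done | simp_all

theorem corner_mem_skew (hodd : Odd L) : corner m L ∈ skewAdjointMatricesLieSubalgebra (chainForm m L) := by
  rw [mem_skew_iff]
  refine ent_ext fun i j hi hj => ?_
  have hp : (-1 : ℂ) ^ (L - 1) = 1 := by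
    obtain ⟨l, rfl⟩ := hodd
    rw [Nat.add_sub_cancel, pow_mul]; simp
  rw [mul_neg, ent_neg, ent_transpose_mul_chainForm (by omega) _ hi hj,
    ent_chainForm_mul (by omega) _ hi hj]
  split_ifs with h1 h2 h2
  · rw [ent_corner (by omega) hi, ent_corner (by omega) hj, if_neg (by omega), if_neg (by omega),
      if_neg (by omega), if_neg (by omega)]
    simp
  · rw [ent_corner (by omega) hi, ent_corner (by omega) hj, if_neg (by omega)]
    by_cases hj0 : j = 0
    · subst hj0
      rw [if_pos (by omega), if_pos (by omega), Nat.sub_zero, hp, one_mul]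
    · rw [if_neg (by omega), if_neg (by omega), if_neg (by omega)]; simp
  · rw [ent_corner (by omega) hi, ent_corner (by omega) hj, if_neg (by omega : ¬ (L - 1 - i = L ∧ j = 0))]
    by_cases hi0 : i = 0
    · subst hi0
      rw [if_pos (by omega), if_pos (by omega)]; simp
    · rw [if_neg (by omega), if_neg (by omega), if_neg (by omega)]; simp
  · rw [ent_corner (by omega) hi, ent_corner (by omega) hj, if_neg (by omega), if_neg (by omega),
      if_neg (by omega), if_neg (by omega)]
    simp

/-- Since `F S = S F = 0` and `S² = -F ^ (L - 1)`, also `S³ = 0`. All mixed products vanish, and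
corrections to `μ ^ n F ^ n` survive only in degrees one and two. -/
theorem pow_smul_chainF_add_smul_corner (μ t : ℂ) (n : ℕ) :
    (μ • chainF m L + t • corner m L) ^ n = μ ^ n • chainF m L ^ n +
      (if n = 1 then t • corner m L else 0) - if n = 2 then t ^ 2 • chainF m L ^ (L - 1) else 0 := by
  have h1 := chainF_mul_corner hm
  have h2 := corner_mul_chainF hm
  have h3 := corner_mul_corner hm hL
  have h4 : chainF m L ^ (L - 1) * chainF m L = 0 := by
    rw [← pow_succ]; exact chainF_pow_eq_zero (by omega) (by omega) (by omega)
  have h5 : ∀ k, 1 ≤ k → chainF m L ^ k * corner m L = 0 := by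
    intro k hk
    obtain ⟨k, rfl⟩ : ∃ k', k = k' + 1 := ⟨k - 1, by omega⟩
    rw [pow_succ, mul_assoc, h1, mul_zero]
  induction n with
  | zero => simp
  | succ n ih =>
    rw [pow_succ, ih]
    rcases (by omega : n = 0 ∨ n = 1 ∨ n = 2 ∨ 3 ≤ n) with rfl | rfl | rfl | hn
    · simp
    · simp only [pow_one, if_true, Nat.reduceEqDiff, if_false, sub_zero, Nat.reduceAdd]
      simp only [add_mul, mul_add, smul_mul_assoc, mul_smul_comm, h1, h2, h3, smul_zero,
        pow_two, smul_neg]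
      module
    · simp only [Nat.reduceEqDiff, if_false, if_true, Nat.reduceAdd, add_zero, sub_zero]
      simp only [sub_mul, mul_add, smul_mul_assoc, mul_smul_comm, h4, h5 2 (by norm_num),
        h5 (L - 1) (by omega), smul_zero]
      rw [← pow_succ]
      module
    · rw [if_neg (by omega), if_neg (by omega), if_neg (by omega), if_neg (by omega)]
      simp only [add_zero, sub_zero]
      simp only [mul_add, smul_mul_assoc, mul_smul_comm, h5 n (by omega), smul_zero, smul_smul, add_zero]
      rw [← pow_succ, ← pow_succ']

theorem chainF_pow_mul_pow (μ t : ℂ) (a n : ℕ) :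
    chainF m L ^ a * (μ • chainF m L + t • corner m L) ^ n = μ ^ n • chainF m L ^ (a + n) +
      (if a = 0 ∧ n = 1 then t • corner m L else 0) -
        if a = 0 ∧ n = 2 then t ^ 2 • chainF m L ^ (L - 1) else 0 := by
  rw [pow_smul_chainF_add_smul_corner hm hL]
  cases a with
  | zero => simp
  | succ a =>
    rw [mul_sub, mul_add, mul_smul_comm, ← pow_add]
    have h1 : chainF m L ^ (a + 1) * (if n = 1 then t • corner m L else 0) = 0 := by
      split_ifs
      · rw [mul_smul_comm, pow_succ, mul_assoc, chainF_mul_corner hm, mul_zero, smul_zero]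
      · exact mul_zero _
    have h2 : chainF m L ^ (a + 1) * (if n = 2 then t ^ 2 • chainF m L ^ (L - 1) else 0) = 0 := by
      split_ifs
      · rw [mul_smul_comm, ← pow_add, chainF_pow_eq_zero (by omega) (by omega) (by omega), smul_zero]
      · exact mul_zero _
    rw [h1, h2]; simp

end Corner

theorem aeval_lineRes {R : Type*} [Ring R] [Algebra ℂ R] (F : R) (μ : ℂ) (P : Poly) :
    Polynomial.aeval F (lineRes 1 μ P) =
      ∑ s ∈ P.support, P.coeff s • μ ^ s 1 • F ^ (s 0 + s 1) := by
  conv_lhs => rw [P.as_sum, map_sum, map_sum]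
  refine Finset.sum_congr rfl fun s _ => ?_
  rw [lineRes_monomial, map_mul, map_pow, Polynomial.aeval_X, Polynomial.aeval_C, ← Algebra.smul_def,
    one_pow, one_mul, mul_smul]

/-- On the pair `(F, μ F)` the two variables become `F` and `μ F`, which is the parametrized line of
slope `μ` with parameter `F`. -/
theorem evalPair_smul (F : Matrix (Fin m) (Fin m) ℂ) (μ : ℂ) (P : Poly) :
    evalPair F (μ • F) P = Polynomial.aeval F (lineRes 1 μ P) := by
  rw [aeval_lineRes, evalPair]
  refine Finset.sum_congr rfl fun s _ => ?_
  rw [smul_pow, mul_smul_comm, ← pow_add]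

theorem sum_support_ite {V : Type*} [AddCommGroup V] [Module ℂ V] (P : Poly) (d : Fin 2 →₀ ℕ) (v : V) :
    ∑ s ∈ P.support, P.coeff s • (if s = d then v else 0) = P.coeff d • v := by
  classical
  simp only [smul_ite, smul_zero, Finset.sum_ite_eq', MvPolynomial.mem_support_iff]
  split_ifs with h
  · rfl
  · rw [not_not.1 h, zero_smul]

theorem eq_single_one_iff (s : Fin 2 →₀ ℕ) (n : ℕ) : s = Finsupp.single 1 n ↔ s 0 = 0 ∧ s 1 = n := by
  constructor
  · rintro rfl; simp
  · rintro ⟨h0, h1⟩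
    ext i; fin_cases i <;> simp [h0, h1]

theorem evalPair_corner (hm : L + 1 = m) (hL : 2 ≤ L) (μ t : ℂ) (P : Poly) :
    evalPair (chainF m L) (μ • chainF m L + t • corner m L) P =
      Polynomial.aeval (chainF m L) (lineRes 1 μ P) +
        P.coeff (Finsupp.single 1 1) • t • corner m L -
        P.coeff (Finsupp.single 1 2) • t ^ 2 • chainF m L ^ (L - 1) := by
  rw [aeval_lineRes, evalPair, ← sum_support_ite P (Finsupp.single 1 1) (t • corner m L),
    ← sum_support_ite P (Finsupp.single 1 2) (t ^ 2 • chainF m L ^ (L - 1)),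
    ← Finset.sum_add_distrib, ← Finset.sum_sub_distrib]
  refine Finset.sum_congr rfl fun s _ => ?_
  rw [chainF_pow_mul_pow hm hL, ← smul_add, ← smul_sub]
  simp only [eq_single_one_iff]

/-- The entry at `(L, 0)` sees only the corner, so the coefficient of `p̄` must vanish when `t ≠ 0`.
What is left is a polynomial in the chain. -/
theorem evalPair_corner_eq_zero (hm : L + 1 = m) (hL : 2 ≤ L) {μ t : ℂ} (ht : t ≠ 0) {P : Poly} :
    evalPair (chainF m L) (μ • chainF m L + t • corner m L) P = 0 ↔
      Polynomial.X ^ L ∣ lineRes 1 μ P -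
        Polynomial.C (t ^ 2 * P.coeff (Finsupp.single 1 2)) * Polynomial.X ^ (L - 1) ∧
      P.coeff (Finsupp.single 1 1) = 0 := by
  have key : evalPair (chainF m L) (μ • chainF m L + t • corner m L) P =
      Polynomial.aeval (chainF m L) (lineRes 1 μ P -
        Polynomial.C (t ^ 2 * P.coeff (Finsupp.single 1 2)) * Polynomial.X ^ (L - 1)) +
        P.coeff (Finsupp.single 1 1) • t • corner m L := by
    rw [evalPair_corner hm hL, map_sub, map_mul, map_pow, Polynomial.aeval_X, Polynomial.aeval_C,
      ← Algebra.smul_def, smul_smul (P.coeff (Finsupp.single 1 2)), mul_comm (t ^ 2)]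
    abel
  rw [key, ← aeval_chainF_eq_zero (m := m) (by omega) (by omega : 0 < L)]
  constructor
  · intro h
    have hc : P.coeff (Finsupp.single 1 1) = 0 := by
      have := congrArg (fun Y => ent Y L 0) h
      simp only [ent_add, ent_smul, ent_zero] at this
      rw [ent_aeval_chainF_zero (by omega) (by omega) _ (by omega), if_neg (lt_irrefl L),
        ent_corner (by omega) (by omega), if_pos ⟨rfl, rfl⟩] at this
      simpa [ht] using this
    rw [hc, zero_smul, add_zero] at h
    exact ⟨h, hc⟩
  · rintro ⟨h1, h2⟩
    rw [h1, h2, zero_smul, add_zero]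

theorem coeff_lineRes_one (μ : ℂ) (k : ℕ) (P : Poly) : (lineRes 1 μ P).coeff k =
    ∑ i ∈ Finset.range (k + 1), μ ^ i * P.coeff (Finsupp.single 0 (k - i) + Finsupp.single 1 i) := by
  induction P using MvPolynomial.induction_on' with
  | add P Q hP hQ =>
    rw [map_add, Polynomial.coeff_add, hP, hQ, ← Finset.sum_add_distrib]
    simp only [MvPolynomial.coeff_add, mul_add]
  | monomial s c =>
    rw [lineRes_monomial, Polynomial.coeff_C_mul_X_pow]
    have e : ∀ i ≤ k, (s = Finsupp.single 0 (k - i) + Finsupp.single 1 i ↔ s 0 + s 1 = k ∧ i = s 1) := by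
      intro i hi
      constructor
      · rintro rfl; simp; omega
      · rintro ⟨h1, rfl⟩
        ext j; fin_cases j <;> simp; omega
    split_ifs with h
    · rw [Finset.sum_eq_single (s 1)]
      · rw [MvPolynomial.coeff_monomial, if_pos ((e _ (by omega)).2 ⟨h.symm, rfl⟩), one_pow, one_mul, mul_comm]
      · intro i hi hne
        rw [Finset.mem_range] at hi
        rw [MvPolynomial.coeff_monomial, if_neg (fun h' => hne ((e i (by omega)).1 h').2), mul_zero]
      · intro h'
        rw [Finset.mem_range] at h'; omega
    · refine (Finset.sum_eq_zero fun i hi => ?_).symm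
      rw [Finset.mem_range] at hi
      rw [MvPolynomial.coeff_monomial, if_neg (fun h' => h ((e i (by omega)).1 h').1.symm), mul_zero]

/-- The ideals `I(F, μ F + t S)`, for `F` a chain of length `L` in dimension `L + 1` and `S` the
corner, converge to the ideal of slope `μ`. -/
theorem mem_slopeIdeal_iff_limit (hm : L + 1 = m) (hL : 2 ≤ L) (μ : ℂ) (P : Poly) :
    P ∈ slopeIdeal 2 L μ ↔ ∃ Q : ℂ → Poly,
      (∀ t, t ≠ 0 → evalPair (chainF m L) (μ • chainF m L + t • corner m L) (Q t) = 0) ∧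
      (∃ d, ∀ t, (Q t).totalDegree ≤ d) ∧
      ∀ s, Filter.Tendsto (fun t => (Q t).coeff s) (𝓝[≠] 0) (𝓝 (P.coeff s)) := by
  rw [mem_slopeIdeal_two hL]
  constructor
  · rintro ⟨h1, h2⟩
    set c := P.coeff (Finsupp.single 1 2)
    have hp : (p ^ (L - 1) : Poly) = MvPolynomial.monomial (Finsupp.single 0 (L - 1)) 1 := by
      rw [MvPolynomial.X_pow_eq_monomial]
    have hne : ∀ n, (Finsupp.single 0 (L - 1) : Fin 2 →₀ ℕ) ≠ Finsupp.single 1 n := by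
      intro n h
      have := ((eq_single_one_iff _ _).1 h).1
      simp only [Finsupp.single_eq_same] at this
      omega
    have hc : ∀ n, (p ^ (L - 1) : Poly).coeff (Finsupp.single 1 n) = 0 := by
      intro n
      rw [hp, MvPolynomial.coeff_monomial, if_neg (hne n)]
    -- The added term cancels the contribution of `(t S)²`. It involves no power of `p̄`, so the
    -- coefficients that define the correction are unchanged, and it tends to zero with `t`.
    refine ⟨fun t => P + MvPolynomial.C (t ^ 2 * c) * p ^ (L - 1), fun t ht => ?_, ?_, fun s => ?_⟩
    · rw [evalPair_corner_eq_zero hm hL ht]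
      simp only [MvPolynomial.coeff_add, MvPolynomial.coeff_C_mul, hc, mul_zero, add_zero]
      refine ⟨?_, h2⟩
      simpa [c] using h1
    · refine ⟨max P.totalDegree (p ^ (L - 1) : Poly).totalDegree, fun t => ?_⟩
      refine (MvPolynomial.totalDegree_add _ _).trans (max_le_max le_rfl ?_)
      rw [← MvPolynomial.smul_eq_C_mul]
      exact MvPolynomial.totalDegree_smul_le _ _
    · simp only [MvPolynomial.coeff_add, MvPolynomial.coeff_C_mul]
      have : Continuous fun t : ℂ => P.coeff s + t ^ 2 * c * (p ^ (L - 1) : Poly).coeff s := by fun_prop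
      have h := (this.tendsto 0).mono_left (nhdsWithin_le_nhds (s := {0}ᶜ))
      simpa using h
  -- Each coefficient of the restriction to the line is a fixed finite combination of coefficients
  -- of the polynomial, so the conditions pass to the limit; the correction carries a factor `t ^
  -- 2`.
  · rintro ⟨Q, hQ, -, hlim⟩
    have hQ' : ∀ᶠ t in 𝓝[≠] (0 : ℂ), Polynomial.X ^ L ∣ lineRes 1 μ (Q t) -
        Polynomial.C (t ^ 2 * (Q t).coeff (Finsupp.single 1 2)) * Polynomial.X ^ (L - 1) ∧
        (Q t).coeff (Finsupp.single 1 1) = 0 := by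
      filter_upwards [self_mem_nhdsWithin] with t ht
      exact (evalPair_corner_eq_zero hm hL ht).1 (hQ t ht)
    constructor
    · refine Polynomial.X_pow_dvd_iff.2 fun k hk => ?_
      have l1 : Filter.Tendsto (fun t => (lineRes 1 μ (Q t)).coeff k) (𝓝[≠] 0)
          (𝓝 ((lineRes 1 μ P).coeff k)) := by
        simp only [coeff_lineRes_one]
        exact tendsto_finsetSum _ fun i _ => (hlim _).const_mul _
      have l2 : Filter.Tendsto (fun t : ℂ => (Polynomial.C (t ^ 2 * (Q t).coeff (Finsupp.single 1 2)) *
          Polynomial.X ^ (L - 1)).coeff k) (𝓝[≠] 0) (𝓝 0) := by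
        simp only [Polynomial.coeff_C_mul]
        have h : Filter.Tendsto (fun t : ℂ => t ^ 2) (𝓝[≠] 0) (𝓝 0) := by
          have := ((continuous_pow 2 : Continuous fun t : ℂ => t ^ 2).tendsto 0).mono_left
            (nhdsWithin_le_nhds (s := {0}ᶜ))
          simpa using this
        have := (h.mul (hlim (Finsupp.single 1 2))).mul_const ((Polynomial.X ^ (L - 1) : Polynomial ℂ).coeff k)
        simpa using this
      refine tendsto_nhds_unique l1 (l2.congr' ?_)
      filter_upwards [hQ'] with t ht
      have := Polynomial.X_pow_dvd_iff.1 ht.1 k hk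
      rw [Polynomial.coeff_sub, sub_eq_zero] at this
      exact this.symm
    · refine tendsto_nhds_unique (hlim _) (tendsto_const_nhds.congr' ?_)
      filter_upwards [hQ'] with t ht
      exact ht.2.symm

theorem mem_slopeIdeal_one_iff {M : ℕ} (hM : 1 ≤ M) (μ : ℂ) (P : Poly) :
    P ∈ slopeIdeal 1 M μ ↔ evalPair (chainF M M) (μ • chainF M M) P = 0 := by
  rw [evalPair_smul, aeval_chainF_eq_zero le_rfl (by omega), mem_slopeIdeal]
  refine ⟨fun h => h.1, fun h => ⟨h, mem_maxIdeal_pow.2 fun s hs => ?_⟩⟩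
  have hs0 : s = 0 := by
    rw [Nat.lt_one_iff, Nat.add_eq_zero_iff] at hs
    ext i; fin_cases i
    · exact hs.1
    · exact hs.2
  rw [hs0, ← coeff_zero_lineRes μ]
  exact Polynomial.X_pow_dvd_iff.1 h 0 (by omega)

theorem mulVec_single_zero (hm : 0 < m) (X : Matrix (Fin m) (Fin m) ℂ) (i : Fin m) :
    X.mulVec (Pi.single ⟨0, hm⟩ 1) i = ent X i 0 := by
  rw [Matrix.mulVec_single_one, Matrix.col_apply, ent_of_lt X i.2 hm]

theorem isCyclicPair_of_single_mem {A B : Matrix (Fin m) (Fin m) ℂ} {v : Fin m → ℂ}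
    (h : ∀ i, Pi.single i 1 ∈ Submodule.span ℂ
      (Set.range fun k : ℕ × ℕ => (A ^ k.1 * B ^ k.2).mulVec v)) : IsCyclicPair A B := by
  refine ⟨v, eq_top_iff.2 fun w _ => ?_⟩
  rw [pi_eq_sum_univ' w]
  exact Submodule.sum_mem _ fun i _ => Submodule.smul_mem _ _ (by simpa using h i)

theorem chainF_pow_mulVec (hL : L ≤ m) (hm : 0 < m) {i : Fin m} (hi : (i : ℕ) < L) :
    (chainF m L ^ (i : ℕ)).mulVec (Pi.single ⟨0, hm⟩ 1) = Pi.single i 1 := by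
  ext j
  rw [mulVec_single_zero hm, ent_chainF_pow_zero hL (by omega) _ j.2, Pi.single_apply]
  simp only [Fin.ext_iff]
  split_ifs <;> first | rfl | omega

theorem isCyclicPair_chainF (hm : 0 < m) (B : Matrix (Fin m) (Fin m) ℂ) : IsCyclicPair (chainF m m) B := by
  refine isCyclicPair_of_single_mem (v := Pi.single ⟨0, hm⟩ 1) fun i => Submodule.subset_span ⟨(i, 0), ?_⟩
  simp only [pow_zero, mul_one]
  exact chainF_pow_mulVec le_rfl hm i.2

/-- Powers of the chain produce `e_0, …, e_{L-1}` from `e_0`, and the missing vector is `e_L = t⁻¹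
(B - μ F) e_0`. -/
theorem isCyclicPair_corner (hm : L + 1 = m) (hL : 2 ≤ L) (μ : ℂ) {t : ℂ} (ht : t ≠ 0) :
    IsCyclicPair (chainF m L) (μ • chainF m L + t • corner m L) := by
  have hm0 : 0 < m := by omega
  refine isCyclicPair_of_single_mem (v := Pi.single ⟨0, hm0⟩ 1) fun i => ?_
  rcases lt_or_ge (i : ℕ) L with hi | hi
  · refine Submodule.subset_span ⟨(i, 0), ?_⟩
    simp only [pow_zero, mul_one]
    exact chainF_pow_mulVec (by omega) hm0 hi
  · have h1 := Submodule.subset_span (R := ℂ) (Set.mem_range_self (f := fun k : ℕ × ℕ =>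
      (chainF m L ^ k.1 * (μ • chainF m L + t • corner m L) ^ k.2).mulVec (Pi.single ⟨0, hm0⟩ 1)) (0, 1))
    have h2 := Submodule.subset_span (R := ℂ) (Set.mem_range_self (f := fun k : ℕ × ℕ =>
      (chainF m L ^ k.1 * (μ • chainF m L + t • corner m L) ^ k.2).mulVec (Pi.single ⟨0, hm0⟩ 1)) (1, 0))
    have e : (Pi.single i 1 : Fin m → ℂ) = t⁻¹ • ((chainF m L ^ 0 *
        (μ • chainF m L + t • corner m L) ^ 1).mulVec (Pi.single ⟨0, hm0⟩ 1) -
        μ • (chainF m L ^ 1 * (μ • chainF m L + t • corner m L) ^ 0).mulVec (Pi.single ⟨0, hm0⟩ 1)) := by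
      simp only [pow_zero, pow_one, one_mul, mul_one, Matrix.add_mulVec, Matrix.smul_mulVec,
        add_sub_cancel_left, smul_smul, inv_mul_cancel₀ ht, one_smul]
      ext j
      rw [mulVec_single_zero hm0, ent_corner j.2 hm0, Pi.single_apply]
      simp only [Fin.ext_iff, and_true]
      have := i.2
      have := j.2
      split_ifs <;> first | rfl | omega
    rw [e]
    exact Submodule.smul_mem _ _ (Submodule.sub_mem _ h1 (Submodule.smul_mem _ _ h2))

/-- All monomials in the pair are multiples of powers of one matrix whose `L`-th power is zero, so a
vector generates at most `L < m` dimensions. -/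
theorem not_isCyclicPair_smul (hm : L < m) (hL : 0 < L) (μ : ℂ) :
    ¬ IsCyclicPair (chainF m L) (μ • chainF m L) := by
  rintro ⟨v, hv⟩
  have hle : Submodule.span ℂ (Set.range fun k : ℕ × ℕ =>
      (chainF m L ^ k.1 * (μ • chainF m L) ^ k.2).mulVec v) ≤
      Submodule.span ℂ (Set.range fun j : Fin L => (chainF m L ^ (j : ℕ)).mulVec v) := by
    rw [Submodule.span_le]
    rintro _ ⟨⟨a, b⟩, rfl⟩
    simp only [smul_pow, mul_smul_comm, ← pow_add, Matrix.smul_mulVec]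
    refine Submodule.smul_mem _ _ ?_
    rcases lt_or_ge (a + b) L with h | h
    · exact Submodule.subset_span ⟨⟨a + b, h⟩, rfl⟩
    · rw [chainF_pow_eq_zero hm.le hL h, Matrix.zero_mulVec]
      exact Submodule.zero_mem _
  rw [hv, top_le_iff] at hle
  have h := finrank_range_le_card (R := ℂ) (fun j : Fin L => (chainF m L ^ (j : ℕ)).mulVec v)
  rw [Set.finrank, hle, finrank_top, Module.finrank_fin_fun, Fintype.card_fin] at h
  omega

end

/-! ### The principal pair: centralizers and idealic image. -/

section

namespace ClassicalType

theorem principalMap_sl2f (T : ClassicalType) :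
    (T.principalMap sl2f : Matrix (Fin T.dim) (Fin T.dim) ℂ) = chainF T.dim T.block := by
  change sl2f.val 0 0 • chainH _ _ + sl2f.val 0 1 • chainE _ _ + sl2f.val 1 0 • chainF _ _ = _
  have h00 : sl2f.val 0 0 = 0 := by simp [sl2f]
  have h01 : sl2f.val 0 1 = 0 := by simp [sl2f]
  have h10 : sl2f.val 1 0 = 1 := by simp [sl2f]
  rw [h00, h01, h10, zero_smul, zero_smul, one_smul, zero_add, zero_add]

theorem mem_centralizer {T : ClassicalType} {A X : T.lieAlg} :
    X ∈ centralizer T A ↔ A.val * X.val = X.val * A.val := by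
  rw [centralizer, LinearMap.mem_ker]
  change ⁅A, X⁆ = 0 ↔ _
  rw [← sub_eq_zero (a := A.val * X.val), ← Ring.lie_def, ← LieSubalgebra.coe_bracket,
    ZeroMemClass.coe_eq_zero]

theorem finrank_centralizer_of_coords {T : ClassicalType} {A : T.lieAlg} (idx : ℕ → ℕ)
    (hinj : ∀ X ∈ centralizer T A, (∀ i < T.rank, ent X.val (idx i) 0 = 0) → X = 0)
    (hsurj : ∀ i < T.rank, ∃ X ∈ centralizer T A,
      ∀ j < T.rank, ent X.val (idx j) 0 = if j = i then 1 else 0) :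
    Module.finrank ℂ (centralizer T A) = T.rank := by
  let c : centralizer T A →ₗ[ℂ] (Fin T.rank → ℂ) :=
    { toFun := fun X j => ent X.val.val (idx j) 0
      map_add' := fun X Y => funext fun j => ent_add _ _ _ _
      map_smul' := fun a X => funext fun j => ent_smul _ _ _ _ }
  have hc : Function.Bijective c := by
    constructor
    · refine (injective_iff_map_eq_zero c).2 fun X hX => ?_
      exact Subtype.ext (hinj X.1 X.2 fun i hi => congrFun hX ⟨i, hi⟩)
    · rw [← LinearMap.range_eq_top, eq_top_iff]
      intro w _
      rw [pi_eq_sum_univ' w]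
      refine Submodule.sum_mem _ fun i _ => Submodule.smul_mem _ _ ?_
      obtain ⟨X, hX, h⟩ := hsurj i i.2
      refine ⟨⟨X, hX⟩, funext fun j => (h j j.2).trans ?_⟩
      simp only [Pi.single_apply, Fin.ext_iff, eq_comm]
  rw [(LinearEquiv.ofBijective c hc).finrank_eq, Module.finrank_fin_fun]

theorem mem_centralizer_pow {T : ClassicalType} {A X : T.lieAlg} {k : ℕ} (h : X.val = A.val ^ k) :
    X ∈ centralizer T A := by
  rw [mem_centralizer, h]
  exact (Commute.self_pow A.val k).eq

/-- The commutant of a full Jordan block consists of the polynomials in it. Trace zero removes the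
constant term and leaves the powers `1, …, r`. -/
theorem finrank_centralizer_A {r : ℕ} :
    Module.finrank ℂ (centralizer (A r) ((A r).principalMap sl2f)) = r := by
  refine finrank_centralizer_of_coords (T := A r) (fun i => i + 1) (fun X hX h => ?_) fun i hi => ?_
  · rw [mem_centralizer, principalMap_sl2f] at hX
    have hd : ∀ d < r + 1, ent X.val d d = ent X.val 0 0 := fun d hd => by
      have := commute_diag le_rfl hX (a := 0) (d := d) (by rwa [zero_add])
      rwa [zero_add] at this
    have h00 : ent X.val 0 0 = 0 := by
      have ht : X.val.trace = 0 := trace_eq_zero_of_mem_sl X.2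
      have : X.val.trace = ((r : ℂ) + 1) * ent X.val 0 0 := by
        rw [Matrix.trace, Finset.sum_congr rfl (g := fun _ => ent X.val 0 0) fun i _ => ?_]
        · rw [Finset.sum_const, Finset.card_univ, Fintype.card_fin, nsmul_eq_mul]
          simp [dim]
        · rw [Matrix.diag_apply, ← hd i i.2]
          exact (ent_val X.val i i).symm
      rw [this] at ht
      exact (mul_eq_zero.1 ht).resolve_left (by exact_mod_cast Nat.succ_ne_zero r)
    refine Subtype.ext (ent_ext fun i j hi hj => ?_)
    refine (commute_block_zero le_rfl hX (fun k hk => ?_) hi hj).trans (ent_zero i j).symm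
    cases k with
    | zero => exact h00
    | succ k => exact h k (Nat.lt_of_succ_lt_succ hk)
  · refine ⟨⟨chainF (A r).dim (A r).block ^ (i + 1), trace_chainF_pow le_rfl i⟩, ?_, fun j hj => ?_⟩
    · refine mem_centralizer_pow (k := i + 1) ?_
      rw [principalMap_sl2f]
    · simp only [rank] at hi hj
      refine (ent_chainF_pow_zero (m := r + 1) (L := r + 1) le_rfl (by omega) (i + 1)
        (by omega : j + 1 < r + 1)).trans ?_
      split_ifs <;> first | rfl | omega

/-- The odd powers of the nilpotent span the centralizer in types `B` and `C`. In type `D` there is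
one odd power too few below the block size, and `corner` supplies the last direction. -/
theorem finrank_centralizer_skew {T : ClassicalType}
    (hT : T.lieAlg = skewAdjointMatricesLieSubalgebra (chainForm T.dim T.block))
    (h2 : T.block = T.dim ∨ T.block + 1 = T.dim ∧ Odd T.block)
    (hb : T.dim = 2 * T.rank ∨ T.dim = 2 * T.rank + 1 ∧ T.block = T.dim) (hL : 2 ≤ T.block) :
    Module.finrank ℂ (centralizer T (T.principalMap sl2f)) = T.rank := by
  refine finrank_centralizer_of_coords (fun i => 2 * i + 1) (fun X hX h => ?_) fun i hi => ?_
  · rw [mem_centralizer, principalMap_sl2f] at hX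
    refine Subtype.ext (commute_skew_eq_zero T.block_le_dim hX h2 (hT ▸ X.2) (by omega) ?_)
    rintro k hk ⟨i, rfl⟩
    exact h i (by omega)
  · by_cases hi' : 2 * i + 1 < T.block
    · refine ⟨⟨chainF T.dim T.block ^ (2 * i + 1), ?_⟩, ?_, fun j hj => ?_⟩
      · rw [hT]
        exact chainF_pow_mem_skew T.block_le_dim ⟨i, rfl⟩
      · refine mem_centralizer_pow (k := 2 * i + 1) ?_
        rw [principalMap_sl2f]
      · refine (ent_chainF_pow_zero T.block_le_dim (by omega) (2 * i + 1)
          (by omega : 2 * j + 1 < T.dim)).trans ?_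
        split_ifs <;> first | rfl | omega
    -- The index `2 i + 1` can reach the block size only in type `D`, for the last `i`; there the
    -- first column of `corner` has its single entry.
    · have hm : T.block + 1 = T.dim := by omega
      refine ⟨⟨corner T.dim T.block, ?_⟩, ?_, fun j hj => ?_⟩
      · rw [hT]
        exact corner_mem_skew hm hL (h2.resolve_left (by omega)).2
      · rw [mem_centralizer, principalMap_sl2f]
        exact (chainF_mul_corner hm).trans (corner_mul_chainF hm).symm
      · refine (ent_corner (by omega : 2 * j + 1 < T.dim) (by omega)).trans ?_
        split_ifs <;> first | rfl | omega

theorem finrank_centralizer_principal {T : ClassicalType} (hT : T.Admissible) :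
    Module.finrank ℂ (centralizer T (T.principalMap sl2f)) = T.rank := by
  cases T with
  | A r => exact finrank_centralizer_A
  | B r =>
    have hT' : 1 ≤ r := hT
    exact finrank_centralizer_skew rfl (.inl rfl) (.inr ⟨rfl, rfl⟩) (by simp only [block]; omega)
  | C r =>
    have hT' : 1 ≤ r := hT
    exact finrank_centralizer_skew rfl (.inl rfl) (.inl rfl) (by simp only [block]; omega)
  | D r =>
    have hT' : 3 ≤ r := hT
    refine finrank_centralizer_skew rfl (.inr ⟨?_, r - 1, ?_⟩) (.inl rfl) ?_ <;>
      simp only [block, dim] <;> omega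

theorem one_le_block {T : ClassicalType} (hT : T.Admissible) : 1 ≤ T.block := by
  cases T <;> simp only [Admissible, block] at hT ⊢ <;> omega

theorem principalMap_smul_sl2f (T : ClassicalType) (μ : ℂ) :
    (T.principalMap (μ • sl2f) : Matrix (Fin T.dim) (Fin T.dim) ℂ) = μ • chainF T.dim T.block := by
  rw [← principalMap_sl2f, map_smul]
  rfl

/-- The second element is a multiple of the first, so whatever commutes with the first commutes with
both. Regularity is taken from the first, since `μ` may vanish at a point. -/
theorem inRegularZeroFibre_principal {T : ClassicalType} (hT : T.Admissible) (μ : ℂ) :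
    InRegularZeroFibre T (T.principalMap sl2f) (T.principalMap (μ • sl2f)) := by
  have hnil : IsNilpotent (chainF T.dim T.block) :=
    ⟨T.block, chainF_pow_eq_zero T.block_le_dim (one_le_block hT) le_rfl⟩
  refine ⟨?_, ?_, ?_, ?_, .inl (finrank_centralizer_principal hT)⟩
  · rw [map_smul, lie_smul, lie_self, smul_zero]
  · rw [principalMap_sl2f]; exact hnil
  · rw [principalMap_smul_sl2f]; exact hnil.smul μ
  · have : centralizer T (T.principalMap sl2f) ≤ centralizer T (T.principalMap (μ • sl2f)) := by
      intro X hX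
      rw [mem_centralizer, principalMap_sl2f] at hX
      rw [mem_centralizer, principalMap_smul_sl2f, smul_mul_assoc, hX, mul_smul_comm]
    rw [inf_eq_left.2 this]
    exact finrank_centralizer_principal hT

/-- The order of vanishing at the zero-section of the elements of a `𝔤`-complex structure. -/
def order : ClassicalType → ℕ
  | D _ => 2
  | _ => 1

theorem isIdealicImage_of_block_eq {T : ClassicalType} (h : T.block = T.dim) (hm : 1 ≤ T.dim) (μ : ℂ) :
    IsIdealicImage T (T.principalMap sl2f) (T.principalMap (μ • sl2f)) (slopeIdeal 1 T.block μ) := by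
  left
  rw [principalMap_sl2f, principalMap_smul_sl2f, h]
  exact ⟨isCyclicPair_chainF hm _, fun P => mem_slopeIdeal_one_iff hm μ P⟩

theorem isIdealicImage_D {r : ℕ} (hr : 3 ≤ r) (μ : ℂ) :
    IsIdealicImage (D r) ((D r).principalMap sl2f) ((D r).principalMap (μ • sl2f))
      (slopeIdeal 2 (D r).block μ) := by
  have hm : (D r).block + 1 = (D r).dim := by simp only [block, dim]; omega
  have hL : 2 ≤ (D r).block := by simp only [block]; omega
  right
  have hS : corner (D r).dim (D r).block ∈ (D r).lieAlg :=
    corner_mem_skew hm hL ⟨r - 1, by simp only [block]; omega⟩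
  have hB : ∀ t : ℂ, ((D r).principalMap (μ • sl2f) + t • (⟨_, hS⟩ : (D r).lieAlg)).val =
      μ • chainF (D r).dim (D r).block + t • corner (D r).dim (D r).block := fun t => by
    rw [← principalMap_smul_sl2f]; rfl
  refine ⟨?_, ⟨_, hS⟩, ?_, fun t ht => ?_, fun P => ?_⟩
  · rw [principalMap_sl2f, principalMap_smul_sl2f]
    exact not_isCyclicPair_smul (by omega) (by omega) μ
  · refine mem_centralizer.2 ?_
    rw [principalMap_sl2f]
    exact (chainF_mul_corner hm).trans (corner_mul_chainF hm).symm
  · rw [hB, principalMap_sl2f]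
    exact isCyclicPair_corner hm hL μ ht
  · simp only [hB, principalMap_sl2f]
    exact mem_slopeIdeal_iff_limit hm hL μ P

theorem isIdealicImage_principal {T : ClassicalType} (hT : T.Admissible) (μ : ℂ) :
    IsIdealicImage T (T.principalMap sl2f) (T.principalMap (μ • sl2f)) (slopeIdeal T.order T.block μ) := by
  have h1 := one_le_block hT
  cases T with
  | A r => exact isIdealicImage_of_block_eq (T := A r) rfl h1 μ
  | B r => exact isIdealicImage_of_block_eq (T := B r) rfl h1 μ
  | C r => exact isIdealicImage_of_block_eq (T := C r) rfl h1 μ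
  | D r => exact isIdealicImage_D hT μ

end ClassicalType

end

/-! ### The moduli spaces and the embedding of Teichmüller space. -/

section

section Structures

variable {S : Type*} [TopologicalSpace S] [ChartedSpace ℂ S] [IsManifold 𝓘(ℂ) ω S]

/-- The family of the ideals of slope `μ`. -/
def slopeSection [T2Space S] (μ : Beltrami S) {k M m : ℕ} (hk : 1 ≤ k)
    (hm : ∀ c : ℂ, Module.finrank ℂ (Poly ⧸ slopeIdeal k M c) = m) : HilbSection m S where
  ideal z := slopeIdeal k M (μ.toFun z)
  codim _ := hm _
  support _ := slopeIdeal_support hk _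
  smooth _ _ hP := slopeIdeal_smooth μ k M m _ hP

/-- The Beltrami differential of a family of ideals that have a slope. -/
def slopeBeltrami {m k : ℕ} (hk : k = 1 ∨ k = 2) (hkm : k + 1 ≤ m) (I : HilbSection m S)
    (h : ∀ z, ∃ c : ℂ, ‖c‖ < 1 ∧ HasSlope k (I.ideal z) c) : Beltrami S where
  toFun z := (h z).choose
  norm_lt_one z := (h z).choose_spec.1
  smooth := contMDiff_of_chartSlope (contDiffAt_slope hk hkm I fun z => (h z).choose_spec.2)

theorem hasSlope_slopeBeltrami {m k : ℕ} (hk : k = 1 ∨ k = 2) (hkm : k + 1 ≤ m) (I : HilbSection m S)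
    (h : ∀ z, ∃ c : ℂ, ‖c‖ < 1 ∧ HasSlope k (I.ideal z) c) (z : S) :
    HasSlope k (I.ideal z) ((slopeBeltrami hk hkm I h).toFun z) := (h z).choose_spec.2

theorem Beltrami.ext_toFun {μ μ' : Beltrami S} (h : ∀ z, μ.toFun z = μ'.toFun z) : μ = μ' := by
  cases μ; cases μ'
  congr
  exact funext h

theorem IsHamiltonianDiffeo.mono {c c' : (Cotangent S → ℝ) → Prop} (hc : ∀ H, c H → c' H)
    {φ : Diffeomorph IT IT (Cotangent S) (Cotangent S) ∞} (h : IsHamiltonianDiffeo c φ) :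
    IsHamiltonianDiffeo c' φ := by
  obtain ⟨H, Φ, h1, h2, h3⟩ := h
  exact ⟨H, Φ, fun t => hc _ (h1 t), h2, h3⟩

/-- A set of families of ideals that have a slope, among them the families of slope ideals, modulo
higher diffeomorphisms contains Teichmüller space. -/
theorem exists_injective_moduli {X : Type*} {m k M : ℕ} (hk : k = 1 ∨ k = 2) (hkm : k + 1 ≤ m)
    (toSection : X → HilbSection m S) (c : (Cotangent S → ℝ) → Prop)
    (hc : ∀ H, c H → VanishesOnZeroSection H) (hc' : ∀ H, IsFibrewiseOdd H → c H)
    (hslope : ∀ (I : X) (z : S), ∃ a : ℂ, ‖a‖ < 1 ∧ HasSlope k ((toSection I).ideal z) a)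
    (ofSlope : Beltrami S → X)
    (hof : ∀ (μ : Beltrami S) (z : S), (toSection (ofSlope μ)).ideal z = slopeIdeal k M (μ.toFun z))
    (hofs : ∀ (μ : Beltrami S) (z : S), HasSlope k ((toSection (ofSlope μ)).ideal z) (μ.toFun z)) :
    ∃ ψ : Teichmuller S → Quot (fun I J : X =>
        ∃ φ, IsHamiltonianDiffeo c φ ∧ Carries φ (toSection I) (toSection J)),
      Function.Injective ψ ∧ ∀ μ, ψ (Teichmuller.mk μ) = Quot.mk _ (ofSlope μ) := by
  let slope : X → Beltrami S := fun I => slopeBeltrami hk hkm (toSection I) (hslope I)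
  have hs : ∀ I z, HasSlope k ((toSection I).ideal z) ((slope I).toFun z) := fun I =>
    hasSlope_slopeBeltrami hk hkm (toSection I) (hslope I)
  -- An identification by an isotopically trivial `f` is realized on the ideals by the cotangent
  -- lift of `f`.
  refine ⟨Quot.map ofSlope fun μ μ' ⟨f, hf, hi⟩ => ⟨cotangentDiffeo f,
    (exists_hamiltonian_of_isotopic hf).mono hc', carries_cotangentDiffeo hi (hof μ) (hof μ')⟩, ?_,
    fun μ => rfl⟩
  -- Taking the slope descends to the moduli space, and the slope of a slope family is the given
  -- Beltrami differential by uniqueness.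
  refine Function.LeftInverse.injective (g := Quot.map slope fun I J ⟨φ, hφ, h⟩ =>
    exists_identifies_of_carries hk hkm (hφ.mono hc) h (hs I) (hs J)) ?_
  rintro ⟨μ⟩
  exact congrArg (Quot.mk _) (Beltrami.ext_toFun fun z =>
    (hs (ofSlope μ) z).unique (by omega) (hofs μ z))

/-- The `n`-complex structure `(μ, 0, …, 0)`. -/
def NComplexStructure.ofBeltrami [T2Space S] {n : ℕ} (hn : 2 ≤ n) (μ : Beltrami S) :
    NComplexStructure n S where
  toHilbSection := slopeSection (k := 1) (M := n) μ le_rfl (finrank_slopeIdeal_one (by omega))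
  reality z := slopeIdeal_reality_one (μ.norm_lt_one z)
  compatible z := ⟨Pi.single 2 (μ.toFun z), by rw [Pi.single_eq_same]; exact μ.norm_lt_one z,
    (genericIdeal_single hn _).symm⟩

theorem exists_injective_nModuli [T2Space S] {n : ℕ} (hn : 2 ≤ n) :
    ∃ ψ : Teichmuller S → NModuli n S, Function.Injective ψ ∧
      ∀ μ : Beltrami S, ∃ I : NComplexStructure n S,
        (∀ z, I.ideal z = genericIdeal n (Pi.single 2 (μ.toFun z))) ∧
        ψ (Teichmuller.mk μ) = NModuli.mk I := by
  have hof : ∀ (μ : Beltrami S) (z : S), (NComplexStructure.ofBeltrami hn μ).ideal z =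
      genericIdeal n (Pi.single 2 (μ.toFun z)) := fun μ z => (genericIdeal_single hn _).symm
  obtain ⟨ψ, hψ, h⟩ := exists_injective_moduli (k := 1) (M := n) (.inl rfl) hn
    (fun I : NComplexStructure n S => I.toHilbSection) VanishesOnZeroSection (fun _ h => h)
    (fun _ h => h.vanishesOnZeroSection)
    (fun I z => by
      obtain ⟨μ, h1, h2⟩ := I.compatible z
      exact ⟨μ 2, h1, h2 ▸ hasSlope_genericIdeal hn μ⟩)
    (NComplexStructure.ofBeltrami hn) (fun μ z => rfl)
    (fun μ z => by
      have h := hasSlope_genericIdeal hn (Pi.single 2 (μ.toFun z))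
      rw [Pi.single_eq_same] at h
      exact (hof μ z).symm ▸ h)
  exact ⟨ψ, hψ, fun μ => ⟨NComplexStructure.ofBeltrami hn μ, hof μ, h μ⟩⟩

namespace ClassicalType

theorem finrank_slopeIdeal {T : ClassicalType} (hT : T.Admissible) (c : ℂ) :
    Module.finrank ℂ (Poly ⧸ slopeIdeal T.order T.block c) = T.dim := by
  cases T with
  | D r =>
    have hr : 3 ≤ r := hT
    refine (finrank_slopeIdeal_two (M := 2 * r - 1) (by omega) c).trans ?_
    simp only [dim]; omega
  | _ => exact finrank_slopeIdeal_one (one_le_block hT) c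

theorem weylInvariant_slopeIdeal (T : ClassicalType) (c : ℂ) :
    T.WeylInvariant (slopeIdeal T.order T.block c) := by
  cases T with
  | A r => trivial
  | _ => exact fun P hP => slopeIdeal_neg hP

theorem slopeIdeal_reality (T : ClassicalType) {c : ℂ} (hc : ‖c‖ < 1) :
    slopeIdeal T.order T.block c ⊔ (slopeIdeal T.order T.block c).map conjPoly = T.realIdeal := by
  cases T with
  | D r => exact slopeIdeal_reality_two hc
  | _ => exact slopeIdeal_reality_one hc

theorem compatibleIdeal_slopeIdeal {T : ClassicalType} (hT : T.Admissible) {c : ℂ} (hc : ‖c‖ < 1) :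
    T.CompatibleIdeal (slopeIdeal T.order T.block c) := by
  cases T with
  | A r => exact ⟨Pi.single 2 c, by rwa [Pi.single_eq_same], (genericIdeal_single (Nat.succ_le_succ hT) c).symm⟩
  | B r =>
    have hr : 1 ≤ r := hT
    exact ⟨Pi.single 2 c, by rwa [Pi.single_eq_same], (genericIdeal_single (n := 2 * r + 1) (by omega) c).symm⟩
  | C r =>
    have hr : 1 ≤ r := hT
    exact ⟨Pi.single 2 c, by rwa [Pi.single_eq_same], (genericIdeal_single (n := 2 * r) (by omega) c).symm⟩
  | D r =>
    have hr : 3 ≤ r := hT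
    exact ⟨Pi.single 2 c, Pi.single 2 (c ^ 2), by rwa [Pi.single_eq_same],
      (genericIdealD_single (by omega) c).symm⟩

theorem order_eq (T : ClassicalType) : T.order = 1 ∨ T.order = 2 := by
  cases T <;> simp [order]

theorem order_lt_dim {T : ClassicalType} (hT : T.Admissible) : T.order + 1 ≤ T.dim := by
  cases T <;> simp only [Admissible, order, dim] at hT ⊢ <;> omega

/-- The codimension matters in type `D`: the generators alone do not tie `ν₂` to `μ₂`, and without
`ν₂ = μ₂²` the quadratic parts have no common linear factor of slope `μ₂`. -/
theorem CompatibleIdeal.hasSlope {T : ClassicalType} (hT : T.Admissible) {I : Ideal Poly}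
    (h : T.CompatibleIdeal I) (hI : Module.finrank ℂ (Poly ⧸ I) = T.dim) :
    ∃ c : ℂ, ‖c‖ < 1 ∧ HasSlope T.order I c := by
  have hd := order_lt_dim hT
  cases T with
  | A r =>
    obtain ⟨μ, h1, rfl⟩ := h
    exact ⟨μ 2, h1, hasSlope_genericIdeal hd μ⟩
  | B r =>
    obtain ⟨μ, h1, rfl⟩ := h
    exact ⟨μ 2, h1, hasSlope_genericIdeal hd μ⟩
  | C r =>
    obtain ⟨μ, h1, rfl⟩ := h
    exact ⟨μ 2, h1, hasSlope_genericIdeal hd μ⟩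
  | D r =>
    obtain ⟨μ, ν, h1, rfl⟩ := h
    have hr : 3 ≤ r := hT
    exact ⟨μ 2, h1, hasSlope_genericIdealD (by omega) (nu_eq_of_finrank hr hI)⟩

theorem hasSlope_slopeIdeal {T : ClassicalType} (hT : T.Admissible) (c : ℂ) :
    HasSlope T.order (slopeIdeal T.order T.block c) c := by
  have hd := order_lt_dim hT
  cases T with
  | A r =>
    have h := hasSlope_genericIdeal hd (Pi.single 2 c)
    rwa [genericIdeal_single hd, Pi.single_eq_same] at h
  | B r =>
    have h := hasSlope_genericIdeal hd (Pi.single 2 c)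
    rwa [genericIdeal_single hd, Pi.single_eq_same] at h
  | C r =>
    have h := hasSlope_genericIdeal hd (Pi.single 2 c)
    rwa [genericIdeal_single hd, Pi.single_eq_same] at h
  | D r =>
    have hr : 2 ≤ r := (by decide : 2 ≤ 3).trans hT
    have h := hasSlope_genericIdealD hr (μ := Pi.single 2 c) (ν := Pi.single 2 (c ^ 2))
      (by rw [Pi.single_eq_same, Pi.single_eq_same])
    rwa [genericIdealD_single hr, Pi.single_eq_same] at h

theorem _root_.HigherTeich.IsFibrewiseOdd.admissibleHamiltonian {T : ClassicalType} {H : Cotangent S → ℝ}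
    (h : IsFibrewiseOdd H) : T.AdmissibleHamiltonian H := by
  cases T with
  | A r => exact h.vanishesOnZeroSection
  | _ => exact h

end ClassicalType

/-- The `𝔤`-complex structure of slope `μ`. -/
def GComplexStructure.ofBeltrami [T2Space S] {T : ClassicalType} (hT : T.Admissible) (μ : Beltrami S) :
    GComplexStructure T S where
  toHilbSection := slopeSection (k := T.order) (M := T.block) μ (by have := T.order_eq; omega)
    (ClassicalType.finrank_slopeIdeal hT)
  weyl _ := T.weylInvariant_slopeIdeal _
  reality z := T.slopeIdeal_reality (μ.norm_lt_one z)
  compatible z := ClassicalType.compatibleIdeal_slopeIdeal hT (μ.norm_lt_one z)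

theorem exists_injective_gModuli [T2Space S] {T : ClassicalType} (hT : T.Admissible) :
    ∃ ψ : Teichmuller S → GModuli T S, Function.Injective ψ ∧
      ∀ μ : Beltrami S, ∃ I : GComplexStructure T S,
        (∀ z, InRegularZeroFibre T (T.principalMap sl2f) (T.principalMap (μ.toFun z • sl2f)) ∧
          IsIdealicImage T (T.principalMap sl2f) (T.principalMap (μ.toFun z • sl2f)) (I.ideal z)) ∧
        ψ (Teichmuller.mk μ) = GModuli.mk I := by
  obtain ⟨ψ, hψ, h⟩ := exists_injective_moduli (k := T.order) (M := T.block) T.order_eq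
    (ClassicalType.order_lt_dim hT) (fun I : GComplexStructure T S => I.toHilbSection) T.AdmissibleHamiltonian
    (fun _ h => h.vanishesOnZeroSection) (fun _ h => h.admissibleHamiltonian)
    (fun I z => (I.compatible z).hasSlope hT (I.codim z))
    (GComplexStructure.ofBeltrami hT) (fun μ z => rfl) (fun μ z => ClassicalType.hasSlope_slopeIdeal hT _)
  exact ⟨ψ, hψ, fun μ => ⟨GComplexStructure.ofBeltrami hT μ, fun z =>
    ⟨ClassicalType.inRegularZeroFibre_principal hT _, ClassicalType.isIdealicImage_principal hT _⟩, h μ⟩⟩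

end Structures

end

end

end HigherTeich

theorem mainTheorem11 (S : Type*) [TopologicalSpace S] [T2Space S] [CompactSpace S]
    [ConnectedSpace S] [ChartedSpace ℂ S] [IsManifold 𝓘(ℂ) ω S] :
    (∀ n : ℕ, 2 ≤ n → ∃ ψ : HigherTeich.Teichmuller S → HigherTeich.NModuli n S,
      Function.Injective ψ ∧
      ∀ μ : HigherTeich.Beltrami S, ∃ I : HigherTeich.NComplexStructure n S,
        (∀ z, I.ideal z = HigherTeich.genericIdeal n (Pi.single 2 (μ.toFun z))) ∧
        ψ (HigherTeich.Teichmuller.mk μ) = HigherTeich.NModuli.mk I) ∧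
    (∀ T : HigherTeich.ClassicalType, T.Admissible →
      ∃ ψ : HigherTeich.Teichmuller S → HigherTeich.GModuli T S,
      Function.Injective ψ ∧
      ∀ μ : HigherTeich.Beltrami S, ∃ I : HigherTeich.GComplexStructure T S,
        (∀ z,
          HigherTeich.InRegularZeroFibre T (T.principalMap HigherTeich.sl2f)
            (T.principalMap (μ.toFun z • HigherTeich.sl2f)) ∧
          HigherTeich.IsIdealicImage T (T.principalMap HigherTeich.sl2f)
            (T.principalMap (μ.toFun z • HigherTeich.sl2f)) (I.ideal z)) ∧
        ψ (HigherTeich.Teichmuller.mk μ) = HigherTeich.GModuli.mk I) := by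
  exact ⟨fun _ hn => HigherTeich.exists_injective_nModuli hn,
    fun _ hT => HigherTeich.exists_injective_gModuli hT⟩
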